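/- Let $n\geq 1$ and $t\geq 2$ be integers such that either $n+1$ is odd, or $n+1$ and $t$ are both even. Let $\Omega S^{n+1}$ be the space of loops in the sphere $S^{n+1}$ based at a point of $S^{n+1}$, with the compact-open topology. Then every continuous map $f:\Omega S^{n+1}\to S^{tn}$ induces the zero homomorphism $f_*=0:\widetilde H_i(\Omega S^{n+1};k)\to\widetilde H_i(S^{tn};k)$ in reduced singular homology, for every $i\geq 0$ and for both $k=\mathbb Z$ and $k=\mathbb Z/2$. (Reduced homology $\widetilde H_i(X;k)$ is the kernel of $H_i(X;k)\to H_i(\mathrm{pt};k)$; it equals $H_i(X;k)$ for $i>0$.) -/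

import Mathlib

open CategoryTheory AlgebraicTopology

noncomputable section

/-- The standard unit sphere `S^d` in `ℝ^(d+1)`, with the subspace topology. -/
abbrev StdSphere (d : ℕ) : Type :=
  Metric.sphere (0 : EuclideanSpace ℝ (Fin (d + 1))) 1

/-- Singular homology `H_i(X; k)` of a topological space, as a `k`-module. -/
abbrev singularHomology (k : Type) [CommRing k] (i : ℕ)
    (X : Type) [TopologicalSpace X] : ModuleCat.{0} k :=
  ((singularHomologyFunctor (ModuleCat.{0} k) i).obj (ModuleCat.of k k)).obj (TopCat.of X)

/-- The map `f_* : H_i(X; k) → H_i(Y; k)` induced by a continuous map `f : X → Y`. -/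
def singularHomologyMap (k : Type) [CommRing k] (i : ℕ)
    {X Y : Type} [TopologicalSpace X] [TopologicalSpace Y] (f : C(X, Y)) :
    singularHomology k i X →ₗ[k] singularHomology k i Y :=
  (((singularHomologyFunctor (ModuleCat.{0} k) i).obj (ModuleCat.of k k)).map
    (TopCat.ofHom f)).hom

theorem singularHomologyMap_comp (k : Type) [CommRing k] (i : ℕ)
    {X Y Z : Type} [TopologicalSpace X] [TopologicalSpace Y] [TopologicalSpace Z]
    (g : C(Y, Z)) (f : C(X, Y)) :
    singularHomologyMap k i (g.comp f) =
      singularHomologyMap k i g ∘ₗ singularHomologyMap k i f := by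
  simp only [singularHomologyMap, TopCat.ofHom_comp, Functor.map_comp, ModuleCat.hom_comp]

/-- Reduced singular homology: the kernel of the map `H_i(X; k) → H_i(pt; k)` induced by the
unique map from `X` to the one-point space. -/
def reducedHomology (k : Type) [CommRing k] (i : ℕ)
    (X : Type) [TopologicalSpace X] : Submodule k (singularHomology k i X) :=
  LinearMap.ker (singularHomologyMap k i (ContinuousMap.const X PUnit.unit))

/-- The map on reduced singular homology induced by a continuous map `f : X → Y`. -/
def reducedHomologyMap (k : Type) [CommRing k] (i : ℕ)
    {X Y : Type} [TopologicalSpace X] [TopologicalSpace Y] (f : C(X, Y)) :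
    reducedHomology k i X →ₗ[k] reducedHomology k i Y :=
  (singularHomologyMap k i f).restrict (fun z hz => by
    have h : (ContinuousMap.const Y PUnit.unit).comp f =
        ContinuousMap.const X PUnit.unit := rfl
    have hz' : singularHomologyMap k i (ContinuousMap.const X PUnit.unit) z = 0 := hz
    rw [← h, singularHomologyMap_comp] at hz'
    exact hz')

end

/-!
The proof works with singular cohomology and the multiplicative structure of the path fibration
`ΩS → PS → S` over `S = S^(n+1)`, without spectral sequences.

Let `f : ΩS → S^(tn)` be a map, `u` a class of degree `tn` on the target, with coefficients in a
torsion-free ring `A` (`ℤ` or `ℚ`), and `w = f^* u`. Then `u * u = 0` (`IsFrame.cup_self_eq_zero`),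
hence `w * w = 0`. On the other hand the cohomology of `ΩS` carries a Wang derivation `θ` of degree
`-n` (`IsEquatorial.exists_isWangDerivation`). It is an (anti)derivation for the cup product, and it
is injective in positive degrees because the path space `PS` is contractible, so that `w = 0` as
soon as the class `θ^t w` of degree zero vanishes. If `n` is even, `θ` is a derivation and the
Leibniz rule gives `θ^(2t) (w * w) = (2t choose t) (θ^t w)^2`; if `n` is odd, `t` is even by
hypothesis, and the same argument applies to the derivation `θ^2`. Either way `(θ^t w)^2 = 0`, in
degree zero, and therefore `θ^t w = 0` and `w = 0` (`IsWangDerivation.eq_zero_of_cup_self`).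

The derivation is built by iterated Mayer–Vietoris sequences. The sphere has a tower of equators
`W 0 ⊆ W 1 ⊆ ⋯ ⊆ W (n+1)`; each is covered by two open sets over which the path fibration has the
cohomology of the fibre, and which meet in the preceding one (`IsEquatorial`). A class on the fibre
extends over each of the two top hemispheres, and the difference of the extensions on the equator
is brought down to the fibre by `n` inverse connecting homomorphisms (`IsWangMap`); these are linear
over the cohomology of the fibre up to sign, which gives the Leibniz rule. The same tower for
the identity of a sphere computes the cohomology of spheres (`IsFrame.exists_eq_pull`). That a
contraction of a subset of the base lifts to the path space is elementary, by prolonging paths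
(`PathsFrom.liftsContractions_endpoint`).

To come back to homology, take for `Q` the group `ℚ/ℤ` if `k = ℤ` and `ℤ/2` if `k = ℤ/2`. It
cogenerates the `k`-modules, so a map that is constant on cohomology with coefficients in `Q` is zero
on reduced homology (`reducedHomologyMap_eq_zero`). Now `Q` is the quotient of `A = ℚ`, respectively
`A = ℤ`, by an infinite cyclic group, and top-dimensional classes on a sphere lift from `Q` to `A`
(`IsFrame.exists_mapCoeff_eq`), where the argument above applies.

Singular cohomology is set up from scratch, with homotopy invariance, the theorem on small
simplices, cup products and the Mayer–Vietoris sequence. Cochains of all degrees are taken together,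
as functions on simplices of every dimension; the part of degree `p` is singled out by the
projection `pr p`.
-/

noncomputable section

namespace SingularCohomology

/-! ### Alternating sums over faces -/

/-- The alternating sum `∑ i, (-1)^i f i` over the faces of a simplex. -/
def altSum {A : Type*} [AddCommGroup A] {n : ℕ} (f : Fin n → A) : A :=
  ∑ i : Fin n, (-1 : ℤ) ^ (i : ℕ) • f i

section altSum

variable {A : Type*} [AddCommGroup A] {n : ℕ}

@[simp] theorem altSum_zero : altSum (fun _ : Fin n => (0 : A)) = 0 := by simp [altSum]

theorem altSum_add (f g : Fin n → A) :
    altSum (fun i => f i + g i) = altSum f + altSum g := by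
  simp [altSum, Finset.sum_add_distrib]

theorem altSum_sub (f g : Fin n → A) :
    altSum (fun i => f i - g i) = altSum f - altSum g := by
  simp [altSum, smul_sub, Finset.sum_sub_distrib]

theorem altSum_sum {ι : Type*} (s : Finset ι) (f : ι → Fin n → A) :
    altSum (fun i => ∑ k ∈ s, f k i) = ∑ k ∈ s, altSum (f k) := by
  simp only [altSum, Finset.smul_sum]
  exact Finset.sum_comm

theorem map_altSum {B : Type*} [AddCommGroup B] (φ : A →+ B) (f : Fin n → A) :
    φ (altSum f) = altSum (fun i => φ (f i)) := by
  simp [altSum]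

/-- The simplicial identity behind `d ∘ d = 0`. -/
theorem altSum_altSum_succAbove {p : ℕ} (F : (Fin (p + 1) → Fin (p + 3)) → A) :
    altSum (fun i : Fin (p + 3) => altSum (fun j : Fin (p + 2) =>
      F (i.succAbove ∘ j.succAbove))) = 0 := by
  simp only [altSum, Finset.smul_sum, smul_smul]
  rw [Finset.sum_comm, ← Finset.sum_product', Finset.univ_product_univ]
  -- the terms with `i ≤ j` cancel in pairs against those with `i > j`
  let S : Finset (Fin (p + 2) × Fin (p + 3)) := {ij | (ij.2 : ℕ) ≤ (ij.1 : ℕ)}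
  rw [← Finset.sum_add_sum_compl S, ← eq_neg_iff_add_eq_zero, ← Finset.sum_neg_distrib]
  let φ : ∀ ij : Fin (p + 2) × Fin (p + 3), ij ∈ S → Fin (p + 2) × Fin (p + 3) := fun ij hij =>
    (Fin.castLT ij.2 (lt_of_le_of_lt (Finset.mem_filter.mp hij).right (Fin.is_lt ij.1)),
      ij.1.succ)
  apply Finset.sum_bij φ
  · intro ij hij
    simp_rw [S, φ, Finset.compl_filter, Finset.mem_filter_univ, Fin.val_succ,
      Fin.val_castLT] at hij ⊢
    lia
  · rintro ⟨i, j⟩ hij ⟨i', j'⟩ hij' h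
    rw [Prod.mk_inj]
    have h1 := congrArg (fun x => (Prod.fst x : Fin (p + 2)).val) h
    have h2 := congrArg (fun x => (Prod.snd x : Fin (p + 3)).val) h
    simp only [φ, Fin.val_castLT, Fin.val_succ] at h1 h2
    exact ⟨Fin.ext (by omega), Fin.ext h1⟩
  · rintro ⟨i', j'⟩ hij'
    simp_rw [S, Finset.compl_filter, Finset.mem_filter_univ, not_le] at hij'
    refine ⟨(j'.pred ?_, Fin.castSucc i'), ?_, ?_⟩
    · rintro rfl
      simp only [Fin.val_zero, not_lt_zero] at hij'
    · have := Nat.le_sub_one_of_lt hij'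
      simpa [S] using this
    · simp only [φ, Fin.castLT_castSucc, Fin.succ_pred]
  · rintro ⟨i, j⟩ hij
    have hle : (j : ℕ) ≤ i := (Finset.mem_filter.mp hij).2
    have hc : j.succAbove ∘ i.succAbove =
        i.succ.succAbove ∘ (Fin.castLT j (lt_of_le_of_lt hle i.is_lt)).succAbove := by
      funext k
      apply Fin.ext
      simp only [Function.comp, Fin.succAbove, Fin.lt_def]
      split_ifs <;> simp_all <;> omega
    dsimp only
    rw [hc, ← neg_smul]
    congr 1
    simp only [φ, Fin.val_succ, Fin.val_castLT]
    ring

end altSum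

/-! ### Cochains on tuples of points -/

/-- Ordered cochains on a set `K`, of all degrees at once: a function on `(q + 1)`-tuples of points
of `K` for every `q`. -/
abbrev TupleCochain (A K : Type*) := ∀ q : ℕ, (Fin (q + 1) → K) → A

namespace TupleCochain

variable {A : Type*} [AddCommGroup A] {K K' : Type*}

/-- The simplicial coboundary. -/
def d : TupleCochain A K →+ TupleCochain A K where
  toFun W q := match q with
    | 0 => 0
    | q + 1 => fun v => altSum fun i => W q (v ∘ i.succAbove)
  map_zero' := by ext (_ | q) v <;> simp
  map_add' W W' := by ext (_ | q) v <;> simp [altSum_add]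

@[simp] theorem d_zero (W : TupleCochain A K) (v) : d W 0 v = 0 := rfl

theorem d_succ (W : TupleCochain A K) (q : ℕ) (v) :
    d W (q + 1) v = altSum fun i => W q (v ∘ i.succAbove) := rfl

theorem d_d (W : TupleCochain A K) : d (d W) = 0 := by
  ext (_ | _ | q) v
  · rfl
  · simp [d_succ]
  · exact altSum_altSum_succAbove fun φ => W q (v ∘ φ)

/-- Pull-back along a map of vertex sets. -/
def pull (g : K → K') : TupleCochain A K' →+ TupleCochain A K where
  toFun W q v := W q (g ∘ v)
  map_zero' := rfl
  map_add' _ _ := rfl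

@[simp] theorem pull_apply (g : K → K') (W : TupleCochain A K') (q v) :
    pull g W q v = W q (g ∘ v) := rfl

theorem d_pull (g : K → K') (W : TupleCochain A K') : d (pull g W) = pull g (d W) := by
  ext (_ | q) v <;> rfl

/-- Evaluation on cones: `cone a W` is `W` evaluated on tuples with the apex `a` put in front. -/
def cone (a : K) : TupleCochain A K →+ TupleCochain A K where
  toFun W q v := W (q + 1) (Fin.cons a v : Fin (q + 1 + 1) → K)
  map_zero' := rfl
  map_add' _ _ := rfl

@[simp] theorem cone_apply (a : K) (W : TupleCochain A K) (q v) :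
    cone a W q v = W (q + 1) (Fin.cons a v : Fin (q + 1 + 1) → K) := rfl

variable (K) in
/-- The cochain of degree zero with constant value `c`. -/
def const (c : A) : TupleCochain A K
  | 0 => fun _ => c
  | _ + 1 => 0

theorem d_const (c : A) : d (const K c) = 0 := by
  ext (_ | _ | q) v
  · rfl
  · simp [d_succ, altSum, const]
  · simp [d_succ, const]

@[simp] theorem cone_const (a : K) (c : A) : cone a (const K c) = 0 := rfl

/-- The cone formula: dual to `∂(a * c) = c - a * ∂c`, with the augmentation correction in
degree zero. -/
theorem cone_d (a : K) (W : TupleCochain A K) :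
    cone a (d W) = W - d (cone a W) - const K (W 0 fun _ => a) := by
  ext (_ | q) v
  · have h0 : (Fin.cons a v : Fin 2 → K) ∘ Fin.succ = v := by ext; simp
    have h1 : (Fin.cons a v : Fin 2 → K) ∘ (Fin.succAbove 1) = fun _ => a := by
      ext i; fin_cases i; rfl
    simp [d_succ, altSum, const, h0, h1, ← sub_eq_add_neg]
  · have h0 : (Fin.cons a v : Fin (q + 3) → K) ∘ Fin.succ = v := by ext; simp
    have h1 : ∀ i : Fin (q + 2), (Fin.cons a v : Fin (q + 3) → K) ∘ i.succ.succAbove =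
        Fin.cons a (v ∘ i.succAbove) := by
      intro i
      ext j
      refine Fin.cases ?_ (fun j => ?_) j <;> simp
    have : (d W) (q + 2) (Fin.cons a v : Fin (q + 3) → K) =
        W (q + 1) v - d (cone a W) (q + 1) v := by
      rw [d_succ, altSum, Fin.sum_univ_succ, d_succ, altSum, sub_eq_add_neg,
        ← Finset.sum_neg_distrib]
      congr 1
      · simp [h0]
      · refine Finset.sum_congr rfl fun i _ => ?_
        rw [h1, Fin.val_succ, pow_succ, mul_neg_one, neg_smul]
        rfl
    simpa [const] using this

/-- The chain homotopy obtained by coning: the recursion `h(v) = a(v) * (Φ(v) - h(∂v))`, written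
for cochains. -/
def coneHomotopyAux (Φ : TupleCochain A K' →+ TupleCochain A K)
    (a : ∀ q, (Fin (q + 1) → K) → K') :
    ∀ q : ℕ, TupleCochain A K' → (Fin (q + 1) → K) → A
  | 0 => fun W v => Φ (cone (a 0 v) W) 0 v
  | q + 1 => fun W v => Φ (cone (a (q + 1) v) W) (q + 1) v -
      altSum fun i => coneHomotopyAux Φ a q (cone (a (q + 1) v) W) (v ∘ i.succAbove)

/-- `coneHomotopyAux` as an additive map of cochains. -/
def coneHomotopy (Φ : TupleCochain A K' →+ TupleCochain A K)
    (a : ∀ q, (Fin (q + 1) → K) → K') : TupleCochain A K' →+ TupleCochain A K where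
  toFun W q v := coneHomotopyAux Φ a q W v
  map_zero' := by
    ext q v
    induction q with
    | zero => simp [coneHomotopyAux]
    | succ q ih =>
      simp only [Pi.zero_apply] at ih
      simp [coneHomotopyAux, ih]
  map_add' W W' := by
    ext q v
    simp only [Pi.add_apply]
    induction q generalizing W W' with
    | zero => simp [coneHomotopyAux]
    | succ q ih =>
      simp only [coneHomotopyAux, map_add, Pi.add_apply, ih, altSum_add]
      abel

theorem coneHomotopy_zero (Φ : TupleCochain A K' →+ TupleCochain A K)
    (a : ∀ q, (Fin (q + 1) → K) → K') (W v) :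
    coneHomotopy Φ a W 0 v = Φ (cone (a 0 v) W) 0 v := rfl

theorem coneHomotopy_succ (Φ : TupleCochain A K' →+ TupleCochain A K)
    (a : ∀ q, (Fin (q + 1) → K) → K') (W q v) :
    coneHomotopy Φ a W (q + 1) v = Φ (cone (a (q + 1) v) W) (q + 1) v -
      altSum fun i => coneHomotopy Φ a (cone (a (q + 1) v) W) q (v ∘ i.succAbove) := rfl

theorem coneHomotopy_const (Φ : TupleCochain A K' →+ TupleCochain A K)
    (a : ∀ q, (Fin (q + 1) → K) → K') (c : A) : coneHomotopy Φ a (const K' c) = 0 := by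
  ext (_ | q) v
  · simp [coneHomotopy_zero]
  · simp [coneHomotopy_succ]

/-- A cochain map `Φ` that kills the constants of degree zero is null-homotopic, because cones
contract the complex of tuples. -/
theorem coneHomotopy_spec (Φ : TupleCochain A K' →+ TupleCochain A K)
    (a : ∀ q, (Fin (q + 1) → K) → K') (hd : ∀ W, d (Φ W) = Φ (d W))
    (hc : ∀ c, Φ (const K' c) = 0) (W : TupleCochain A K') :
    coneHomotopy Φ a (d W) + d (coneHomotopy Φ a W) = Φ W := by
  ext q v
  induction q generalizing W with
  | zero =>
    have := congrFun (congrFun (hd (cone (a 0 v) W)) 0) v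
    simp only [Pi.add_apply, coneHomotopy_zero, cone_d, map_sub, hc, ← hd, Pi.sub_apply]
    simp
  | succ q ih =>
    simp only [Pi.add_apply] at ih ⊢
    rw [coneHomotopy_succ, cone_d, d_succ]
    simp only [map_sub, hc, ← hd, Pi.sub_apply, coneHomotopy_const, Pi.zero_apply, sub_zero]
    have ih' : ∀ v', coneHomotopy Φ a (d (cone (a (q + 1) v) W)) q v' =
        Φ (cone (a (q + 1) v) W) q v' - d (coneHomotopy Φ a (cone (a (q + 1) v) W)) q v' :=
      fun v' => eq_sub_of_add_eq (ih _ v')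
    simp only [ih', altSum_sub]
    rw [← d_succ (d (coneHomotopy Φ a (cone (a (q + 1) v) W))), d_d,
      ← d_succ (Φ (cone (a (q + 1) v) W))]
    simp only [Pi.zero_apply]
    abel

variable {K₁ K₁' : Type*}

theorem pull_cone (g : K₁ → K) (a : K₁) (W : TupleCochain A K) :
    cone a (pull g W) = pull g (cone (g a) W) := by
  ext q v
  simp only [cone_apply, pull_apply]
  congr 1
  ext i
  refine Fin.cases ?_ (fun j => ?_) i <;> simp

/-- Homotopies that cone with compatible apexes commute with pull-back. -/
theorem coneHomotopy_natural (Φ : TupleCochain A K' →+ TupleCochain A K)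
    (a : ∀ q, (Fin (q + 1) → K) → K') (Φ₁ : TupleCochain A K₁' →+ TupleCochain A K₁)
    (a₁ : ∀ q, (Fin (q + 1) → K₁) → K₁') (g : K₁ → K) (g' : K₁' → K')
    (hΦ : ∀ W, Φ₁ (pull g' W) = pull g (Φ W)) (ha : ∀ q v, g' (a₁ q v) = a q (g ∘ v))
    (W : TupleCochain A K') :
    coneHomotopy Φ₁ a₁ (pull g' W) = pull g (coneHomotopy Φ a W) := by
  ext q v
  induction q generalizing W with
  | zero => simp [coneHomotopy_zero, pull_cone, hΦ, ha]
  | succ q ih =>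
    simp only [coneHomotopy_succ, pull_cone, hΦ, ha, ih, pull_apply]
    rfl

/-- Subdivision of cochains along a choice `b` of an interior point of every tuple: the recursion
`sd v = b(v) * sd(∂v)`, written for cochains. -/
def subdivAux (b : ∀ q, (Fin (q + 1) → K) → K) :
    ∀ q : ℕ, TupleCochain A K → (Fin (q + 1) → K) → A
  | 0 => fun W v => W 0 v
  | q + 1 => fun W v => altSum fun i => subdivAux b q (cone (b (q + 1) v) W) (v ∘ i.succAbove)

/-- `subdivAux` as an additive map of cochains. -/
def subdiv (b : ∀ q, (Fin (q + 1) → K) → K) : TupleCochain A K →+ TupleCochain A K where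
  toFun W q v := subdivAux b q W v
  map_zero' := by
    ext q v
    induction q with
    | zero => simp [subdivAux]
    | succ q ih =>
      simp only [Pi.zero_apply] at ih
      simp [subdivAux, ih]
  map_add' W W' := by
    ext q v
    simp only [Pi.add_apply]
    induction q generalizing W W' with
    | zero => simp [subdivAux]
    | succ q ih => simp only [subdivAux, map_add, ih, altSum_add]

variable (b : ∀ q, (Fin (q + 1) → K) → K)

@[simp] theorem subdiv_zero (W : TupleCochain A K) (v) : subdiv b W 0 v = W 0 v := rfl

theorem subdiv_succ (W : TupleCochain A K) (q v) :
    subdiv b W (q + 1) v =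
      altSum fun i => subdiv b (cone (b (q + 1) v) W) q (v ∘ i.succAbove) := rfl

theorem subdiv_const (c : A) : subdiv b (const K c) = const K c := by
  ext (_ | q) v
  · rfl
  · simp [subdiv_succ, const]

theorem d_subdiv (W : TupleCochain A K) : d (subdiv b W) = subdiv b (d W) := by
  ext q v
  induction q generalizing W with
  | zero => rfl
  | succ q ih =>
    rw [subdiv_succ, cone_d]
    simp only [map_sub, ← ih, Pi.sub_apply, altSum_sub, subdiv_const]
    rw [← d_succ (d _), d_d, ← d_succ (const K _), d_const, d_succ]
    simp

theorem subdiv_natural (b₁ : ∀ q, (Fin (q + 1) → K₁) → K₁) (g : K₁ → K)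
    (hb : ∀ q v, g (b₁ q v) = b q (g ∘ v)) (W : TupleCochain A K) :
    subdiv b₁ (pull g W) = pull g (subdiv b W) := by
  ext q v
  induction q generalizing W with
  | zero => rfl
  | succ q ih =>
    simp only [subdiv_succ, pull_cone, hb, ih, pull_apply]
    rfl

end TupleCochain


/-! ### Singular cochains -/

/-- Singular `p`-simplices of a space. -/
abbrev Simp (X : Type*) [TopologicalSpace X] (p : ℕ) := C(stdSimplex ℝ (Fin (p + 1)), X)

/-- Restriction of a singular simplex along a map of vertices. -/
def Simp.reindex {X : Type*} [TopologicalSpace X] {p q : ℕ} (σ : Simp X q)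
    (φ : Fin (p + 1) → Fin (q + 1)) : Simp X p :=
  σ.comp ⟨stdSimplex.map φ, stdSimplex.continuous_map φ⟩

section

variable {X Y : Type*} [TopologicalSpace X] [TopologicalSpace Y] {p q r : ℕ}

theorem Simp.reindex_reindex (σ : Simp X r) (φ : Fin (q + 1) → Fin (r + 1))
    (ψ : Fin (p + 1) → Fin (q + 1)) : (σ.reindex φ).reindex ψ = σ.reindex (φ ∘ ψ) := by
  ext t
  exact congrArg σ (stdSimplex.map_comp_apply ψ φ t)

theorem Simp.comp_reindex (f : C(X, Y)) (σ : Simp X q) (φ : Fin (p + 1) → Fin (q + 1)) :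
    Simp.reindex (f.comp σ) φ = f.comp (σ.reindex φ) := rfl

theorem Simp.reindex_id (σ : Simp X p) : σ.reindex id = σ := by
  ext t
  exact congrArg σ (stdSimplex.map_id_apply t)

end

/-- Singular cochains with coefficients in `A`, of all degrees at once. -/
abbrev Cochain (A X : Type*) [TopologicalSpace X] := ∀ p : ℕ, Simp X p → A

namespace Cochain

variable {A : Type*} [AddCommGroup A] {X Y Z : Type*} [TopologicalSpace X] [TopologicalSpace Y]
  [TopologicalSpace Z]

/-- The singular coboundary. -/
def d : Cochain A X →+ Cochain A X where
  toFun w p := match p with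
    | 0 => 0
    | p + 1 => fun σ => altSum fun i => w p (σ.reindex i.succAbove)
  map_zero' := by ext (_ | q) v <;> simp
  map_add' W W' := by ext (_ | q) v <;> simp [altSum_add]

@[simp] theorem d_zero (w : Cochain A X) (σ) : d w 0 σ = 0 := rfl

theorem d_succ (w : Cochain A X) (p : ℕ) (σ) :
    d w (p + 1) σ = altSum fun i => w p (σ.reindex i.succAbove) := rfl

theorem d_d (w : Cochain A X) : d (d w) = 0 := by
  ext (_ | _ | p) σ
  · rfl
  · simp [d_succ]
  · simp only [d_succ, Simp.reindex_reindex]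
    exact altSum_altSum_succAbove fun φ => w p (σ.reindex φ)

/-- Pull-back of cochains along a continuous map. -/
def pull (f : C(X, Y)) : Cochain A Y →+ Cochain A X where
  toFun w p σ := w p (f.comp σ)
  map_zero' := rfl
  map_add' _ _ := rfl

@[simp] theorem pull_apply (f : C(X, Y)) (w : Cochain A Y) (p σ) :
    pull f w p σ = w p (f.comp σ) := rfl

theorem d_pull (f : C(X, Y)) (w : Cochain A Y) : d (pull f w) = pull f (d w) := by
  ext (_ | p) σ <;> rfl

/-- Change of coefficients. -/
def mapCoeff {B : Type*} [AddCommGroup B] (φ : A →+ B) : Cochain A X →+ Cochain B X where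
  toFun w p σ := φ (w p σ)
  map_zero' := by ext; simp
  map_add' _ _ := by ext; simp

@[simp] theorem mapCoeff_apply {B : Type*} [AddCommGroup B] (φ : A →+ B) (w : Cochain A X)
    (p σ) : mapCoeff φ w p σ = φ (w p σ) := rfl

theorem d_mapCoeff {B : Type*} [AddCommGroup B] (φ : A →+ B) (w : Cochain A X) :
    d (mapCoeff φ w) = mapCoeff φ (d w) := by
  ext (_ | p) σ
  · simp
  · simp [d_succ, map_altSum]

/-- Projection to the part of degree `p`. -/
def pr (p : ℕ) : Cochain A X →+ Cochain A X where
  toFun w q := if q = p then w q else 0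
  map_zero' := by ext q σ; simp
  map_add' w w' := by ext q σ; by_cases h : q = p <;> simp [h]

theorem pr_apply (p : ℕ) (w : Cochain A X) (q : ℕ) :
    pr p w q = if q = p then w q else 0 := rfl

@[simp] theorem pr_apply_self (p : ℕ) (w : Cochain A X) : pr p w p = w p := by simp [pr_apply]

theorem d_pr (p : ℕ) (w : Cochain A X) : d (pr p w) = pr (p + 1) (d w) := by
  ext (_ | q) σ
  · simp [pr_apply]
  · by_cases h : q = p <;> simp [pr_apply, h, d_succ]

theorem pr_zero_d (w : Cochain A X) : pr 0 (d w) = 0 := by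
  ext (_ | q) σ <;> simp [pr_apply]

theorem pr_pull (p : ℕ) (f : C(X, Y)) (w : Cochain A Y) :
    pr p (pull f w) = pull f (pr p w) := by
  ext q σ
  by_cases h : q = p <;> simp [pr_apply, h]

theorem pr_pr_self (p : ℕ) (w : Cochain A X) : pr p (pr p w) = pr p w := by
  ext q σ
  by_cases h : q = p <;> simp [pr_apply, h]

/-- The sign involution, `(-1)^p` in degree `p`. -/
def sgn : Cochain A X →+ Cochain A X where
  toFun w p σ := (-1 : ℤ) ^ p • w p σ
  map_zero' := by ext; simp
  map_add' _ _ := by ext; simp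

theorem sgn_apply (w : Cochain A X) (p σ) : sgn w p σ = (-1 : ℤ) ^ p • w p σ := rfl

theorem sgn_d (w : Cochain A X) : sgn (d w) = -d (sgn w) := by
  ext (_ | p) σ
  · simp [sgn_apply]
  · simp [sgn_apply, d_succ, altSum, pow_succ, Finset.smul_sum, smul_smul, mul_comm]

theorem sgn_pull (f : C(X, Y)) (w : Cochain A Y) : sgn (pull f w) = pull f (sgn w) := rfl

theorem sgn_sgn (w : Cochain A X) : sgn (sgn w) = w := by
  ext p σ
  simp [sgn_apply, smul_smul, ← mul_pow]

/-! ### Cup product -/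

/-- The inclusion of the first `p + 1` vertices of an `N`-simplex (for `p ≤ N`; larger indices are
truncated). -/
def frontFace (p N : ℕ) (i : Fin (p + 1)) : Fin (N + 1) := ⟨min i N, by omega⟩

/-- The inclusion of the `q + 1` vertices from the `p`-th vertex on of an `N`-simplex (for
`p + q ≤ N`; larger indices are truncated). -/
def backFace (p q N : ℕ) (i : Fin (q + 1)) : Fin (N + 1) := ⟨min (p + i) N, by omega⟩

/-- The cup product of cochains with respect to a pairing of the coefficients, by the
Alexander–Whitney formula. -/
def cup (m : A →+ A →+ A) (a b : Cochain A X) : Cochain A X := fun N σ =>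
  ∑ pq ∈ Finset.HasAntidiagonal.antidiagonal N,
    m (a pq.1 (σ.reindex (frontFace pq.1 N))) (b pq.2 (σ.reindex (backFace pq.1 pq.2 N)))

variable (m : A →+ A →+ A)

theorem cup_add_left (a a' b : Cochain A X) : cup m (a + a') b = cup m a b + cup m a' b := by
  ext N σ
  simp [cup, Finset.sum_add_distrib]

theorem cup_add_right (a b b' : Cochain A X) : cup m a (b + b') = cup m a b + cup m a b' := by
  ext N σ
  simp [cup, Finset.sum_add_distrib]

theorem cup_zero_left (b : Cochain A X) : cup m 0 b = 0 := by
  ext N σ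
  simp [cup]

theorem cup_zero_right (b : Cochain A X) : cup m b 0 = 0 := by
  ext N σ
  simp [cup]

theorem pull_cup (f : C(X, Y)) (a b : Cochain A Y) :
    pull f (cup m a b) = cup m (pull f a) (pull f b) := rfl

theorem cup_zero_apply (a b : Cochain A X) (σ : Simp X 0) :
    cup m a b 0 σ = m (a 0 σ) (b 0 σ) := by
  have h1 : frontFace 0 0 = id := by ext i; simp [frontFace]
  have h2 : backFace 0 0 0 = id := by ext i; simp [backFace]
  simp [cup, h1, h2, Simp.reindex_id]

/-- One summand of the Leibniz rule: the faces of an `N`-simplex, `N = p + q + 1`, distributed over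
the front and the back. The last face of the front cancels against the first face of the back. -/
theorem leibniz_summand (a b : Cochain A X) (p q : ℕ) (σ : Simp X (p + q + 1)) :
    (altSum fun i => m (a p ((σ.reindex i.succAbove).reindex (frontFace p (p + q))))
        (b q ((σ.reindex i.succAbove).reindex (backFace p q (p + q))))) =
      m (d a (p + 1) (σ.reindex (frontFace (p + 1) (p + q + 1))))
          (b q (σ.reindex (backFace (p + 1) q (p + q + 1)))) +
        m ((-1 : ℤ) ^ p • a p (σ.reindex (frontFace p (p + q + 1))))
          (d b (q + 1) (σ.reindex (backFace p (q + 1) (p + q + 1)))) := by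
  have key : ∀ f : Fin (p + q + 1 + 1) → A, altSum f =
      (∑ i : Fin (p + 1), (-1 : ℤ) ^ (i : ℕ) • f ⟨i, by omega⟩) +
        ∑ j : Fin (q + 1), (-1 : ℤ) ^ (p + 1 + j : ℕ) • f ⟨p + 1 + j, by omega⟩ := by
    intro f
    have hN : p + q + 1 + 1 = (p + 1) + (q + 1) := by omega
    rw [altSum, ← (finCongr hN.symm).sum_comp, Fin.sum_univ_add]
    rfl
  rw [key, d_succ, d_succ, altSum, altSum, Fin.sum_univ_castSucc (n := p + 1),
    Fin.sum_univ_succ (n := q + 1)]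
  simp only [map_add, AddMonoidHom.add_apply, map_sum, AddMonoidHom.finsetSum_apply,
    map_zsmul, AddMonoidHom.zsmul_apply, Simp.reindex_reindex]
  have e1 : ∀ i : Fin (p + 1), (⟨i, by omega⟩ : Fin (p + q + 1 + 1)).succAbove ∘
      frontFace p (p + q) = frontFace (p + 1) (p + q + 1) ∘ i.castSucc.succAbove := by
    intro i; ext k
    simp only [frontFace, Function.comp, Fin.succAbove, Fin.lt_def, Fin.val_castSucc]
    split_ifs <;> simp_all <;> omega
  have e2 : ∀ i : Fin (p + 1), (⟨i, by omega⟩ : Fin (p + q + 1 + 1)).succAbove ∘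
      backFace p q (p + q) = backFace (p + 1) q (p + q + 1) := by
    intro i; ext k
    simp only [backFace, Function.comp, Fin.succAbove, Fin.lt_def, Fin.val_castSucc]
    split_ifs <;> simp_all <;> omega
  have e3 : ∀ j : Fin (q + 1), (⟨p + 1 + j, by omega⟩ : Fin (p + q + 1 + 1)).succAbove ∘
      frontFace p (p + q) = frontFace p (p + q + 1) := by
    intro i; ext k
    simp only [frontFace, Function.comp, Fin.succAbove, Fin.lt_def, Fin.val_castSucc]
    split_ifs <;> simp_all <;> omega
  have e4 : ∀ j : Fin (q + 1), (⟨p + 1 + j, by omega⟩ : Fin (p + q + 1 + 1)).succAbove ∘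
      backFace p q (p + q) = backFace p (q + 1) (p + q + 1) ∘ j.succ.succAbove := by
    intro i; ext k
    simp only [backFace, Function.comp, Fin.succAbove, Fin.lt_def, Fin.val_castSucc, Fin.val_succ]
    split_ifs <;> simp_all <;> omega
  have e5 : frontFace (p + 1) (p + q + 1) ∘ (Fin.last (p + 1)).succAbove =
      frontFace p (p + q + 1) := by
    ext k
    simp [frontFace]
  have e6 : backFace p (q + 1) (p + q + 1) ∘ (0 : Fin (q + 2)).succAbove =
      backFace (p + 1) q (p + q + 1) := by
    ext k
    simp [backFace]
    omega
  simp only [e1, e2, e3, e4, e5, e6, Fin.val_castSucc, Fin.val_succ, Fin.val_last, Fin.val_zero,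
    pow_zero, smul_smul]
  rw [pow_succ (-1 : ℤ) p, mul_neg_one, neg_smul, one_mul,
    Finset.sum_congr rfl fun (j : Fin (q + 1)) _ =>
      by rw [show (-1 : ℤ) ^ (p + 1 + (j : ℕ)) = (-1) ^ ((j : ℕ) + 1) * (-1) ^ p by ring]]
  abel

/-- The Leibniz rule. -/
theorem d_cup (a b : Cochain A X) : d (cup m a b) = cup m (d a) b + cup m (sgn a) (d b) := by
  ext (_ | N) σ
  · simp [cup]
  · rw [d_succ]
    simp only [cup, altSum_sum, Pi.add_apply]
    rw [Finset.Nat.sum_antidiagonal_succ, Finset.Nat.sum_antidiagonal_succ']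
    simp only [d_zero, map_zero, AddMonoidHom.zero_apply, zero_add]
    rw [← Finset.sum_add_distrib]
    refine Finset.sum_congr rfl fun pq h => ?_
    obtain ⟨p, q⟩ := pq
    rw [Finset.HasAntidiagonal.mem_antidiagonal] at h
    subst h
    exact leibniz_summand m a b p q σ

end Cochain


/-! ### Affine simplices -/

/-- A space in which every tuple of points spans an affine singular simplex. -/
class HasAffineSimplices (K : Type*) [TopologicalSpace K] where
  /-- The affine simplex with given vertices. -/
  aff : ∀ {q : ℕ}, (Fin (q + 1) → K) → Simp K q
  aff_reindex : ∀ {p q : ℕ} (v : Fin (q + 1) → K) (φ : Fin (p + 1) → Fin (q + 1)),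
    (aff v).reindex φ = aff (v ∘ φ)

open HasAffineSimplices

theorem sum_map_smul {E : Type*} [AddCommGroup E] [Module ℝ E] {p q : ℕ}
    (φ : Fin (p + 1) → Fin (q + 1)) (t : stdSimplex ℝ (Fin (p + 1))) (v : Fin (q + 1) → E) :
    ∑ j, stdSimplex.map φ t j • v j = ∑ k, t k • v (φ k) := by
  classical
  have h : ∀ j, stdSimplex.map φ t j = ∑ k with φ k = j, t k := by
    intro j
    have := congrFun (stdSimplex.map_coe φ t) j
    rw [FunOnFinite.linearMap_apply_apply] at this
    exact this
  simp only [h, Finset.sum_smul]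
  rw [← Finset.sum_fiberwise (s := Finset.univ) (g := φ)]
  refine Finset.sum_congr rfl fun j _ => Finset.sum_congr rfl fun k hk => ?_
  rw [(Finset.mem_filter.mp hk).2]

/-- Affine simplices in a convex set. -/
@[reducible] def HasAffineSimplices.ofConvex {E : Type*} [AddCommGroup E] [Module ℝ E]
    [TopologicalSpace E] [IsTopologicalAddGroup E] [ContinuousSMul ℝ E] {s : Set E}
    (hs : Convex ℝ s) : HasAffineSimplices s where
  aff v :=
    { toFun := fun t => ⟨∑ j, t j • (v j : E),
        hs.sum_mem (fun j _ => stdSimplex.zero_le t j) (stdSimplex.sum_eq_one t) fun j _ => (v j).2⟩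
      continuous_toFun := by
        refine Continuous.subtype_mk (continuous_finsetSum _ fun j _ => ?_) _
        exact ((continuous_apply j).comp continuous_subtype_val).smul continuous_const }
  aff_reindex v φ := by
    ext t
    exact congrArg _ (Subtype.ext (sum_map_smul φ t fun j => (v j : E)))

instance (n : ℕ) : HasAffineSimplices (stdSimplex ℝ (Fin n)) := .ofConvex (convex_stdSimplex ℝ _)

instance : HasAffineSimplices unitInterval := .ofConvex (convex_Icc 0 1)

instance {K L : Type*} [TopologicalSpace K] [TopologicalSpace L] [HasAffineSimplices K]
    [HasAffineSimplices L] : HasAffineSimplices (K × L) where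
  aff v := (aff (Prod.fst ∘ v)).prodMk (aff (Prod.snd ∘ v))
  aff_reindex v φ := by
    ext t : 1
    exact Prod.ext (DFunLike.congr_fun (aff_reindex (Prod.fst ∘ v) φ) t)
      (DFunLike.congr_fun (aff_reindex (Prod.snd ∘ v) φ) t)

theorem coe_aff {n q : ℕ} (v : Fin (q + 1) → stdSimplex ℝ (Fin n)) (t) :
    ((aff v t : stdSimplex ℝ (Fin n)) : Fin n → ℝ) = ∑ j, t j • (v j : Fin n → ℝ) := rfl

/-- The vertices of the standard simplex. -/
def vert (p : ℕ) (i : Fin (p + 1)) : stdSimplex ℝ (Fin (p + 1)) := stdSimplex.vertex i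

theorem aff_vert (p : ℕ) : aff (vert p) = ContinuousMap.id _ := by
  ext t i
  change (aff (vert p) t : Fin (p + 1) → ℝ) i = t i
  simp [coe_aff, vert, Finset.sum_apply, Pi.single_apply]

theorem aff_apply_vert {p n : ℕ} (v : Fin (p + 1) → stdSimplex ℝ (Fin n)) :
    aff v ∘ vert p = v := by
  ext i k
  change (aff v (vert p i) : Fin n → ℝ) k = v i k
  simp [coe_aff, vert, Finset.sum_apply, Pi.single_apply, ite_apply]

/-- Maps that take affine simplices to affine simplices. -/
def IsAffine {K L : Type*} [TopologicalSpace K] [TopologicalSpace L] [HasAffineSimplices K]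
    [HasAffineSimplices L] (g : C(K, L)) : Prop :=
  ∀ (q : ℕ) (u : Fin (q + 1) → K), g.comp (aff u) = aff (g ∘ u)

theorem isAffine_aff {p n : ℕ} (v : Fin (p + 1) → stdSimplex ℝ (Fin n)) : IsAffine (aff v) := by
  intro q u
  ext t k
  change (aff v (aff u t) : Fin n → ℝ) k = (aff (aff v ∘ u) t : Fin n → ℝ) k
  have h : ∀ j, (aff u t) j = ∑ i, t i * (u i) j := fun j => by
    simp [coe_aff, Finset.sum_apply]
  simp only [coe_aff, Finset.sum_apply, Pi.smul_apply, smul_eq_mul, h, Function.comp,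
    Finset.sum_mul, Finset.mul_sum]
  rw [Finset.sum_comm]
  exact Finset.sum_congr rfl fun i _ => Finset.sum_congr rfl fun j _ => by
    rw [mul_assoc]

/-- The map of standard simplices induced by a map of vertices. -/
def vmap {p q : ℕ} (φ : Fin (p + 1) → Fin (q + 1)) :
    C(stdSimplex ℝ (Fin (p + 1)), stdSimplex ℝ (Fin (q + 1))) :=
  ⟨stdSimplex.map φ, stdSimplex.continuous_map φ⟩

theorem vmap_comp_vert {p q : ℕ} (φ : Fin (p + 1) → Fin (q + 1)) :
    vmap φ ∘ vert p = vert q ∘ φ := by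
  ext1 i
  exact stdSimplex.map_vertex φ i

theorem vmap_eq_aff {p q : ℕ} (φ : Fin (p + 1) → Fin (q + 1)) : vmap φ = aff (vert q ∘ φ) := by
  rw [← aff_reindex, aff_vert]
  rfl

theorem isAffine_vmap {p q : ℕ} (φ : Fin (p + 1) → Fin (q + 1)) : IsAffine (vmap φ) := by
  rw [vmap_eq_aff]
  exact isAffine_aff _

theorem IsAffine.prodMap_id {K L M : Type*} [TopologicalSpace K] [TopologicalSpace L]
    [TopologicalSpace M] [HasAffineSimplices K] [HasAffineSimplices L] [HasAffineSimplices M]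
    {g : C(K, L)} (hg : IsAffine g) : IsAffine (g.prodMap (ContinuousMap.id M)) := by
  intro q u
  ext t : 1
  exact Prod.ext (DFunLike.congr_fun (hg q (Prod.fst ∘ u)) t) rfl

/-! ### Operators on singular cochains from operators on tuples -/

section Operators

variable {A : Type*} [AddCommGroup A] {X Y : Type*} [TopologicalSpace X] [TopologicalSpace Y]

/-- A singular cochain evaluated on the images of affine simplices. -/
def evalOn {K : Type*} [TopologicalSpace K] [HasAffineSimplices K] (τ : C(K, Y)) :
    Cochain A Y →+ TupleCochain A K where
  toFun w q u := w q (τ.comp (aff u))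
  map_zero' := rfl
  map_add' _ _ := rfl

theorem evalOn_apply {K : Type*} [TopologicalSpace K] [HasAffineSimplices K] (τ : C(K, Y))
    (w : Cochain A Y) (q) (u : Fin (q + 1) → K) : evalOn τ w q u = w q (τ.comp (aff u)) := rfl

theorem d_evalOn {K : Type*} [TopologicalSpace K] [HasAffineSimplices K] (τ : C(K, Y))
    (w : Cochain A Y) : (evalOn τ w).d = evalOn τ w.d := by
  ext (_ | q) u
  · rfl
  · simp only [TupleCochain.d_succ, evalOn_apply, Cochain.d_succ, Simp.comp_reindex, aff_reindex]

theorem evalOn_comp {K L : Type*} [TopologicalSpace K] [HasAffineSimplices K] [TopologicalSpace L]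
    [HasAffineSimplices L] (τ : C(L, Y)) {g : C(K, L)} (hg : IsAffine g) (w : Cochain A Y) :
    evalOn (τ.comp g) w = TupleCochain.pull g (evalOn τ w) := by
  ext q u
  simp only [evalOn_apply, TupleCochain.pull_apply, ContinuousMap.comp_assoc, hg q u]

theorem evalOn_vert {p : ℕ} (σ : Simp Y p) (w : Cochain A Y) : evalOn σ w p (vert p) = w p σ := by
  rw [evalOn_apply, aff_vert, ContinuousMap.comp_id]

variable {K : ℕ → Type*} [∀ p, TopologicalSpace (K p)] [∀ p, HasAffineSimplices (K p)]

/-- The operator on singular cochains whose value on a `p`-simplex `σ` is obtained by carrying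
cochains over to tuples along `τ σ`, applying `Θ p`, and evaluating on the vertices of the standard
simplex. -/
def opOf (τ : ∀ p, Simp X p → C(K p, Y))
    (Θ : ∀ p, TupleCochain A (K p) →+ TupleCochain A (stdSimplex ℝ (Fin (p + 1)))) :
    Cochain A Y →+ Cochain A X where
  toFun w p σ := Θ p (evalOn (τ p σ) w) p (vert p)
  map_zero' := by ext; simp
  map_add' _ _ := by ext; simp

theorem opOf_apply (τ : ∀ p, Simp X p → C(K p, Y))
    (Θ : ∀ p, TupleCochain A (K p) →+ TupleCochain A (stdSimplex ℝ (Fin (p + 1))))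
    (w : Cochain A Y) (p) (σ : Simp X p) :
    opOf τ Θ w p σ = Θ p (evalOn (τ p σ) w) p (vert p) := rfl

/-- If `Θ` is compatible with faces, then the coboundary of `opOf τ Θ` is computed by that of
`Θ`. -/
theorem d_opOf (τ : ∀ p, Simp X p → C(K p, Y))
    (Θ : ∀ p, TupleCochain A (K p) →+ TupleCochain A (stdSimplex ℝ (Fin (p + 1))))
    (hnat : ∀ p (i : Fin (p + 2)) (σ : Simp X (p + 1)) (w : Cochain A Y),
      Θ p (evalOn (τ p (σ.reindex i.succAbove)) w) =
        TupleCochain.pull (vmap i.succAbove) (Θ (p + 1) (evalOn (τ (p + 1) σ) w)))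
    (w : Cochain A Y) (p) (σ : Simp X p) :
    (opOf τ Θ w).d p σ = (Θ p (evalOn (τ p σ) w)).d p (vert p) := by
  cases p with
  | zero => rfl
  | succ p =>
    simp only [Cochain.d_succ, TupleCochain.d_succ, opOf_apply, hnat, TupleCochain.pull_apply,
      vmap_comp_vert]

end Operators

/-! ### Homotopy invariance -/

section Homotopy

variable {A : Type*} [AddCommGroup A] {X Y : Type*} [TopologicalSpace X] [TopologicalSpace Y]

/-- Difference of the restrictions to the two ends of the prism. -/
def prismEnds (A : Type*) [AddCommGroup A] (K : Type*) :
    TupleCochain A (K × unitInterval) →+ TupleCochain A K :=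
  TupleCochain.pull (fun x => (x, 1)) - TupleCochain.pull fun x => (x, 0)

/-- The prism operator, as the coning homotopy for the difference of the two ends of the prism. -/
theorem exists_homotopyOperator {f g : C(X, Y)} (H : f.Homotopy g) :
    ∃ P : Cochain A Y →+ Cochain A X, ∀ w,
      P w.d + (P w).d = Cochain.pull g w - Cochain.pull f w := by
  let H' : C(X × unitInterval, Y) := H.toContinuousMap.comp
    (ContinuousMap.prodSwap)
  let τ : ∀ p, Simp X p → C(stdSimplex ℝ (Fin (p + 1)) × unitInterval, Y) := fun p σ =>
    H'.comp (σ.prodMap (ContinuousMap.id _))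
  let apex : ∀ p q, (Fin (q + 1) → stdSimplex ℝ (Fin (p + 1))) →
    stdSimplex ℝ (Fin (p + 1)) × unitInterval := fun p q v => (v 0, 0)
  let Θ := fun p => TupleCochain.coneHomotopy
    (prismEnds A (stdSimplex ℝ (Fin (p + 1)))) (apex p)
  have hd : ∀ p W, (prismEnds A (stdSimplex ℝ (Fin (p + 1))) W).d = prismEnds A _ W.d := by
    intro p W
    simp only [prismEnds, AddMonoidHom.sub_apply, map_sub, TupleCochain.d_pull]
  have hc : ∀ p c, prismEnds A (stdSimplex ℝ (Fin (p + 1))) (TupleCochain.const _ c) = 0 := by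
    intro p c
    ext (_ | q) v <;> simp [prismEnds, TupleCochain.const]
  refine ⟨opOf τ Θ, fun w => ?_⟩
  ext p σ
  have hnat : ∀ p (i : Fin (p + 2)) (σ : Simp X (p + 1)) (w : Cochain A Y),
      Θ p (evalOn (τ p (σ.reindex i.succAbove)) w) =
        TupleCochain.pull (vmap i.succAbove) (Θ (p + 1) (evalOn (τ (p + 1) σ) w)) := by
    intro p i σ w
    have h1 : τ p (σ.reindex i.succAbove) =
      (τ (p + 1) σ).comp ((vmap i.succAbove).prodMap (ContinuousMap.id _)) := rfl
    rw [h1, evalOn_comp _ (isAffine_vmap _).prodMap_id]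
    exact TupleCochain.coneHomotopy_natural _ (apex (p + 1)) _ (apex p) (vmap i.succAbove)
      ((vmap i.succAbove).prodMap (ContinuousMap.id _)) (fun W => rfl) (fun q v => rfl) _
  rw [Pi.add_apply, Pi.add_apply, d_opOf τ Θ hnat, opOf_apply, ← d_evalOn, ← Pi.add_apply,
    ← Pi.add_apply, TupleCochain.coneHomotopy_spec _ _ (hd p) (hc p)]
  have h1 : aff ((fun x => (x, (1 : unitInterval))) ∘ vert p) =
      (ContinuousMap.id (stdSimplex ℝ (Fin (p + 1)))).prodMk (ContinuousMap.const _ 1) := by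
    ext t : 1
    refine Prod.ext (DFunLike.congr_fun (aff_vert p) t) (Subtype.ext ?_)
    change ∑ j, t j • (1 : ℝ) = 1
    simp
  have h0 : aff ((fun x => (x, (0 : unitInterval))) ∘ vert p) =
      (ContinuousMap.id (stdSimplex ℝ (Fin (p + 1)))).prodMk (ContinuousMap.const _ 0) := by
    ext t : 1
    refine Prod.ext (DFunLike.congr_fun (aff_vert p) t) (Subtype.ext ?_)
    change ∑ j, t j • (0 : ℝ) = 0
    simp
  simp only [prismEnds, AddMonoidHom.sub_apply, Pi.sub_apply, TupleCochain.pull_apply,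
    evalOn_apply, h1, h0, Cochain.pull_apply]
  congr 2
  · ext t
    exact H.apply_one _
  · ext t
    exact H.apply_zero _

end Homotopy

/-! ### Barycentric subdivision makes simplices small -/

namespace TupleCochain

variable {A : Type*} [AddCommGroup A] {K : Type*} [PseudoMetricSpace K]
  {b : ∀ q, (Fin (q + 1) → K) → K}

/-- If `b` picks barycenters, then the value of a subdivided cochain on `v` depends only on tuples
that lie in every ball containing `v` and whose diameter is smaller than that of `v` by the factor
`q / (q + 1)`. -/
theorem subdiv_eq_zero
    (hb : ∀ q (v : Fin (q + 1) → K) x c, (∀ j, dist (v j) x ≤ c) → dist (b q v) x ≤ c)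
    (hb' : ∀ q (v : Fin (q + 1) → K) D, (∀ i j, dist (v i) (v j) ≤ D) →
      ∀ j, dist (b q v) (v j) ≤ q / (q + 1) * D)
    (q : ℕ) (W : TupleCochain A K) (v : Fin (q + 1) → K) (D : ℝ)
    (hv : ∀ i j, dist (v i) (v j) ≤ D)
    (hW : ∀ u : Fin (q + 1) → K, (∀ x c, (∀ j, dist (v j) x ≤ c) → ∀ i, dist (u i) x ≤ c) →
      (∀ i j, dist (u i) (u j) ≤ q / (q + 1) * D) → W q u = 0) :
    subdiv b W q v = 0 := by
  have hD : 0 ≤ D := dist_nonneg.trans (hv 0 0)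
  induction q generalizing W with
  | zero =>
    refine hW v (fun x c h => h) fun i j => ?_
    obtain rfl : i = j := by omega
    simp
  | succ q ih =>
    rw [subdiv_succ]
    refine (congrArg altSum (funext fun i => ?_)).trans altSum_zero
    refine ih _ _ (fun _ _ => hv _ _) fun u hu hu' => hW _ ?_ ?_
    · intro x c h k
      refine Fin.cases ?_ (fun k => ?_) k
      · simpa using hb _ v x c h
      · simpa using hu x c (fun j => h _) k
    · have h1 : ∀ k, dist (u k) (b (q + 1) v) ≤ ((q + 1 : ℕ) : ℝ) / ((q + 1 : ℕ) + 1) * D :=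
        hu _ _ fun j => by rw [dist_comm]; exact hb' _ v D hv _
      have h2 : (q : ℝ) / (q + 1) * D ≤ ((q + 1 : ℕ) : ℝ) / ((q + 1 : ℕ) + 1) * D := by
        refine mul_le_mul_of_nonneg_right ?_ hD
        rw [div_le_div_iff₀ (by positivity) (by positivity)]
        push_cast
        nlinarith
      have h3 : 0 ≤ ((q + 1 : ℕ) : ℝ) / ((q + 1 : ℕ) + 1) * D := by positivity
      intro k l
      refine Fin.cases ?_ (fun k => ?_) k <;> refine Fin.cases ?_ (fun l => ?_) l
      · simpa using h3
      · simpa [dist_comm] using h1 l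
      · simpa using h1 k
      · simpa using (hu' k l).trans h2

/-- The diameter shrinks geometrically under iterated subdivision. -/
theorem subdiv_iterate_eq_zero
    (hb : ∀ q (v : Fin (q + 1) → K) x c, (∀ j, dist (v j) x ≤ c) → dist (b q v) x ≤ c)
    (hb' : ∀ q (v : Fin (q + 1) → K) D, (∀ i j, dist (v i) (v j) ≤ D) →
      ∀ j, dist (b q v) (v j) ≤ q / (q + 1) * D)
    (q : ℕ) (m : ℕ) (W : TupleCochain A K) (v : Fin (q + 1) → K) (D : ℝ)
    (hv : ∀ i j, dist (v i) (v j) ≤ D)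
    (hW : ∀ u : Fin (q + 1) → K, (∀ i j, dist (u i) (u j) ≤ ((q : ℝ) / (q + 1)) ^ m * D) →
      W q u = 0) :
    (subdiv b)^[m] W q v = 0 := by
  induction m generalizing W with
  | zero => exact hW v (by simpa using hv)
  | succ m ih =>
    rw [Function.iterate_succ_apply]
    refine ih _ fun u hu => subdiv_eq_zero hb hb' q W u _ hu fun u' _ hu' => hW u' ?_
    intro i j
    refine (hu' i j).trans_eq ?_
    ring

end TupleCochain

/-- The barycenter of a tuple of points of a simplex. -/
def bary (p q : ℕ) (v : Fin (q + 1) → stdSimplex ℝ (Fin (p + 1))) :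
    stdSimplex ℝ (Fin (p + 1)) := aff v stdSimplex.barycenter

theorem IsAffine.map_bary {p p' : ℕ}
    {g : C(stdSimplex ℝ (Fin (p + 1)), stdSimplex ℝ (Fin (p' + 1)))} (hg : IsAffine g) (q : ℕ)
    (v : Fin (q + 1) → stdSimplex ℝ (Fin (p + 1))) : g (bary p q v) = bary p' q (g ∘ v) :=
  DFunLike.congr_fun (hg q v) _

theorem dist_aff_le {p q : ℕ} (v : Fin (q + 1) → stdSimplex ℝ (Fin (p + 1)))
    (x : stdSimplex ℝ (Fin (p + 1))) (c : ℝ) (h : ∀ j, dist (v j) x ≤ c) (t) :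
    dist (aff v t) x ≤ c := by
  have := (convex_closedBall (x : Fin (p + 1) → ℝ) c).sum_mem (t := Finset.univ)
    (w := fun j => t j) (z := fun j => ((v j : Fin (p + 1) → ℝ)))
    (fun j _ => stdSimplex.zero_le t j) (stdSimplex.sum_eq_one t)
    (fun j _ => Metric.mem_closedBall.mpr (h j))
  exact Metric.mem_closedBall.mp this

theorem dist_bary_le {p q : ℕ} (v : Fin (q + 1) → stdSimplex ℝ (Fin (p + 1))) (D : ℝ)
    (h : ∀ i j, dist (v i) (v j) ≤ D) (j : Fin (q + 1)) :
    dist (bary p q v) (v j) ≤ q / (q + 1) * D := by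
  rw [Subtype.dist_eq, dist_eq_norm]
  have hq : (0 : ℝ) < q + 1 := by positivity
  have h1 : ((bary p q v : stdSimplex ℝ (Fin (p + 1))) : Fin (p + 1) → ℝ) -
      (v j : Fin (p + 1) → ℝ) =
        ((q : ℝ) + 1)⁻¹ • ∑ i ∈ Finset.univ.erase j,
          ((v i : Fin (p + 1) → ℝ) - (v j : Fin (p + 1) → ℝ)) := by
    rw [Finset.sum_erase _ (sub_self _), Finset.sum_sub_distrib, smul_sub, bary, coe_aff,
      Finset.smul_sum]
    congr 1
    · refine Finset.sum_congr rfl fun i _ => ?_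
      congr 1
      change (stdSimplex.barycenter : stdSimplex ℝ (Fin (q + 1))).val i = _
      simp
    · simp only [Finset.sum_const, Finset.card_univ, Fintype.card_fin, ← Nat.cast_smul_eq_nsmul ℝ,
        smul_smul]
      push_cast
      rw [inv_mul_cancel₀ hq.ne', one_smul]
  refine (congrArg norm h1).le.trans ?_
  rw [norm_smul, Real.norm_of_nonneg (by positivity), div_mul_eq_mul_div, ← div_eq_inv_mul]
  refine div_le_div_of_nonneg_right ((norm_sum_le _ _).trans ?_) hq.le
  refine (Finset.sum_le_card_nsmul _ _ D fun i _ => ?_).trans ?_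
  · rw [← dist_eq_norm]
    exact h i j
  · simp

section

variable {A : Type*} [AddCommGroup A] {X : Type*} [TopologicalSpace X]

namespace Cochain

/-- Barycentric subdivision of singular cochains. -/
def sd : Cochain A X →+ Cochain A X :=
  opOf (fun _ σ => σ) fun p => TupleCochain.subdiv (bary p)

/-- The identity minus barycentric subdivision, on tuples of points of a simplex. -/
def idSubSubdiv (A : Type*) [AddCommGroup A] (p : ℕ) :
    TupleCochain A (stdSimplex ℝ (Fin (p + 1))) →+ TupleCochain A (stdSimplex ℝ (Fin (p + 1))) :=
  AddMonoidHom.id _ - TupleCochain.subdiv (bary p)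

/-- The homotopy between the identity and barycentric subdivision. -/
def sdHomotopy : Cochain A X →+ Cochain A X :=
  opOf (fun _ σ => σ) fun p => TupleCochain.coneHomotopy (idSubSubdiv A p) (bary p)

theorem subdiv_evalOn_reindex {p q : ℕ} (φ : Fin (p + 1) → Fin (q + 1)) (σ : Simp X q)
    (w : Cochain A X) : TupleCochain.subdiv (bary p) (evalOn (σ.reindex φ) w) =
      TupleCochain.pull (vmap φ) (TupleCochain.subdiv (bary q) (evalOn σ w)) := by
  rw [← TupleCochain.subdiv_natural (bary q) (bary p) (vmap φ)
    fun q v => (isAffine_vmap φ).map_bary q v, ← evalOn_comp _ (isAffine_vmap φ)]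
  rfl

theorem d_sd (w : Cochain A X) : (sd w).d = sd w.d := by
  ext p σ
  rw [sd, d_opOf (fun _ σ => σ) (fun p => TupleCochain.subdiv (bary p))
    fun p i σ w => subdiv_evalOn_reindex _ σ w, opOf_apply, TupleCochain.d_subdiv, d_evalOn]

theorem sdHomotopy_spec (w : Cochain A X) :
    sdHomotopy w.d + (sdHomotopy w).d = w - sd w := by
  have hd : ∀ p W, (idSubSubdiv A p W).d = idSubSubdiv A p W.d := by
    intro p W
    simp [idSubSubdiv, TupleCochain.d_subdiv]
  have hc : ∀ p c, idSubSubdiv A p (TupleCochain.const _ c) = 0 := by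
    intro p c
    simp [idSubSubdiv, TupleCochain.subdiv_const]
  ext p σ
  rw [Pi.add_apply, Pi.add_apply, sdHomotopy, d_opOf (fun _ σ => σ)
    (fun p => TupleCochain.coneHomotopy (idSubSubdiv A p) (bary p)), opOf_apply, ← d_evalOn,
    ← Pi.add_apply, ← Pi.add_apply, TupleCochain.coneHomotopy_spec _ _ (hd p) (hc p)]
  · rw [idSubSubdiv, AddMonoidHom.sub_apply, Pi.sub_apply, Pi.sub_apply, AddMonoidHom.id_apply,
      evalOn_vert]
    rfl
  · intro p i σ w
    rw [← TupleCochain.coneHomotopy_natural (idSubSubdiv A (p + 1)) (bary (p + 1))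
      (idSubSubdiv A p) (bary p) (vmap i.succAbove) (vmap i.succAbove) ?_
      fun q v => (isAffine_vmap _).map_bary q v, ← evalOn_comp _ (isAffine_vmap _)]
    · rfl
    · intro W
      simp only [idSubSubdiv, AddMonoidHom.sub_apply, AddMonoidHom.id_apply, map_sub]
      rw [TupleCochain.subdiv_natural (bary (p + 1)) (bary p) (vmap i.succAbove)
        fun q v => (isAffine_vmap _).map_bary q v]

theorem evalOn_sd {p : ℕ} (σ : Simp X p) (w : Cochain A X) :
    evalOn σ (sd w) = TupleCochain.subdiv (bary p) (evalOn σ w) := by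
  ext q u
  rw [evalOn_apply, sd, opOf_apply, evalOn_comp _ (isAffine_aff u),
    TupleCochain.subdiv_natural (bary p) (bary q) (aff u)
      fun q v => (isAffine_aff u).map_bary q v, TupleCochain.pull_apply, aff_apply_vert]

theorem evalOn_sd_iterate {p : ℕ} (σ : Simp X p) (m : ℕ) (w : Cochain A X) :
    evalOn σ (sd^[m] w) = (TupleCochain.subdiv (bary p))^[m] (evalOn σ w) := by
  induction m generalizing w with
  | zero => rfl
  | succ m ih => rw [Function.iterate_succ_apply, Function.iterate_succ_apply, ih, evalOn_sd]

/-! ### The theorem on small simplices -/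

variable (U V : Set X)

/-- Cochains that vanish on the simplices contained in `U` or in `V`. -/
def VanishesOn (w : Cochain A X) : Prop :=
  ∀ p (σ : Simp X p), Set.range σ ⊆ U ∨ Set.range σ ⊆ V → w p σ = 0

variable {U V}

theorem VanishesOn.evalOn_eq_zero {w : Cochain A X} (hw : w.VanishesOn U V) {p : ℕ}
    {σ : Simp X p} (hσ : Set.range σ ⊆ U ∨ Set.range σ ⊆ V) : evalOn σ w = 0 := by
  ext q u
  have h : Set.range (σ.comp (aff u)) ⊆ Set.range σ := by
    rintro _ ⟨t, rfl⟩
    exact ⟨_, rfl⟩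
  exact hw q _ (hσ.imp h.trans h.trans)

theorem VanishesOn.sd {w : Cochain A X} (hw : w.VanishesOn U V) : (sd w).VanishesOn U V := by
  intro p σ hσ
  rw [Cochain.sd, opOf_apply, hw.evalOn_eq_zero hσ, map_zero]
  rfl

theorem VanishesOn.sdHomotopy {w : Cochain A X} (hw : w.VanishesOn U V) :
    (sdHomotopy w).VanishesOn U V := by
  intro p σ hσ
  rw [Cochain.sdHomotopy, opOf_apply, hw.evalOn_eq_zero hσ, map_zero]
  rfl

theorem VanishesOn.sd_iterate {w : Cochain A X} (hw : w.VanishesOn U V) (m : ℕ) :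
    (Cochain.sd^[m] w).VanishesOn U V := by
  induction m with
  | zero => exact hw
  | succ m ih =>
    rw [Function.iterate_succ_apply']
    exact ih.sd

/-- By the Lebesgue number lemma, sufficiently many subdivisions make a given simplex small. -/
theorem eventually_sd_iterate_eq_zero (A : Type*) [AddCommGroup A] (hU : IsOpen U) (hV : IsOpen V)
    (hUV : U ∪ V = Set.univ) {p : ℕ} (σ : Simp X p) :
    ∀ᶠ m in Filter.atTop, ∀ w : Cochain A X, w.VanishesOn U V → Cochain.sd^[m] w p σ = 0 := by
  let c : Bool → Set (stdSimplex ℝ (Fin (p + 1))) := fun i => σ ⁻¹' (bif i then U else V)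
  obtain ⟨δ, hδ, hc⟩ := lebesgue_number_lemma_of_metric (c := c) isCompact_univ
    (by rintro (_ | _); exacts [hV.preimage σ.continuous, hU.preimage σ.continuous])
    (by
      intro x _
      have : σ x ∈ U ∪ V := hUV ▸ Set.mem_univ _
      rcases this with h | h
      · exact Set.mem_iUnion.mpr ⟨true, h⟩
      · exact Set.mem_iUnion.mpr ⟨false, h⟩)
  let D := Metric.diam (Set.univ : Set (stdSimplex ℝ (Fin (p + 1))))
  have hr : (p : ℝ) / (p + 1) < 1 := by
    rw [div_lt_one (by positivity)]
    linarith
  have hlim : Filter.Tendsto (fun m : ℕ => ((p : ℝ) / (p + 1)) ^ m * D) Filter.atTop (nhds 0) := by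
    simpa using (tendsto_pow_atTop_nhds_zero_of_lt_one (by positivity) hr).mul_const D
  filter_upwards [hlim.eventually (gt_mem_nhds hδ)] with m hm w hw
  rw [← evalOn_vert σ (Cochain.sd^[m] w), evalOn_sd_iterate]
  refine TupleCochain.subdiv_iterate_eq_zero (fun q v x c h => dist_aff_le v x c h _)
    (fun q v D h => dist_bary_le v D h) p m _ _ D
    (fun i j => Metric.dist_le_diam_of_mem isCompact_univ.isBounded trivial trivial)
    fun u hu => ?_
  obtain ⟨i, hi⟩ := hc (u 0) trivial
  have hran : Set.range (σ.comp (aff u)) ⊆ (bif i then U else V) := by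
    rintro _ ⟨t, rfl⟩
    refine hi (Metric.mem_ball.mpr (lt_of_le_of_lt ?_ hm))
    exact dist_aff_le u (u 0) _ (fun j => hu j 0) t
  refine hw p _ ?_
  cases i
  · exact Or.inr hran
  · exact Or.inl hran

/-- The restriction of cochains to small simplices is a quasi-isomorphism: a cocycle vanishing on
small simplices is the coboundary of a cochain vanishing on small simplices. The cochain is
`σ ↦ ∑ i < m(σ), (sd^i T w)(σ)` where `m(σ)` subdivisions make `σ` and all its faces small. -/
theorem VanishesOn.exists_d_eq (hU : IsOpen U) (hV : IsOpen V) (hUV : U ∪ V = Set.univ)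
    {w : Cochain A X} (hw : w.VanishesOn U V) (hd : w.d = 0) :
    ∃ v : Cochain A X, v.VanishesOn U V ∧ v.d = w := by
  classical
  -- from `M` subdivisions on, all faces of `σ` are small
  let P : ∀ {p : ℕ}, Simp X p → ℕ → Prop := fun {p} σ M =>
    ∀ (q : Fin (p + 1)) (φ : Fin (q.val + 1) → Fin (p + 1)), ∀ m ≥ M, ∀ w : Cochain A X,
      w.VanishesOn U V → Cochain.sd^[m] w q.val (σ.reindex φ) = 0
  have hP : ∀ {p : ℕ} (σ : Simp X p), ∃ M, P σ M := by
    intro p σ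
    have : ∀ᶠ m in Filter.atTop, ∀ (q : Fin (p + 1)) (φ : Fin (q.val + 1) → Fin (p + 1)),
        ∀ w : Cochain A X, w.VanishesOn U V → Cochain.sd^[m] w q.val (σ.reindex φ) = 0 := by
      rw [Filter.eventually_all]
      intro q
      rw [Filter.eventually_all]
      intro φ
      exact eventually_sd_iterate_eq_zero A hU hV hUV _
    obtain ⟨M, hM⟩ := Filter.eventually_atTop.mp this
    exact ⟨M, fun q φ m hm => hM m hm q φ⟩
  -- the least such number does not increase under faces, so that the sum that defines `v` on a face
  -- may be taken over the range of the whole simplex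
  let μ : ∀ {p : ℕ}, Simp X p → ℕ := fun σ => Nat.find (hP σ)
  have hμ : ∀ {p : ℕ} (σ : Simp X p) (m) (_ : μ σ ≤ m) (w : Cochain A X), w.VanishesOn U V →
      Cochain.sd^[m] w p σ = 0 := by
    intro p σ m hm w hw
    have := Nat.find_spec (hP σ) (Fin.last p) id m hm w hw
    rwa [Simp.reindex_id] at this
  have hμface : ∀ {p : ℕ} (σ : Simp X (p + 1)) (i : Fin (p + 2)),
      μ (σ.reindex i.succAbove) ≤ μ σ := by
    intro p σ i
    refine Nat.find_min' (hP (σ.reindex i.succAbove)) fun q φ m hm w hw => ?_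
    rw [Simp.reindex_reindex]
    exact Nat.find_spec (hP σ) q.castSucc (i.succAbove ∘ φ) m hm w hw
  let v : Cochain A X := fun p σ =>
    ∑ i ∈ Finset.range (μ σ), Cochain.sd^[i] (Cochain.sdHomotopy w) p σ
  have hv : ∀ {p : ℕ} (σ : Simp X p) (M) (_ : μ σ ≤ M),
      v p σ = ∑ i ∈ Finset.range M, Cochain.sd^[i] (Cochain.sdHomotopy w) p σ := by
    intro p σ M hM
    refine Finset.sum_subset (Finset.range_mono hM) fun i _ hi => ?_
    exact hμ σ i (by simpa using hi) _ hw.sdHomotopy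
  refine ⟨v, fun p σ hσ => Finset.sum_eq_zero fun i _ =>
    (hw.sdHomotopy.sd_iterate i) p σ hσ, ?_⟩
  have hdsd : ∀ (i : ℕ) (z : Cochain A X), (Cochain.sd^[i] z).d = Cochain.sd^[i] z.d := by
    intro i
    induction i with
    | zero => exact fun z => rfl
    | succ i ih =>
      intro z
      rw [Function.iterate_succ_apply, ih, d_sd, Function.iterate_succ_apply]
  have hstep : (Cochain.sdHomotopy w).d = w - Cochain.sd w := by
    have := sdHomotopy_spec w
    rwa [hd, map_zero, zero_add] at this
  ext (_ | p) σ
  · -- a simplex of dimension zero is small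
    rw [d_zero]
    refine (hw 0 σ ?_).symm
    have hx : Set.range σ ⊆ {σ (vert 0 0)} := by
      rintro _ ⟨t, rfl⟩
      rw [Subsingleton.elim t (vert 0 0)]
      rfl
    have : σ (vert 0 0) ∈ U ∪ V := hUV ▸ Set.mem_univ _
    exact this.imp (fun h => hx.trans (Set.singleton_subset_iff.mpr h))
      fun h => hx.trans (Set.singleton_subset_iff.mpr h)
  · rw [d_succ]
    simp only [hv _ (μ σ) (hμface σ _), altSum_sum]
    have : ∀ i, (altSum fun j => Cochain.sd^[i] (Cochain.sdHomotopy w) p (σ.reindex j.succAbove)) =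
        Cochain.sd^[i] w (p + 1) σ - Cochain.sd^[i + 1] w (p + 1) σ := by
      intro i
      rw [← d_succ, hdsd, hstep, iterate_map_sub, Function.iterate_succ_apply]
      rfl
    simp only [this]
    rw [Finset.sum_range_sub', hμ σ _ le_rfl w hw, sub_zero]
    rfl

end Cochain

end


/-! ### Cohomology groups -/

section Coh

/-- Singular cohomology with coefficients in `A`, all degrees at once: cocycles modulo
coboundaries. -/
def Coh (A X : Type*) [AddCommGroup A] [TopologicalSpace X] : Type _ :=
  (Cochain.d : Cochain A X →+ Cochain A X).ker ⧸
    (Cochain.d : Cochain A X →+ Cochain A X).range.addSubgroupOf Cochain.d.ker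

variable {A B : Type*} [AddCommGroup A] [AddCommGroup B] {X Y Z : Type*} [TopologicalSpace X]
  [TopologicalSpace Y] [TopologicalSpace Z]

instance : AddCommGroup (Coh A X) := inferInstanceAs (AddCommGroup (_ ⧸ _))

namespace Coh

/-- The class of a cocycle. -/
def mk (w : Cochain A X) (hw : w.d = 0) : Coh A X := QuotientAddGroup.mk ⟨w, hw⟩

theorem exists_mk (x : Coh A X) : ∃ (w : Cochain A X) (hw : w.d = 0), mk w hw = x := by
  obtain ⟨⟨w, hw⟩, rfl⟩ := QuotientAddGroup.mk_surjective x
  exact ⟨w, hw, rfl⟩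

theorem mk_add (w w' : Cochain A X) (hw : w.d = 0) (hw' : w'.d = 0) :
    mk (w + w') (by simp [hw, hw']) = mk w hw + mk w' hw' := rfl

theorem mk_neg (w : Cochain A X) (hw : w.d = 0) : mk (-w) (by simp [hw]) = -mk w hw := rfl

theorem mk_sub (w w' : Cochain A X) (hw : w.d = 0) (hw' : w'.d = 0) :
    mk (w - w') (by simp [hw, hw']) = mk w hw - mk w' hw' := rfl

theorem mk_eq_zero {w : Cochain A X} {hw : w.d = 0} : mk w hw = 0 ↔ ∃ v : Cochain A X, v.d = w := by
  refine (QuotientAddGroup.eq_zero_iff _).trans ?_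
  exact AddSubgroup.mem_addSubgroupOf

theorem mk_eq_mk {w w' : Cochain A X} {hw : w.d = 0} {hw' : w'.d = 0} :
    mk w hw = mk w' hw' ↔ ∃ v : Cochain A X, v.d = w - w' := by
  rw [← sub_eq_zero, ← mk_sub, mk_eq_zero]

/-- The map on cohomology induced by an additive map of cochains that preserves cocycles and
coboundaries. -/
def map (f : Cochain A X →+ Cochain B Y) (h₁ : ∀ w, w.d = 0 → (f w).d = 0)
    (h₂ : ∀ v : Cochain A X, ∃ u : Cochain B Y, u.d = f v.d) : Coh A X →+ Coh B Y :=
  QuotientAddGroup.map _ _ ((f.comp (Cochain.d : Cochain A X →+ Cochain A X).ker.subtype).codRestrict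
    (Cochain.d : Cochain B Y →+ Cochain B Y).ker fun w => AddMonoidHom.mem_ker.mpr (h₁ w.1 w.2)) (by
      rintro ⟨w, hw⟩ ⟨v, rfl⟩
      obtain ⟨u, hu⟩ := h₂ v
      exact ⟨u, hu⟩)

/-- The map induced by a continuous map. -/
def pull (f : C(X, Y)) : Coh A Y →+ Coh A X :=
  map (Cochain.pull f) (fun w hw => by rw [Cochain.d_pull, hw, map_zero])
    fun v => ⟨Cochain.pull f v, Cochain.d_pull f v⟩

theorem pull_mk (f : C(X, Y)) (w : Cochain A Y) (hw : w.d = 0) :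
    pull f (mk w hw) = mk (Cochain.pull f w) (by rw [Cochain.d_pull, hw, map_zero]) := rfl

theorem pull_pull (f : C(X, Y)) (g : C(Y, Z)) (x : Coh A Z) :
    pull f (pull g x) = pull (g.comp f) x := by
  obtain ⟨w, hw, rfl⟩ := exists_mk x
  rfl

theorem pull_id (x : Coh A X) : pull (ContinuousMap.id X) x = x := by
  obtain ⟨w, hw, rfl⟩ := exists_mk x
  rfl

theorem pull_eq_of_homotopic {f g : C(X, Y)} (H : f.Homotopic g) (x : Coh A Y) :
    pull f x = pull g x := by
  obtain ⟨w, hw, rfl⟩ := exists_mk x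
  obtain ⟨P, hP⟩ := exists_homotopyOperator (A := A) H.some
  rw [pull_mk, pull_mk, eq_comm, mk_eq_mk]
  refine ⟨P w, ?_⟩
  rw [← hP, hw, map_zero, zero_add]

/-- Projection to the part of degree `p`; a class `x` is homogeneous of degree `p` if `pr p x = x`. -/
def pr (p : ℕ) : Coh A X →+ Coh A X :=
  map (Cochain.pr p) (fun w hw => by rw [Cochain.d_pr, hw, map_zero]) fun v => by
    cases p with
    | zero => exact ⟨0, by rw [Cochain.pr_zero_d, map_zero]⟩
    | succ p => exact ⟨Cochain.pr p v, Cochain.d_pr p v⟩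

theorem pr_mk (p : ℕ) (w : Cochain A X) (hw : w.d = 0) :
    pr p (mk w hw) = mk (Cochain.pr p w) (by rw [Cochain.d_pr, hw, map_zero]) := rfl

theorem pr_pull (p : ℕ) (f : C(X, Y)) (x : Coh A Y) : pr p (pull f x) = pull f (pr p x) := by
  obtain ⟨w, hw, rfl⟩ := exists_mk x
  simp only [pr_mk, pull_mk, Cochain.pr_pull]

/-- The sign involution, `(-1)^p` in degree `p`. -/
def sgn : Coh A X →+ Coh A X :=
  map Cochain.sgn
    (fun w hw => by
      rw [← neg_eq_zero, ← Cochain.sgn_d, hw, map_zero])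
    fun v => ⟨-Cochain.sgn v, by rw [map_neg, Cochain.sgn_d]⟩

theorem d_sgn_eq_zero {w : Cochain A X} (hw : w.d = 0) : w.sgn.d = 0 := by
  rw [← neg_eq_zero, ← Cochain.sgn_d, hw, map_zero]

theorem sgn_mk (w : Cochain A X) (hw : w.d = 0) :
    sgn (mk w hw) = mk (Cochain.sgn w) (d_sgn_eq_zero hw) := rfl

theorem sgn_pull (f : C(X, Y)) (x : Coh A Y) : sgn (pull f x) = pull f (sgn x) := by
  obtain ⟨w, hw, rfl⟩ := exists_mk x
  rfl

theorem sgn_sgn (x : Coh A X) : sgn (sgn x) = x := by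
  obtain ⟨w, hw, rfl⟩ := exists_mk x
  simp only [sgn_mk, Cochain.sgn_sgn]

variable (m : A →+ A →+ A)

theorem d_cup_eq_zero {a b : Cochain A X} (ha : a.d = 0) (hb : b.d = 0) :
    (Cochain.cup m a b).d = 0 := by
  rw [Cochain.d_cup, ha, hb, Cochain.cup_zero_left, Cochain.cup_zero_right, add_zero]

/-- The cup product on cohomology. -/
def cup (x y : Coh A X) : Coh A X :=
  mk (Cochain.cup m (exists_mk x).choose (exists_mk y).choose)
    (d_cup_eq_zero m (exists_mk x).choose_spec.choose (exists_mk y).choose_spec.choose)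

theorem cup_mk (a b : Cochain A X) (ha : a.d = 0) (hb : b.d = 0) :
    cup m (mk a ha) (mk b hb) = mk (Cochain.cup m a b) (d_cup_eq_zero m ha hb) := by
  rw [cup]
  generalize_proofs h₁ h₂ h₃ h₄ h₅
  obtain ⟨ha', ea⟩ := h₁.choose_spec
  obtain ⟨hb', eb⟩ := h₂.choose_spec
  generalize h₁.choose = a' at *
  generalize h₂.choose = b' at *
  obtain ⟨v, hv⟩ := mk_eq_mk.mp ea
  obtain ⟨u, hu⟩ := mk_eq_mk.mp eb
  refine mk_eq_mk.mpr ⟨Cochain.cup m v b' + Cochain.cup m a.sgn u, ?_⟩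
  rw [map_add, Cochain.d_cup, Cochain.d_cup, hb', Cochain.cup_zero_right, add_zero,
    d_sgn_eq_zero ha, Cochain.cup_zero_left, zero_add, Cochain.sgn_sgn, hv, hu]
  have e₁ : Cochain.cup m a' b' = Cochain.cup m (a' - a) b' + Cochain.cup m a b' := by
    rw [← Cochain.cup_add_left, sub_add_cancel]
  have e₂ : Cochain.cup m a b' = Cochain.cup m a (b' - b) + Cochain.cup m a b := by
    rw [← Cochain.cup_add_right, sub_add_cancel]
  rw [e₁, e₂]
  abel

theorem cup_add_left (x x' y : Coh A X) : cup m (x + x') y = cup m x y + cup m x' y := by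
  obtain ⟨a, ha, rfl⟩ := exists_mk x
  obtain ⟨a', ha', rfl⟩ := exists_mk x'
  obtain ⟨b, hb, rfl⟩ := exists_mk y
  simp only [← mk_add, cup_mk, Cochain.cup_add_left]

theorem cup_add_right (y x x' : Coh A X) : cup m y (x + x') = cup m y x + cup m y x' := by
  obtain ⟨a, ha, rfl⟩ := exists_mk x
  obtain ⟨a', ha', rfl⟩ := exists_mk x'
  obtain ⟨b, hb, rfl⟩ := exists_mk y
  simp only [← mk_add, cup_mk, Cochain.cup_add_right]

/-- The cup product as a biadditive map. -/
def cupHom : Coh A X →+ Coh A X →+ Coh A X :=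
  AddMonoidHom.mk' (fun x => AddMonoidHom.mk' (cup m x) (cup_add_right m x)) fun x x' => by
    ext y
    exact cup_add_left m x x' y

theorem cup_zero_left (y : Coh A X) : cup m 0 y = 0 :=
  DFunLike.congr_fun (map_zero (cupHom m)) y

theorem cup_zero_right (y : Coh A X) : cup m y 0 = 0 := map_zero (cupHom m y)

theorem cup_sub_left (x x' y : Coh A X) : cup m (x - x') y = cup m x y - cup m x' y :=
  DFunLike.congr_fun (map_sub (cupHom m) x x') y

theorem cup_sub_right (y x x' : Coh A X) : cup m y (x - x') = cup m y x - cup m y x' :=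
  map_sub (cupHom m y) x x'

theorem pull_cup (f : C(X, Y)) (x y : Coh A Y) :
    pull f (cup m x y) = cup m (pull f x) (pull f y) := by
  obtain ⟨a, ha, rfl⟩ := exists_mk x
  obtain ⟨b, hb, rfl⟩ := exists_mk y
  simp only [pull_mk, cup_mk, Cochain.pull_cup]

/-- In degree zero the cup product is pointwise, so that squares vanish only if the class does. -/
theorem eq_zero_of_cup_self_of_degree_zero (hm : ∀ a, m a a = 0 → a = 0) {c : ℤ}
    (hc : ∀ a : A, c • a = 0 → a = 0) (x : Coh A X) (hx : pr 0 x = x)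
    (hxx : c • cup m x x = 0) : x = 0 := by
  obtain ⟨w, hw, rfl⟩ := exists_mk x
  rw [cup_mk] at hxx
  obtain ⟨v, hv⟩ := mk_eq_zero.mp (show mk (c • Cochain.cup m w w) (by
    rw [map_zsmul, d_cup_eq_zero m hw hw, smul_zero]) = 0 from hxx)
  rw [← hx, pr_mk, mk_eq_zero]
  refine ⟨0, ?_⟩
  rw [map_zero]
  ext p σ
  rcases Nat.eq_zero_or_pos p with rfl | hp
  · have := congrFun (congrFun hv 0) σ
    rw [Cochain.d_zero, Pi.smul_apply, Pi.smul_apply, Cochain.cup_zero_apply] at this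
    simp [hm _ (hc _ this.symm)]
  · simp [Cochain.pr_apply, hp.ne']

/-- The cohomology of a point is concentrated in degree zero. -/
theorem pr_eq_zero_of_subsingleton [Subsingleton X] {p : ℕ} (hp : p ≠ 0) (x : Coh A X) :
    pr p x = 0 := by
  obtain ⟨w, hw, rfl⟩ := exists_mk x
  obtain ⟨p, rfl⟩ := Nat.exists_eq_succ_of_ne_zero hp
  rw [pr_mk, mk_eq_zero]
  have hsub : ∀ q, Subsingleton (Simp X q) := fun q => ⟨fun a b => by
    ext t
    exact Subsingleton.elim _ _⟩
  -- the alternating sum of `N` equal terms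
  have halt : ∀ (N : ℕ) (a : A), (altSum fun _ : Fin N => a) = if Even N then 0 else a := by
    intro N a
    induction N with
    | zero => simp [altSum]
    | succ N ih =>
      rw [altSum] at ih ⊢
      rw [Fin.sum_univ_castSucc]
      simp only [Fin.val_castSucc, Fin.val_last, ih]
      by_cases h : Even N <;> simp [h, Nat.even_add_one, Odd.neg_one_pow,
        Nat.not_even_iff_odd.mp]
  rcases Nat.even_or_odd p with hpar | hpar
  · -- the coboundary from degree `p` to degree `p + 1` is zero and the next one is injective
    refine ⟨0, ?_⟩
    rw [map_zero]
    ext q σ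
    by_cases hq : q = p + 1
    · subst hq
      have h := congrFun (congrFun hw (p + 2)) (ContinuousMap.const _ (σ (vert _ 0)))
      rw [Cochain.d_succ] at h
      simp only [fun i => (hsub (p + 1)).elim (Simp.reindex (ContinuousMap.const
        (stdSimplex ℝ (Fin (p + 2 + 1))) (σ (vert _ 0))) (Fin.succAbove i)) σ] at h
      rw [halt, if_neg (by
        rw [Nat.not_even_iff_odd]
        obtain ⟨k, rfl⟩ := hpar
        exact ⟨k + 1, by ring⟩)] at h
      simp [h]
    · simp [Cochain.pr_apply, hq]
  · refine ⟨Cochain.pr p fun q σ => w (q + 1) (ContinuousMap.const _ (σ (vert _ 0))), ?_⟩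
    rw [Cochain.d_pr]
    ext q σ
    by_cases hq : q = p + 1
    · subst hq
      rw [Cochain.pr_apply_self, Cochain.pr_apply_self, Cochain.d_succ]
      simp only [fun x => (hsub (p + 1)).elim (ContinuousMap.const _ x) σ]
      rw [halt, if_neg (by
        rw [Nat.not_even_iff_odd]
        obtain ⟨k, rfl⟩ := hpar
        exact ⟨k + 1, by ring⟩)]
    · simp [Cochain.pr_apply, hq]

end Coh

end Coh

/-! ### The Mayer–Vietoris sequence -/

section MayerVietoris

variable {A : Type*} [AddCommGroup A] {P : Type*} [TopologicalSpace P]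

/-- The inclusion of subsets as a continuous map. -/
def incl {S T : Set P} (h : S ⊆ T) : C(S, T) := ⟨Set.inclusion h, continuous_inclusion h⟩

/-- Restriction of cochains to a smaller subset. -/
def Cochain.res {S T : Set P} (h : S ⊆ T) : Cochain A T →+ Cochain A S := Cochain.pull (incl h)

theorem Cochain.d_res {S T : Set P} (h : S ⊆ T) (w : Cochain A T) :
    (Cochain.res h w).d = Cochain.res h w.d := Cochain.d_pull _ _

theorem Cochain.res_res {R S T : Set P} (h : R ⊆ S) (h' : S ⊆ T) (w : Cochain A T) :
    Cochain.res h (Cochain.res h' w) = Cochain.res (h.trans h') w := rfl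

/-- Restriction of cohomology classes to a smaller subset. -/
def Coh.res {S T : Set P} (h : S ⊆ T) : Coh A T →+ Coh A S := Coh.pull (incl h)

theorem Coh.res_mk {S T : Set P} (h : S ⊆ T) (w : Cochain A T) (hw : w.d = 0) :
    Coh.res h (Coh.mk w hw) = Coh.mk (Cochain.res h w) (by rw [Cochain.d_res, hw, map_zero]) :=
  rfl

theorem Coh.res_res {R S T : Set P} (h : R ⊆ S) (h' : S ⊆ T) (x : Coh A T) :
    Coh.res h (Coh.res h' x) = Coh.res (h.trans h') x := Coh.pull_pull _ _ _

/-- Extension of cochains by zero. -/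
def Cochain.extend {S T : Set P} (c : Cochain A S) : Cochain A T := fun p σ =>
  open scoped Classical in
  if h : ∀ t, (σ t : P) ∈ S then c p ⟨fun t => ⟨σ t, h t⟩, by fun_prop⟩ else 0

theorem Cochain.res_extend {S T : Set P} (h : S ⊆ T) (c : Cochain A S) :
    Cochain.res h (Cochain.extend c) = c := by
  ext p σ
  exact dif_pos (c := ∀ t, (((incl h).comp σ) t : P) ∈ S) fun t => (σ t).2

/-- A cover of `T` by two open sets `U` and `V` with intersection `C`. -/
structure IsOpenPair (T U V C : Set P) : Prop where
  isOpen_left : IsOpen U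
  isOpen_right : IsOpen V
  union_eq : U ∪ V = T
  inter_eq : U ∩ V = C

namespace IsOpenPair

variable {T U V C : Set P} (h : IsOpenPair T U V C)

include h

theorem left : U ⊆ T := h.union_eq ▸ Set.subset_union_left

theorem right : V ⊆ T := h.union_eq ▸ Set.subset_union_right

theorem inter_left : C ⊆ U := h.inter_eq ▸ Set.inter_subset_left

theorem inter_right : C ⊆ V := h.inter_eq ▸ Set.inter_subset_right

theorem inter : C ⊆ T := h.inter_left.trans h.left

/-- Cochains on `T` that vanish on `U` and on `V` form an acyclic complex. -/
theorem exists_d_eq_of_res_eq_zero {w : Cochain A T} (hw : w.d = 0)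
    (hU : Cochain.res h.left w = 0) (hV : Cochain.res h.right w = 0) :
    ∃ v : Cochain A T, v.d = w ∧ Cochain.res h.left v = 0 ∧ Cochain.res h.right v = 0 := by
  have hvan : w.VanishesOn (Subtype.val ⁻¹' U) (Subtype.val ⁻¹' V) := by
    rintro p σ (hσ | hσ)
    · exact congrFun (congrFun hU p)
        ⟨fun t => ⟨σ t, hσ ⟨t, rfl⟩⟩, by fun_prop⟩
    · exact congrFun (congrFun hV p)
        ⟨fun t => ⟨σ t, hσ ⟨t, rfl⟩⟩, by fun_prop⟩
  obtain ⟨v, hv, hd⟩ := hvan.exists_d_eq (h.isOpen_left.preimage continuous_subtype_val)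
    (h.isOpen_right.preimage continuous_subtype_val) (by
      rw [← Set.preimage_union, h.union_eq, Subtype.coe_preimage_self]) hw
  refine ⟨v, hd, ?_, ?_⟩
  · ext p σ
    refine hv p _ (Or.inl ?_)
    rintro _ ⟨t, rfl⟩
    exact (σ t).2
  · ext p σ
    refine hv p _ (Or.inr ?_)
    rintro _ ⟨t, rfl⟩
    exact (σ t).2

theorem exists_glue {a : Cochain A U} {b : Cochain A V}
    (hab : Cochain.res h.inter_left a = Cochain.res h.inter_right b) :
    ∃ z : Cochain A T, Cochain.res h.left z = a ∧ Cochain.res h.right z = b := by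
  classical
  refine ⟨fun p σ => if ∀ t, (σ t : P) ∈ U then Cochain.extend a p σ else Cochain.extend b p σ,
    ?_, ?_⟩
  · ext p σ
    refine (if_pos fun t => (σ t).2).trans ?_
    exact congrFun (congrFun (Cochain.res_extend h.left a) p) σ
  · ext p σ
    by_cases hσ : ∀ t, (σ t : P) ∈ U
    · refine (if_pos hσ).trans ?_
      have hC : ∀ t, (σ t : P) ∈ C := fun t => h.inter_eq ▸ ⟨hσ t, (σ t).2⟩
      refine (dif_pos hσ).trans ?_
      exact congrFun (congrFun hab p) ⟨fun t => ⟨σ t, hC t⟩, by fun_prop⟩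
    · refine (if_neg hσ).trans ?_
      exact congrFun (congrFun (Cochain.res_extend h.right b) p) σ

theorem exists_glue_cocycle {a : Cochain A U} {b : Cochain A V}
    (hab : Cochain.res h.inter_left a = Cochain.res h.inter_right b) (ha : a.d = 0)
    (hb : b.d = 0) :
    ∃ z : Cochain A T, z.d = 0 ∧ Cochain.res h.left z = a ∧ Cochain.res h.right z = b := by
  obtain ⟨z, hzU, hzV⟩ := h.exists_glue hab
  obtain ⟨v, hv, hvU, hvV⟩ := h.exists_d_eq_of_res_eq_zero (Cochain.d_d z)
    (by rw [← Cochain.d_res, hzU, ha]) (by rw [← Cochain.d_res, hzV, hb])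
  exact ⟨z - v, by rw [map_sub, hv, sub_self], by rw [map_sub, hzU, hvU, sub_zero],
    by rw [map_sub, hzV, hvV, sub_zero]⟩

theorem exists_d_eq_of_res_eq_d {z : Cochain A T} (hz : z.d = 0) {a : Cochain A U}
    {b : Cochain A V} (hab : Cochain.res h.inter_left a = Cochain.res h.inter_right b)
    (ha : Cochain.res h.left z = a.d) (hb : Cochain.res h.right z = b.d) :
    ∃ v : Cochain A T, v.d = z := by
  obtain ⟨y, hyU, hyV⟩ := h.exists_glue hab
  obtain ⟨v, hv, -, -⟩ := h.exists_d_eq_of_res_eq_zero (w := z - y.d)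
    (by rw [map_sub, hz, Cochain.d_d, sub_zero])
    (by rw [map_sub, ha, ← Cochain.d_res, hyU, sub_self])
    (by rw [map_sub, hb, ← Cochain.d_res, hyV, sub_self])
  exact ⟨v + y, by rw [map_add, hv, sub_add_cancel]⟩

/-- Classes on the two open sets that agree on the intersection come from a class on the union. -/
theorem exists_res_eq {a : Coh A U} {b : Coh A V}
    (hab : Coh.res h.inter_left a = Coh.res h.inter_right b) :
    ∃ x : Coh A T, Coh.res h.left x = a ∧ Coh.res h.right x = b := by
  obtain ⟨a, ha, rfl⟩ := Coh.exists_mk a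
  obtain ⟨b, hb, rfl⟩ := Coh.exists_mk b
  rw [Coh.res_mk, Coh.res_mk] at hab
  obtain ⟨v, hv⟩ := Coh.mk_eq_mk.mp hab
  have hv' : Cochain.res h.inter_left (Cochain.extend v : Cochain A U).d = v.d := by
    rw [← Cochain.d_res, Cochain.res_extend]
  obtain ⟨z, hz, hzU, hzV⟩ := h.exists_glue_cocycle
    (a := a - (Cochain.extend v : Cochain A U).d) (b := b)
    (by rw [map_sub, hv', hv, sub_sub_cancel]) (by rw [map_sub, ha, Cochain.d_d, sub_zero]) hb
  refine ⟨Coh.mk z hz, ?_, ?_⟩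
  · rw [Coh.res_mk, Coh.mk_eq_mk]
    exact ⟨-Cochain.extend v, by rw [hzU, map_neg]; abel⟩
  · rw [Coh.res_mk, Coh.mk_eq_mk]
    exact ⟨0, by rw [hzV, map_zero, sub_self]⟩

/-- The graph of the connecting homomorphism: `c` is the difference of cochains `a` on `U` and `b`
on `V` whose coboundaries are the restrictions of a cocycle representing `x`. -/
def Connects (c : Coh A C) (x : Coh A T) : Prop :=
  ∃ (a : Cochain A U) (b : Cochain A V) (z : Cochain A T) (hz : z.d = 0)
    (_ : Cochain.res h.left z = a.d) (_ : Cochain.res h.right z = b.d)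
    (hc : (Cochain.res h.inter_left a - Cochain.res h.inter_right b).d = 0),
    Coh.mk _ hc = c ∧ Coh.mk z hz = x

theorem exists_connects (c : Coh A C) : ∃ x, h.Connects c x := by
  obtain ⟨c, hc, rfl⟩ := Coh.exists_mk c
  have e := Cochain.res_extend h.inter_left c
  obtain ⟨z, hz, hzU, hzV⟩ := h.exists_glue_cocycle (a := (Cochain.extend c : Cochain A U).d)
    (b := 0) (by rw [← Cochain.d_res, e, hc, map_zero]) (Cochain.d_d _) (map_zero _)
  exact ⟨Coh.mk z hz, Cochain.extend c, 0, z, hz, hzU, by rw [hzV, map_zero],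
    by rw [e, map_zero, sub_zero, hc], by simp only [e, map_zero, sub_zero], rfl⟩

variable {h}

omit h in
theorem Connects.add {h : IsOpenPair T U V C} {c c' : Coh A C} {x x' : Coh A T}
    (hx : h.Connects c x) (hx' : h.Connects c' x') : h.Connects (c + c') (x + x') := by
  obtain ⟨a, b, z, hz, ha, hb, hc, rfl, rfl⟩ := hx
  obtain ⟨a', b', z', hz', ha', hb', hc', rfl, rfl⟩ := hx'
  have e : Cochain.res h.inter_left (a + a') - Cochain.res h.inter_right (b + b') =
      (Cochain.res h.inter_left a - Cochain.res h.inter_right b) +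
        (Cochain.res h.inter_left a' - Cochain.res h.inter_right b') := by
    rw [map_add, map_add]
    abel
  refine ⟨a + a', b + b', z + z', by rw [map_add, hz, hz', add_zero], by simp [ha, ha'],
    by simp [hb, hb'], by rw [e, map_add, hc, hc', add_zero], ?_, rfl⟩
  rw [← Coh.mk_add]
  simp only [e]

omit h in
theorem Connects.neg {h : IsOpenPair T U V C} {c : Coh A C} {x : Coh A T}
    (hx : h.Connects c x) : h.Connects (-c) (-x) := by
  obtain ⟨a, b, z, hz, ha, hb, hc, rfl, rfl⟩ := hx
  have e : Cochain.res h.inter_left (-a) - Cochain.res h.inter_right (-b) =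
      -(Cochain.res h.inter_left a - Cochain.res h.inter_right b) := by
    rw [map_neg, map_neg]
    abel
  refine ⟨-a, -b, -z, by rw [map_neg, hz, neg_zero], by simp [ha],
    by simp [hb], by rw [e, map_neg, hc, neg_zero], ?_, rfl⟩
  rw [← Coh.mk_neg]
  simp only [e]

omit h in
theorem Connects.eq_zero {h : IsOpenPair T U V C} {x : Coh A T} (hx : h.Connects 0 x) :
    x = 0 := by
  obtain ⟨a, b, z, hz, ha, hb, hc, hc0, rfl⟩ := hx
  obtain ⟨v, hv⟩ := Coh.mk_eq_zero.mp hc0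
  have hv' : Cochain.res h.inter_left (Cochain.extend v : Cochain A U).d = v.d := by
    rw [← Cochain.d_res, Cochain.res_extend]
  refine Coh.mk_eq_zero.mpr (h.exists_d_eq_of_res_eq_d hz
    (a := a - (Cochain.extend v : Cochain A U).d) (b := b) ?_ ?_ hb)
  · rw [map_sub, hv', hv, sub_sub_cancel]
  · rw [map_sub, Cochain.d_d, sub_zero, ha]

omit h in
theorem Connects.unique {h : IsOpenPair T U V C} {c : Coh A C} {x x' : Coh A T}
    (hx : h.Connects c x) (hx' : h.Connects c x') : x = x' := by
  have := hx.add hx'.neg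
  rw [add_neg_cancel, ← sub_eq_add_neg] at this
  exact sub_eq_zero.mp this.eq_zero

variable (h)

/-- The connecting homomorphism of the Mayer–Vietoris sequence. -/
def conn : Coh A C →+ Coh A T :=
  AddMonoidHom.mk' (fun c => (h.exists_connects c).choose) fun c c' =>
    (h.exists_connects (c + c')).choose_spec.unique
      ((h.exists_connects c).choose_spec.add (h.exists_connects c').choose_spec)

theorem connects_conn (c : Coh A C) : h.Connects c (h.conn c) := (h.exists_connects c).choose_spec

end IsOpenPair

end MayerVietoris


section

variable {A : Type*} [AddCommGroup A] {P : Type*} [TopologicalSpace P]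

theorem Coh.res_cup {S T : Set P} (h : S ⊆ T) (m : A →+ A →+ A) (x y : Coh A T) :
    Coh.res h (Coh.cup m x y) = Coh.cup m (Coh.res h x) (Coh.res h y) := Coh.pull_cup _ _ _ _

theorem Coh.res_pr {S T : Set P} (h : S ⊆ T) (p : ℕ) (x : Coh A T) :
    Coh.res h (Coh.pr p x) = Coh.pr p (Coh.res h x) := (Coh.pr_pull _ _ _).symm

theorem Coh.res_sgn {S T : Set P} (h : S ⊆ T) (x : Coh A T) :
    Coh.res h (Coh.sgn x) = Coh.sgn (Coh.res h x) := (Coh.sgn_pull _ _).symm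

namespace IsOpenPair

variable {T U V C : Set P}

theorem Connects.conn_eq {h : IsOpenPair T U V C} {c : Coh A C} {x : Coh A T}
    (hx : h.Connects c x) : h.conn c = x := (h.connects_conn c).unique hx

variable (h : IsOpenPair T U V C)

theorem res_left_conn (c : Coh A C) : Coh.res h.left (h.conn c) = 0 := by
  obtain ⟨a, b, z, hz, ha, hb, hc, rfl, hx⟩ := h.connects_conn c
  rw [← hx, Coh.res_mk, Coh.mk_eq_zero]
  exact ⟨a, ha.symm⟩

/-- Exactness of the Mayer–Vietoris sequence at the union. -/
theorem exists_conn_eq {x : Coh A T} (hU : Coh.res h.left x = 0) (hV : Coh.res h.right x = 0) :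
    ∃ c, h.conn c = x := by
  obtain ⟨z, hz, rfl⟩ := Coh.exists_mk x
  rw [Coh.res_mk, Coh.mk_eq_zero] at hU hV
  obtain ⟨a, ha⟩ := hU
  obtain ⟨b, hb⟩ := hV
  exact ⟨_, Connects.conn_eq ⟨a, b, z, hz, ha.symm, hb.symm, by
    rw [map_sub, Cochain.d_res, Cochain.d_res, ha, hb]
    exact sub_self _, rfl, rfl⟩⟩

/-- Exactness of the Mayer–Vietoris sequence at the intersection. -/
theorem exists_eq_sub_of_conn_eq_zero {c : Coh A C} (hc : h.conn c = 0) :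
    ∃ (a : Coh A U) (b : Coh A V), c = Coh.res h.inter_left a - Coh.res h.inter_right b := by
  obtain ⟨a, b, z, hz, ha, hb, hab, rfl, hx⟩ := h.connects_conn c
  rw [hc, Coh.mk_eq_zero] at hx
  obtain ⟨v, rfl⟩ := hx
  refine ⟨Coh.mk (a - Cochain.res h.left v) ?_, Coh.mk (b - Cochain.res h.right v) ?_, ?_⟩
  · rw [map_sub, Cochain.d_res, ha, sub_self]
  · rw [map_sub, Cochain.d_res, hb, sub_self]
  · rw [Coh.res_mk, Coh.res_mk, ← Coh.mk_sub, Coh.mk_eq_mk]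
    refine ⟨0, ?_⟩
    rw [map_zero, map_sub, map_sub, Cochain.res_res, Cochain.res_res]
    abel

theorem conn_res_left (a : Coh A U) : h.conn (Coh.res h.inter_left a) = 0 := by
  obtain ⟨a, ha, rfl⟩ := Coh.exists_mk a
  refine Connects.conn_eq ⟨a, 0, 0, map_zero _, by rw [map_zero, ha], by simp, ?_, ?_, ?_⟩
  · rw [map_zero, sub_zero, Cochain.d_res, ha, map_zero]
  · simp only [Coh.res_mk, map_zero, sub_zero]
  · rfl

/-- The connecting homomorphism is linear over the cohomology of the union. -/
theorem conn_cup_res (m : A →+ A →+ A) (c : Coh A C) (y : Coh A T) :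
    h.conn (Coh.cup m c (Coh.res h.inter y)) = Coh.cup m (h.conn c) y := by
  obtain ⟨a, b, z, hz, ha, hb, hc, rfl, hx⟩ := h.connects_conn c
  obtain ⟨y, hy, rfl⟩ := Coh.exists_mk y
  rw [← hx, Coh.res_mk, Coh.cup_mk, Coh.cup_mk]
  have e : Cochain.res h.inter_left (Cochain.cup m a (Cochain.res h.left y)) -
      Cochain.res h.inter_right (Cochain.cup m b (Cochain.res h.right y)) =
        Cochain.cup m (Cochain.res h.inter_left a - Cochain.res h.inter_right b)
          (Cochain.res h.inter y) := by
    rw [sub_eq_iff_eq_add]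
    change Cochain.cup m (Cochain.res h.inter_left a) (Cochain.res h.inter y) =
      _ + Cochain.cup m (Cochain.res h.inter_right b) (Cochain.res h.inter y)
    rw [← Cochain.cup_add_left, sub_add_cancel]
  have hdy : (Cochain.res h.inter y).d = 0 := by rw [Cochain.d_res, hy, map_zero]
  refine Connects.conn_eq ⟨Cochain.cup m a (Cochain.res h.left y),
    Cochain.cup m b (Cochain.res h.right y), Cochain.cup m z y, Coh.d_cup_eq_zero m hz hy,
    ?_, ?_, ?_, ?_, rfl⟩
  · rw [Cochain.d_cup, Cochain.d_res, hy, map_zero, Cochain.cup_zero_right, add_zero, ← ha]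
    rfl
  · rw [Cochain.d_cup, Cochain.d_res, hy, map_zero, Cochain.cup_zero_right, add_zero, ← hb]
    rfl
  · rw [e]
    exact Coh.d_cup_eq_zero m hc hdy
  · simp only [e]

/-- Left multiplication commutes with the connecting homomorphism up to sign. -/
theorem conn_res_cup (m : A →+ A →+ A) (c : Coh A C) (y : Coh A T) :
    h.conn (Coh.cup m (Coh.res h.inter y) c) = Coh.cup m (Coh.sgn y) (h.conn c) := by
  obtain ⟨a, b, z, hz, ha, hb, hc, rfl, hx⟩ := h.connects_conn c
  obtain ⟨y, hy, rfl⟩ := Coh.exists_mk y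
  rw [← hx, Coh.res_mk, Coh.sgn_mk, Coh.cup_mk, Coh.cup_mk]
  have e : Cochain.res h.inter_left (Cochain.cup m (Cochain.res h.left y) a) -
      Cochain.res h.inter_right (Cochain.cup m (Cochain.res h.right y) b) =
        Cochain.cup m (Cochain.res h.inter y)
          (Cochain.res h.inter_left a - Cochain.res h.inter_right b) := by
    rw [sub_eq_iff_eq_add]
    change Cochain.cup m (Cochain.res h.inter y) (Cochain.res h.inter_left a) =
      _ + Cochain.cup m (Cochain.res h.inter y) (Cochain.res h.inter_right b)
    rw [← Cochain.cup_add_right, sub_add_cancel]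
  have hdy : (Cochain.res h.inter y).d = 0 := by rw [Cochain.d_res, hy, map_zero]
  refine Connects.conn_eq ⟨Cochain.cup m (Cochain.res h.left y) a,
    Cochain.cup m (Cochain.res h.right y) b, Cochain.cup m y.sgn z,
    Coh.d_cup_eq_zero m (Coh.d_sgn_eq_zero hy) hz, ?_, ?_, ?_, ?_, rfl⟩
  · rw [Cochain.d_cup, Cochain.d_res, hy, map_zero, Cochain.cup_zero_left, zero_add, ← ha]
    rfl
  · rw [Cochain.d_cup, Cochain.d_res, hy, map_zero, Cochain.cup_zero_left, zero_add, ← hb]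
    rfl
  · rw [e]
    exact Coh.d_cup_eq_zero m hdy hc
  · simp only [e]

theorem pr_succ_conn (p : ℕ) (c : Coh A C) : Coh.pr (p + 1) (h.conn c) = h.conn (Coh.pr p c) := by
  obtain ⟨a, b, z, hz, ha, hb, hc, rfl, hx⟩ := h.connects_conn c
  rw [← hx, Coh.pr_mk, Coh.pr_mk]
  have e : Cochain.res h.inter_left (Cochain.pr p a) - Cochain.res h.inter_right (Cochain.pr p b) =
      Cochain.pr p (Cochain.res h.inter_left a - Cochain.res h.inter_right b) := by
    rw [map_sub, Cochain.res, Cochain.res, ← Cochain.pr_pull, ← Cochain.pr_pull]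
  refine (Connects.conn_eq ⟨Cochain.pr p a, Cochain.pr p b, Cochain.pr (p + 1) z, ?_, ?_, ?_, ?_,
    ?_, rfl⟩).symm
  · rw [Cochain.d_pr, ← ha, Cochain.res, Cochain.pr_pull]
  · rw [Cochain.d_pr, ← hb, Cochain.res, Cochain.pr_pull]
  · rw [e, Cochain.d_pr, hc, map_zero]
  · simp only [e]

theorem pr_zero_conn (c : Coh A C) : Coh.pr 0 (h.conn c) = 0 := by
  obtain ⟨a, b, z, hz, ha, hb, hc, rfl, hx⟩ := h.connects_conn c
  rw [← hx, Coh.pr_mk]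
  refine (Connects.conn_eq (h := h) (c := 0) ⟨0, 0, Cochain.pr 0 z, ?_, ?_, ?_, by simp, ?_,
    rfl⟩).symm.trans (map_zero _)
  · rw [map_zero, Cochain.res, ← Cochain.pr_pull]
    exact (congrArg _ ha).trans (Cochain.pr_zero_d a)
  · rw [map_zero, Cochain.res, ← Cochain.pr_pull]
    exact (congrArg _ hb).trans (Cochain.pr_zero_d b)
  · exact Coh.mk_eq_zero.mpr ⟨0, by simp⟩

theorem sgn_conn (c : Coh A C) : Coh.sgn (h.conn c) = -h.conn (Coh.sgn c) := by
  obtain ⟨a, b, z, hz, ha, hb, hc, rfl, hx⟩ := h.connects_conn c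
  rw [← hx, Coh.sgn_mk, Coh.sgn_mk, ← map_neg, ← Coh.mk_neg]
  have e : Cochain.res h.inter_left (-a.sgn) - Cochain.res h.inter_right (-b.sgn) =
      -(Cochain.res h.inter_left a - Cochain.res h.inter_right b).sgn := by
    rw [map_sub, map_neg, map_neg, Cochain.res, Cochain.res, ← Cochain.sgn_pull,
      ← Cochain.sgn_pull]
    abel
  refine (Connects.conn_eq ⟨-a.sgn, -b.sgn, z.sgn, Coh.d_sgn_eq_zero hz, ?_, ?_, ?_, ?_,
    rfl⟩).symm
  · rw [map_neg, ← Cochain.sgn_d, ← ha]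
    rfl
  · rw [map_neg, ← Cochain.sgn_d, ← hb]
    rfl
  · rw [e, map_neg, Coh.d_sgn_eq_zero hc, neg_zero]
  · simp only [e]

end IsOpenPair

end


/-! ### Iterated Mayer–Vietoris decompositions -/

section

variable {A : Type*} [AddCommGroup A] {P Z : Type*} [TopologicalSpace P] [TopologicalSpace Z]

/-- Restriction of a map to a smaller subset. -/
def restr {S T : Set P} (h : S ⊆ T) (φ : C(T, Z)) : C(S, Z) := φ.comp (incl h)

theorem Coh.res_pull {S T : Set P} (h : S ⊆ T) (φ : C(T, Z)) (r : Coh A Z) :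
    Coh.res h (Coh.pull φ r) = Coh.pull (restr h φ) r := Coh.pull_pull _ _ _

theorem Coh.subsingleton_of_isEmpty {X : Type*} [TopologicalSpace X] [IsEmpty X] (x : Coh A X) :
    x = 0 := by
  obtain ⟨w, hw, rfl⟩ := Coh.exists_mk x
  refine Coh.mk_eq_zero.mpr ⟨0, ?_⟩
  ext p σ
  exact isEmptyElim (σ (vert p 0))

/-- The properties of the composite of `j` inverse connecting homomorphisms
`κ : H^{p+j}(T) → H^p(Z)`. Here `T` is like the product of a `j`-sphere with `F`, and the map
`φ : T → Z` is a cohomology isomorphism on `F`. Together with the restriction to `F`, the map `κ`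
detects all classes on `T`. It kills the classes that come from `Z`, and it is linear over `H(Z)` up
to sign. -/
structure IsWangMap (j : ℕ) {T F : Set P} (hF : F ⊆ T) (φ : C(T, Z))
    (κ : Coh A T →+ Coh A Z) : Prop where
  eq_zero : ∀ x, κ x = 0 → Coh.res hF x = 0 → x = 0
  pull : ∀ r, κ (Coh.pull φ r) = 0
  cup_right : ∀ m x r, κ (Coh.cup m x (Coh.pull φ r)) = Coh.cup m (κ x) r
  cup_left : ∀ m x r, κ (Coh.cup m (Coh.pull φ r) x) = Coh.cup m (Coh.sgn^[j] r) (κ x)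
  pr : ∀ p x, Coh.pr p (κ x) = κ (Coh.pr (p + j) x)
  pr_of_lt : ∀ i < j, ∀ x, κ (Coh.pr i x) = 0
  sgn : ∀ x, κ (Coh.sgn x) = (-1 : ℤ) ^ j • Coh.sgn (κ x)

variable {T U V C F : Set P}

/-- The start of the tower: a disjoint union of two pieces. -/
theorem IsOpenPair.exists_isWangMap_zero (h : IsOpenPair T U V ∅) (hF : F ⊆ U)
    (hUF : Function.Injective (Coh.res (A := A) hF)) (φ : C(T, Z))
    (hU : Function.Bijective (Coh.pull (A := A) (restr h.left φ)))
    (hV : Function.Bijective (Coh.pull (A := A) (restr h.right φ))) :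
    ∃ κ : Coh A T →+ Coh A Z, IsWangMap 0 (hF.trans h.left) φ κ := by
  let eU := AddEquiv.ofBijective _ hU
  let eV := AddEquiv.ofBijective _ hV
  have eUs : ∀ x r, Coh.pull (restr h.left φ) r = x → eU.symm x = r := fun x r hx => by
    rw [← hx]; exact eU.symm_apply_apply r
  have eVs : ∀ x r, Coh.pull (restr h.right φ) r = x → eV.symm x = r := fun x r hx => by
    rw [← hx]; exact eV.symm_apply_apply r
  have eU' : ∀ x, Coh.pull (restr h.left φ) (eU.symm x) = x := eU.apply_symm_apply
  have eV' : ∀ x, Coh.pull (restr h.right φ) (eV.symm x) = x := eV.apply_symm_apply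
  refine ⟨eV.symm.toAddMonoidHom.comp (Coh.res h.right) -
    eU.symm.toAddMonoidHom.comp (Coh.res h.left), ?_⟩
  have hκ : ∀ x, (eV.symm.toAddMonoidHom.comp (Coh.res h.right) -
    eU.symm.toAddMonoidHom.comp (Coh.res h.left)) x =
      eV.symm (Coh.res h.right x) - eU.symm (Coh.res h.left x) := fun x => rfl
  constructor
  · intro x hx hxF
    have h1 : Coh.res h.left x = 0 := hUF (by rw [Coh.res_res, hxF, map_zero])
    rw [hκ, h1, map_zero, sub_zero, map_eq_zero_iff _ eV.symm.injective] at hx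
    obtain ⟨c, rfl⟩ := h.exists_conn_eq h1 hx
    rw [Coh.subsingleton_of_isEmpty c, map_zero]
  · intro r
    rw [hκ, Coh.res_pull, Coh.res_pull, eUs _ r rfl, eVs _ r rfl, sub_self]
  · intro m x r
    rw [hκ, hκ, Coh.cup_sub_left, Coh.res_cup, Coh.res_cup, Coh.res_pull, Coh.res_pull]
    congr 1
    · exact eVs _ _ (by rw [Coh.pull_cup, eV'])
    · exact eUs _ _ (by rw [Coh.pull_cup, eU'])
  · intro m x r
    rw [hκ, hκ, Coh.cup_sub_right, Coh.res_cup, Coh.res_cup, Coh.res_pull, Coh.res_pull]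
    congr 1
    · exact eVs _ _ (by rw [Coh.pull_cup, eV']; rfl)
    · exact eUs _ _ (by rw [Coh.pull_cup, eU']; rfl)
  · intro p x
    rw [hκ, hκ, map_sub, Coh.res_pr, Coh.res_pr]
    congr 1
    · exact (eVs _ _ (by rw [← Coh.pr_pull, eV']; rfl)).symm
    · exact (eUs _ _ (by rw [← Coh.pr_pull, eU']; rfl)).symm
  · intro i hi
    omega
  · intro x
    rw [hκ, hκ, map_sub, Coh.res_sgn, Coh.res_sgn, pow_zero, one_smul]
    congr 1
    · exact eVs _ _ (by rw [← Coh.sgn_pull, eV'])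
    · exact eUs _ _ (by rw [← Coh.sgn_pull, eU'])

/-- A class that restricts to zero on `F` is in the image of the connecting homomorphism. -/
theorem IsOpenPair.exists_conn_eq_of_res_eq_zero (h : IsOpenPair T U V C) (hF : F ⊆ C)
    (hUF : Function.Injective (Coh.res (A := A) (hF.trans h.inter_left)))
    (hVF : Function.Injective (Coh.res (A := A) (hF.trans h.inter_right))) {x : Coh A T}
    (hx : Coh.res (hF.trans h.inter) x = 0) : ∃ c, h.conn c = x :=
  h.exists_conn_eq (hUF (by rw [Coh.res_res, hx, map_zero]))
    (hVF (by rw [Coh.res_res, hx, map_zero]))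

/-- A class that vanishes on `F` is annihilated by classes that vanish on `F`. -/
theorem IsOpenPair.cup_eq_cup (h : IsOpenPair T U V C) (hF : F ⊆ C)
    (hUF : Function.Injective (Coh.res (A := A) (hF.trans h.inter_left)))
    (hVF : Function.Injective (Coh.res (A := A) (hF.trans h.inter_right)))
    (m : A →+ A →+ A) {x y y' : Coh A T} (hx : Coh.res (hF.trans h.inter) x = 0)
    (hy : Coh.res (hF.trans h.inter) y = Coh.res (hF.trans h.inter) y') :
    Coh.cup m x y = Coh.cup m x y' := by
  obtain ⟨c, rfl⟩ := h.exists_conn_eq_of_res_eq_zero hF hUF hVF hx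
  have hU : Coh.res h.left y = Coh.res h.left y' :=
    hUF (by rw [Coh.res_res, Coh.res_res, hy])
  have hC : Coh.res h.inter y = Coh.res h.inter y' := by
    rw [← Coh.res_res h.inter_left h.left, hU, Coh.res_res]
  rw [← h.conn_cup_res, ← h.conn_cup_res, hC]

/-- The step of the tower: every class on `T` is the sum of a class from `Z` and of the image `∂ c` of
a class on the intersection, and `κ' (∂ c) = κ c`. -/
theorem IsOpenPair.exists_isWangMap_succ (h : IsOpenPair T U V C) (hF : F ⊆ C)
    (hUF : Function.Injective (Coh.res (A := A) (hF.trans h.inter_left)))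
    (hVF : Function.Injective (Coh.res (A := A) (hF.trans h.inter_right))) (φ : C(T, Z))
    (hφ : Function.Bijective (Coh.pull (A := A) (restr (hF.trans h.inter) φ))) {j : ℕ}
    {κ : Coh A C →+ Coh A Z} (hκ : IsWangMap j hF (restr h.inter φ) κ) :
    ∃ κ' : Coh A T →+ Coh A Z, IsWangMap (j + 1) (hF.trans h.inter) φ κ' := by
  have hconnF : ∀ c : Coh A C, Coh.res (hF.trans h.inter) (h.conn c) = 0 := fun c => by
    rw [← Coh.res_res (hF.trans h.inter_left) h.left, h.res_left_conn, map_zero]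
  -- `x` minus the class from `Z` with the same restriction to `F` vanishes on `U` and on `V`
  have hsurj : ∀ x : Coh A T, ∃ (c : Coh A C) (r : Coh A Z), h.conn c + Coh.pull φ r = x := by
    intro x
    obtain ⟨r, hr⟩ := hφ.2 (Coh.res (hF.trans h.inter) x)
    obtain ⟨c, hc⟩ := h.exists_conn_eq_of_res_eq_zero hF hUF hVF (x := x - Coh.pull φ r)
      (by rw [map_sub, Coh.res_pull, hr, sub_self])
    exact ⟨c, r, by rw [hc, sub_add_cancel]⟩
  have hconn0 : ∀ c : Coh A C, h.conn c = 0 → κ c = 0 := by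
    intro c hc
    obtain ⟨a, b, rfl⟩ := h.exists_eq_sub_of_conn_eq_zero hc
    obtain ⟨r, hr⟩ := hφ.2 (Coh.res (hF.trans h.inter_left) a)
    obtain ⟨s, hs⟩ := hφ.2 (Coh.res (hF.trans h.inter_right) b)
    have ha : a = Coh.pull (restr h.left φ) r := hUF (by rw [Coh.res_pull, ← hr]; rfl)
    have hb : b = Coh.pull (restr h.right φ) s := hVF (by rw [Coh.res_pull, ← hs]; rfl)
    rw [ha, hb, Coh.res_pull, Coh.res_pull, map_sub]
    exact (congrArg₂ _ (hκ.pull r) (hκ.pull s)).trans (sub_self 0)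
  have hker : ∀ c r, h.conn c + Coh.pull φ r = 0 → κ c = 0 := by
    intro c r hcr
    have hr : Coh.pull (restr (hF.trans h.inter) φ) r = 0 := by
      have := congrArg (Coh.res (hF.trans h.inter)) hcr
      rwa [map_add, hconnF, zero_add, map_zero, Coh.res_pull] at this
    rw [map_eq_zero_iff _ hφ.1] at hr
    rw [hr, map_zero, add_zero] at hcr
    exact hconn0 c hcr
  have huniq : ∀ c r c' r', h.conn c + Coh.pull φ r = h.conn c' + Coh.pull φ r' → κ c = κ c' := by
    intro c r c' r' e
    rw [← sub_eq_zero, ← map_sub]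
    refine hker _ (r - r') ?_
    rw [map_sub, map_sub, sub_add_sub_comm, e, sub_self]
  choose γ ρ hγ using hsurj
  let κ' : Coh A T →+ Coh A Z := AddMonoidHom.mk' (fun x => κ (γ x)) fun x y => by
    rw [← map_add]
    refine huniq _ (ρ (x + y)) _ (ρ x + ρ y) ?_
    rw [hγ, map_add, map_add, add_add_add_comm, hγ, hγ]
  have hκ' : ∀ c r, κ' (h.conn c + Coh.pull φ r) = κ c := fun c r => huniq _ _ _ _ (hγ _)
  have hκc : ∀ c, κ' (h.conn c) = κ c := fun c => by
    have := hκ' c 0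
    rwa [map_zero, add_zero] at this
  have hκr : ∀ r, κ' (Coh.pull φ r) = 0 := fun r => by
    have := hκ' 0 r
    rwa [map_zero, zero_add, map_zero] at this
  refine ⟨κ', ?_, hκr, ?_, ?_, ?_, ?_, ?_⟩
  · intro x hx hxF
    obtain ⟨c, r, rfl⟩ : ∃ c r, h.conn c + Coh.pull φ r = x := ⟨_, _, hγ x⟩
    rw [map_add, hconnF, zero_add, Coh.res_pull, map_eq_zero_iff _ hφ.1] at hxF
    subst hxF
    rw [hκ'] at hx
    obtain ⟨s, hs⟩ := hφ.2 (Coh.res hF c)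
    have hc : c - Coh.pull (restr h.inter φ) s = 0 := hκ.eq_zero _
      (by rw [map_sub, hx, hκ.pull, sub_zero])
      (by rw [map_sub, Coh.res_pull, ← hs]; exact sub_self _)
    rw [map_zero, add_zero, sub_eq_zero.mp hc]
    exact (congrArg h.conn (Coh.res_pull h.inter_left (restr h.left φ) s).symm).trans
      (h.conn_res_left _)
  · intro m x r
    obtain ⟨c, s, rfl⟩ : ∃ c r, h.conn c + Coh.pull φ r = x := ⟨_, _, hγ x⟩
    rw [hκ', Coh.cup_add_left, ← h.conn_cup_res, Coh.res_pull, ← Coh.pull_cup, hκ', hκ.cup_right]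
  · intro m x r
    obtain ⟨c, s, rfl⟩ : ∃ c r, h.conn c + Coh.pull φ r = x := ⟨_, _, hγ x⟩
    rw [hκ', Coh.cup_add_right, ← Coh.pull_cup]
    have := h.conn_res_cup m c (Coh.pull φ (Coh.sgn r))
    rw [← Coh.sgn_pull, Coh.sgn_sgn, Coh.sgn_pull, Coh.res_pull] at this
    rw [← this, hκ', hκ.cup_left, Function.iterate_succ_apply]
  · intro p x
    obtain ⟨c, s, rfl⟩ : ∃ c r, h.conn c + Coh.pull φ r = x := ⟨_, _, hγ x⟩
    rw [hκ', map_add, ← add_assoc, h.pr_succ_conn, Coh.pr_pull, hκ', hκ.pr]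
  · intro i hi x
    obtain ⟨c, s, rfl⟩ : ∃ c r, h.conn c + Coh.pull φ r = x := ⟨_, _, hγ x⟩
    rw [map_add, Coh.pr_pull]
    cases i with
    | zero => rw [h.pr_zero_conn, zero_add, hκr]
    | succ i => rw [h.pr_succ_conn, hκ', hκ.pr_of_lt i (by omega)]
  · intro x
    obtain ⟨c, s, rfl⟩ : ∃ c r, h.conn c + Coh.pull φ r = x := ⟨_, _, hγ x⟩
    rw [map_add, h.sgn_conn, Coh.sgn_pull, ← map_neg, hκ', hκ', map_neg, hκ.sgn, pow_succ]
    simp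

/-- A decomposition of spaces `W 0 ⊆ W 1 ⊆ ⋯ ⊆ W N` like the equators of a sphere: `W j` is covered
by open sets `U j` and `V j`, enlarged hemispheres, that meet in `W (j - 1)`, and each of these sets
has the cohomology of the fixed subset `F`. Only for `V 0`, which is disjoint from `F`, is nothing
assumed. -/
structure IsEquatorial (A : Type*) [AddCommGroup A] (N : ℕ) (W U V : ℕ → Set P) (F : Set P) :
    Prop where
  zero : IsOpenPair (W 0) (U 0) (V 0) ∅
  succ : ∀ j < N, IsOpenPair (W (j + 1)) (U (j + 1)) (V (j + 1)) (W j)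
  subset : F ⊆ U 0
  bijective_left_zero : Function.Bijective (Coh.res (A := A) subset)
  bijective_left : ∀ j < N, ∀ h : F ⊆ U (j + 1), Function.Bijective (Coh.res (A := A) h)
  bijective_right : ∀ j < N, ∀ h : F ⊆ V (j + 1), Function.Bijective (Coh.res (A := A) h)

namespace IsEquatorial

variable {N : ℕ} {W U V : ℕ → Set P}

theorem subset_W (h : IsEquatorial A N W U V F) {j : ℕ} (hj : j ≤ N) : F ⊆ W j := by
  induction j with
  | zero => exact h.subset.trans h.zero.left
  | succ j ih => exact (ih (by omega)).trans (h.succ j (by omega)).inter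

theorem W_zero_subset (h : IsEquatorial A N W U V F) {j : ℕ} (hj : j ≤ N) : W 0 ⊆ W j := by
  induction j with
  | zero => exact subset_rfl
  | succ j ih => exact (ih (by omega)).trans (h.succ j (by omega)).inter

/-- The tower of connecting homomorphisms starts with the two pieces of `W 0`; the map `φ` has to be a
cohomology isomorphism on both, through `F` on the first. -/
theorem exists_isWangMap (h : IsEquatorial A N W U V F) {j : ℕ} (hj : j ≤ N) (φ : C(W j, Z))
    (hφ : Function.Bijective (Coh.pull (A := A) (restr (h.subset_W hj) φ)))
    (hφ' : Function.Bijective (Coh.pull (A := A)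
      (restr (h.zero.right.trans (h.W_zero_subset hj)) φ))) :
    ∃ κ : Coh A (W j) →+ Coh A Z, IsWangMap j (h.subset_W hj) φ κ := by
  induction j with
  | zero =>
    refine h.zero.exists_isWangMap_zero h.subset h.bijective_left_zero.1 φ ?_ hφ'
    have h1 : ⇑(Coh.pull (A := A) (restr (h.subset_W hj) φ)) =
        ⇑(Coh.res (A := A) h.subset) ∘ ⇑(Coh.pull (A := A) (restr h.zero.left φ)) := by
      ext r
      exact (Coh.res_pull h.subset (restr h.zero.left φ) r).symm
    rw [h1] at hφ
    exact (Function.Bijective.of_comp_iff' h.bijective_left_zero _).mp hφ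
  | succ j ih =>
    have hs := h.succ j (by omega)
    obtain ⟨κ, hκ⟩ := ih (by omega) (restr hs.inter φ) hφ hφ'
    exact hs.exists_isWangMap_succ (h.subset_W (by omega)) (h.bijective_left j (by omega) _).1
      (h.bijective_right j (by omega) _).1 φ hφ hκ

end IsEquatorial

end


section

/-! ### Derivations -/

variable {A : Type*} [AddCommGroup A]

theorem iterate_leibniz {H : Type*} [AddCommGroup H] (μ : H →+ H →+ H) (D : H →+ H)
    (hD : ∀ x y, D (μ x y) = μ (D x) y + μ x (D y)) (N : ℕ) (x y : H) :
    D^[N] (μ x y) = ∑ ij ∈ Finset.HasAntidiagonal.antidiagonal N,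
      N.choose ij.1 • μ (D^[ij.1] x) (D^[ij.2] y) := by
  induction N with
  | zero => simp
  | succ N ih =>
    rw [Function.iterate_succ_apply', ih, map_sum,
      Finset.sum_antidiagonal_choose_succ_nsmul fun i j => μ (D^[i] x) (D^[j] y),
      ← Finset.sum_add_distrib]
    refine Finset.sum_congr rfl fun ij h => ?_
    rw [Finset.HasAntidiagonal.mem_antidiagonal] at h
    rw [map_nsmul, hD, nsmul_add, add_comm, Function.iterate_succ_apply',
      Function.iterate_succ_apply', Nat.choose_symm_of_eq_add h.symm]

/-- If `D ^ (s + 1)` kills `w`, then only the middle term of the Leibniz formula for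
`D ^ (2 * s)` of the square of `w` survives. -/
theorem iterate_leibniz_self {H : Type*} [AddCommGroup H] (μ : H →+ H →+ H) (D : H →+ H)
    (hD : ∀ x y, D (μ x y) = μ (D x) y + μ x (D y)) (s : ℕ) (w : H) (hw : D^[s + 1] w = 0) :
    D^[2 * s] (μ w w) = (2 * s).choose s • μ (D^[s] w) (D^[s] w) := by
  have hbig : ∀ i, s < i → D^[i] w = 0 := by
    intro i hi
    obtain ⟨k, rfl⟩ := Nat.exists_eq_add_of_lt hi
    rw [show s + k + 1 = k + (s + 1) by ring, Function.iterate_add_apply, hw, iterate_map_zero]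
  rw [iterate_leibniz μ D hD, Finset.sum_eq_single (s, s)]
  · rintro ⟨i, j⟩ h hne
    rw [Finset.HasAntidiagonal.mem_antidiagonal] at h
    rcases lt_trichotomy i s with hi | hi | hi
    · simp [hbig j (by simp at h; omega)]
    · refine absurd ?_ hne
      simp at h
      exact Prod.ext hi (by simp; omega)
    · simp [hbig i hi]
  · intro h
    refine absurd ?_ h
    rw [Finset.HasAntidiagonal.mem_antidiagonal]
    ring

/-! ### Cohomology outside the top degree -/

variable {P Z X : Type*} [TopologicalSpace P] [TopologicalSpace Z] [TopologicalSpace X]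

/-- Outside the degree `N`, the cohomology of `T` comes from a point. -/
theorem IsWangMap.exists_eq_pull {N : ℕ} {T F : Set P} {hF : F ⊆ T} {φ : C(T, Z)}
    {κ : Coh A T →+ Coh A Z} (hκ : IsWangMap N hF φ κ) [Subsingleton Z]
    (hφ : Function.Surjective (Coh.pull (A := A) (restr hF φ))) {i : ℕ} (hi : i ≠ N)
    {x : Coh A T} (hx : Coh.pr i x = x) : ∃ r, x = Coh.pull φ r := by
  have hκx : κ x = 0 := by
    rcases lt_or_gt_of_ne hi with h | h
    · rw [← hx]
      exact hκ.pr_of_lt i h x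
    · obtain ⟨p, rfl⟩ : ∃ p, i = p + N := ⟨i - N, by omega⟩
      rw [← hx, ← hκ.pr]
      exact Coh.pr_eq_zero_of_subsingleton (by omega) _
  obtain ⟨r, hr⟩ := hφ (Coh.res hF x)
  refine ⟨r, sub_eq_zero.mp (hκ.eq_zero _ ?_ ?_)⟩
  · rw [map_sub, hκx, hκ.pull, sub_zero]
  · rw [map_sub, Coh.res_pull, hr, sub_self]

theorem Coh.pull_eq_zero_of_subsingleton [Subsingleton Z] {φ : C(X, Z)} {r : Coh A Z} {p : ℕ}
    (hp : p ≠ 0) (h : Coh.pr p (Coh.pull φ r) = Coh.pull φ r) : Coh.pull φ r = 0 := by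
  rw [← h, Coh.pr_pull, Coh.pr_eq_zero_of_subsingleton hp, map_zero]

/-! ### The Wang derivation -/

/-- The properties of the Wang derivation on the cohomology of the fibre of a contractible space over
a sphere of dimension `n + 1`: an antiderivation of degree `-n` (a derivation for even `n`) that is
injective in positive degrees. -/
structure IsWangDerivation (n : ℕ) (θ : Coh A X →+ Coh A X) : Prop where
  leibniz : ∀ m x y, θ (Coh.cup m x y) = Coh.cup m (θ x) y + Coh.cup m (Coh.sgn^[n] x) (θ y)
  pr : ∀ p x, Coh.pr p (θ x) = θ (Coh.pr (p + n) x)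
  pr_of_lt : ∀ i < n, ∀ x, θ (Coh.pr i x) = 0
  sgn : ∀ x, θ (Coh.sgn x) = (-1 : ℤ) ^ n • Coh.sgn (θ x)
  eq_zero : ∀ p ≠ 0, ∀ x, Coh.pr p x = x → θ x = 0 → x = 0

/-- The Wang derivation, on the hemisphere `U (n + 2)` instead of the fibre `F`, with the same
cohomology: carry a class over to the other hemisphere `V (n + 2)` through the fibre, restrict it to
the equator, and apply the inverse connecting homomorphisms. The restriction of the class
itself is killed by `κ`, so that in effect `κ` is applied to the difference of two extensions. -/
theorem IsEquatorial.exists_isWangDerivation {n : ℕ} {W U V : ℕ → Set P} {F : Set P}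
    (h : IsEquatorial A (n + 2) W U V F) (hV : V 0 ⊆ U (n + 2))
    (hV0 : Function.Bijective (Coh.res (A := A) hV))
    (htop : ∀ p ≠ 0, ∀ x : Coh A (W (n + 2)), Coh.pr p x = 0) :
    ∃ θ : Coh A (U (n + 2)) →+ Coh A (U (n + 2)), IsWangDerivation (n + 1) θ := by
  have hs := h.succ (n + 1) (by omega)
  have hs' := h.succ n (by omega)
  have hFn : F ⊆ W n := h.subset_W (by omega)
  have hF : F ⊆ W (n + 1) := hFn.trans hs'.inter
  have hUF := h.bijective_left (n + 1) (by omega) (hF.trans hs.inter_left)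
  have hVF := h.bijective_right (n + 1) (by omega) (hF.trans hs.inter_right)
  obtain ⟨κ, hκ⟩ := h.exists_isWangMap (j := n + 1) (by omega) (incl hs.inter_left) hUF hV0
  -- `ι` carries a class over from one hemisphere to the other through the fibre
  let ι : Coh A (U (n + 2)) →+ Coh A (V (n + 2)) :=
    (AddEquiv.ofBijective _ hVF).symm.toAddMonoidHom.comp (Coh.res (hF.trans hs.inter_left))
  have hι : ∀ x, Coh.res (hF.trans hs.inter_right) (ι x) = Coh.res (hF.trans hs.inter_left) x :=
    fun x => (AddEquiv.ofBijective _ hVF).apply_symm_apply _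
  have hι' : ∀ x y, Coh.res (hF.trans hs.inter_right) y = Coh.res (hF.trans hs.inter_left) x →
      ι x = y := fun x y e => hVF.1 (by rw [hι, e])
  have hιW : ∀ x, Coh.res hF (Coh.res hs.inter_right (ι x)) =
      Coh.res hF (Coh.res hs.inter_left x) := fun x => by
    rw [Coh.res_res, Coh.res_res, hι]
  have hθ : ∀ x, (κ.comp ((Coh.res hs.inter_right).comp ι)) x =
      κ (Coh.res hs.inter_right (ι x)) := fun x => rfl
  have hκU : ∀ x, κ (Coh.res hs.inter_left x) = 0 := hκ.pull
  refine ⟨κ.comp ((Coh.res hs.inter_right).comp ι), ?_, ?_, ?_, ?_, ?_⟩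
  · intro m x y
    have e1 : ι (Coh.cup m x y) = Coh.cup m (ι x) (ι y) :=
      hι' _ _ (by rw [Coh.res_cup, Coh.res_cup, hι, hι])
    -- the difference vanishes on the fibre, so products with it see only restrictions to the fibre
    have e2 : Coh.cup m (Coh.res hs.inter_right (ι x) - Coh.res hs.inter_left x)
        (Coh.res hs.inter_right (ι y)) =
        Coh.cup m (Coh.res hs.inter_right (ι x) - Coh.res hs.inter_left x)
          (Coh.res hs.inter_left y) :=
      hs'.cup_eq_cup hFn (h.bijective_left n (by omega) _).1 (h.bijective_right n (by omega) _).1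
        m (by rw [map_sub, hιW, sub_self]) (hιW y)
    rw [Coh.cup_sub_left, sub_eq_iff_eq_add] at e2
    have e3 := hκ.cup_right m (Coh.res hs.inter_right (ι x) - Coh.res hs.inter_left x) y
    rw [map_sub, hκU, sub_zero] at e3
    rw [hθ, hθ, hθ, e1, Coh.res_cup, e2, map_add]
    exact congrArg₂ _ e3 (hκ.cup_left m _ x)
  · intro p x
    rw [hθ, hθ, hκ.pr, ← Coh.res_pr, hι' (Coh.pr (p + (n + 1)) x) (Coh.pr (p + (n + 1)) (ι x))
      (by rw [Coh.res_pr, Coh.res_pr, hι])]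
  · intro i hi x
    rw [hθ, hι' _ (Coh.pr i (ι x)) (by rw [Coh.res_pr, Coh.res_pr, hι]), Coh.res_pr,
      hκ.pr_of_lt i hi]
  · intro x
    rw [hθ, hθ, hι' _ (Coh.sgn (ι x)) (by rw [Coh.res_sgn, Coh.res_sgn, hι]), Coh.res_sgn,
      hκ.sgn]
  · intro p hp x hx hx0
    have e : Coh.res hs.inter_right (ι x) - Coh.res hs.inter_left x = 0 :=
      hκ.eq_zero _ (by rw [map_sub, hκU, sub_zero]; exact hx0) (by rw [map_sub, hιW, sub_self])
    -- both extensions agree on the equator, hence come from the contractible total space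
    obtain ⟨z, hz, -⟩ := hs.exists_res_eq (sub_eq_zero.mp e).symm
    rw [← hx, ← hz, ← Coh.res_pr, htop p hp, map_zero]

/-- A class `w` of degree `t * n` with `w * w = 0` vanishes in the presence of a Wang derivation:
apply the iterated Leibniz rule to `w * w`, up to degree zero. -/
theorem IsWangDerivation.eq_zero_of_cup_self {n t : ℕ} {θ : Coh A X →+ Coh A X}
    (hθ : IsWangDerivation n θ) (hn : 0 < n) (hpar : Even n ∨ Even t) (m : A →+ A →+ A)
    (hm : ∀ a, m a a = 0 → a = 0) (hc : ∀ (c : ℤ) (a : A), c ≠ 0 → c • a = 0 → a = 0)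
    {w : Coh A X} (hw : Coh.pr (t * n) w = w) (hww : Coh.cup m w w = 0) : w = 0 := by
  have hpr : ∀ (k p : ℕ) (x : Coh A X), Coh.pr p (θ^[k] x) = θ^[k] (Coh.pr (p + k * n) x) := by
    intro k
    induction k with
    | zero => intro p x; simp
    | succ k ih =>
      intro p x
      rw [Function.iterate_succ_apply', hθ.pr, ih, Function.iterate_succ_apply']
      congr 3
      ring_nf
  have hdeg : Coh.pr 0 (θ^[t] w) = θ^[t] w := by rw [hpr, zero_add, hw]
  have hnext : θ^[t + 1] w = 0 := by
    rw [Function.iterate_succ_apply', ← hdeg, hθ.pr_of_lt 0 hn]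
  have hdesc : ∀ k ≤ t, θ^[k] w = 0 → w = 0 := by
    intro k
    induction k with
    | zero => exact fun _ h => h
    | succ k ih =>
      intro hk h
      refine ih (by omega) (hθ.eq_zero ((t - k) * n)
        (Nat.mul_ne_zero (by omega) hn.ne') _ ?_ ?_)
      · rw [hpr, ← add_mul, Nat.sub_add_cancel (by omega), hw]
      · rwa [← Function.iterate_succ_apply' θ]
  refine hdesc t le_rfl ?_
  have hfinal : ∀ (s : ℕ) (D : Coh A X →+ Coh A X),
      (∀ x y, D (Coh.cup m x y) = Coh.cup m (D x) y + Coh.cup m x (D y)) →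
      D^[s] w = θ^[t] w → D^[s + 1] w = 0 → θ^[t] w = 0 := by
    intro s D hD hs hs'
    have := iterate_leibniz_self (Coh.cupHom m) D hD s w hs'
    rw [show Coh.cupHom m w w = 0 from hww, iterate_map_zero, hs, ← natCast_zsmul] at this
    refine Coh.eq_zero_of_cup_self_of_degree_zero m hm (c := ((2 * s).choose s : ℤ))
      (fun a ha => hc _ a ?_ ha) _ hdeg this.symm
    exact_mod_cast (Nat.choose_pos (by omega)).ne'
  have hss : ∀ x : Coh A X, Coh.sgn (Coh.sgn x) = x := Coh.sgn_sgn
  rcases Nat.even_or_odd n with he | ho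
  · refine hfinal t θ (fun x y => ?_) rfl hnext
    rw [hθ.leibniz]
    obtain ⟨k, rfl⟩ := he
    rw [← two_mul, Function.iterate_mul, show (⇑(Coh.sgn : Coh A X →+ _))^[2] = id from
      funext hss, Function.iterate_id, id]
  · -- for odd `n` the square of the antiderivation `θ` is a derivation
    obtain ⟨s, rfl⟩ : Even t := hpar.resolve_left (Nat.not_even_iff_odd.mpr ho)
    have hit : ∀ k, (⇑(θ.comp θ))^[k] w = θ^[k + k] w := by
      intro k
      rw [← two_mul, Function.iterate_mul]
      rfl
    have hsg : ∀ x : Coh A X, Coh.sgn^[n] x = Coh.sgn x := by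
      intro x
      obtain ⟨k, rfl⟩ := ho
      refine (Function.iterate_succ_apply (⇑(Coh.sgn : Coh A X →+ _)) (2 * k) x).trans ?_
      rw [Function.iterate_mul,
        show (⇑(Coh.sgn : Coh A X →+ _))^[2] = id from funext hss, Function.iterate_id, id]
    refine hfinal s (θ.comp θ) (fun x y => ?_) (hit s) ?_
    · simp only [AddMonoidHom.comp_apply]
      rw [hθ.leibniz, map_add, hθ.leibniz, hθ.leibniz, hsg, hsg, hsg, hss, hθ.sgn,
        ho.neg_one_pow, neg_one_smul]
      have : Coh.cup m (-Coh.sgn (θ x)) (θ y) = -Coh.cup m (Coh.sgn (θ x)) (θ y) := by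
        rw [← zero_sub, Coh.cup_sub_left, Coh.cup_zero_left, zero_sub]
      rw [this]
      abel
    · rw [hit, show s + 1 + (s + 1) = (s + s + 1) + 1 by ring, Function.iterate_succ_apply',
        hnext, map_zero]

end


section

open scoped unitInterval

/-! ### Deformation retractions and spaces of paths -/

variable {A : Type*} [AddCommGroup A] {P B : Type*} [TopologicalSpace P] [TopologicalSpace B]

/-- A deformation of `S` into a subset `F`, through maps that preserve `F`, is a cohomology
isomorphism. -/
theorem Coh.bijective_res_of_deformation {F S : Set P} (h : F ⊆ S) (K : S → I → P)
    (hK : Continuous fun x : S × I => K x.1 x.2) (hS : ∀ x s, K x s ∈ S) (h0 : ∀ x, K x 0 = x)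
    (h1 : ∀ x, K x 1 ∈ F) (hF : ∀ (x : S) s, (x : P) ∈ F → K x s ∈ F) :
    Function.Bijective (Coh.res (A := A) h) := by
  let r : C(S, F) := ⟨fun x => ⟨K x 1, h1 x⟩, by fun_prop⟩
  have e1 : (ContinuousMap.id S).Homotopic ((incl h).comp r) :=
    ⟨{ toFun := fun x => ⟨K x.2 x.1, hS _ _⟩
       continuous_toFun := by fun_prop
       map_zero_left := fun x => Subtype.ext (h0 x)
       map_one_left := fun x => rfl }⟩
  have e2 : (ContinuousMap.id F).Homotopic (r.comp (incl h)) :=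
    ⟨{ toFun := fun x => ⟨K (incl h x.2) x.1, hF _ _ x.2.2⟩
       continuous_toFun := by
        have : Continuous fun x : I × F => ((incl h x.2, x.1) : S × I) := by fun_prop
        exact (hK.comp this).subtype_mk _
       map_zero_left := fun x => Subtype.ext (h0 _)
       map_one_left := fun x => rfl }⟩
  refine Function.bijective_iff_has_inverse.mpr ⟨Coh.pull r, fun x => ?_, fun x => ?_⟩
  · exact (Coh.pull_pull r (incl h) x).trans
      ((Coh.pull_eq_of_homotopic e1 x).symm.trans (Coh.pull_id x))
  · exact (Coh.pull_pull (incl h) r x).trans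
      ((Coh.pull_eq_of_homotopic e2 x).symm.trans (Coh.pull_id x))

/-- A strong deformation retraction of `S` onto its point `q`. -/
structure Contraction (S : Set B) (q : B) where
  toFun : S → I → B
  continuous_toFun : Continuous fun x : S × I => toFun x.1 x.2
  mem : ∀ x s, toFun x s ∈ S
  zero : ∀ x, toFun x 0 = x
  one : ∀ x, toFun x 1 = q
  base : ∀ (x : S) s, (x : B) = q → toFun x s = q

/-- The map `p` lifts contractions up to homotopy, as far as cohomology can see: over a subset of
the base that contracts to `q`, the total space has the cohomology of the fibre at `q`. -/
def LiftsContractions (A : Type*) [AddCommGroup A] (p : P → B) : Prop :=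
  ∀ (S : Set B) (q : B) (_ : Contraction S q) (h : p ⁻¹' {q} ⊆ p ⁻¹' S),
    Function.Bijective (Coh.res (A := A) h)

theorem liftsContractions_id : LiftsContractions A (id : B → B) := fun S q c h =>
  Coh.bijective_res_of_deformation h c.toFun c.continuous_toFun c.mem c.zero c.one c.base

/-- The space of paths that start at `b`. -/
abbrev PathsFrom (b : B) : Type _ := {γ : C(I, B) // γ 0 = b}

namespace PathsFrom

variable (b : B)

/-- The end of a path. -/
def endpoint (γ : PathsFrom b) : B := γ.1 1

theorem continuous_endpoint : Continuous (endpoint b) := by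
  unfold endpoint
  fun_prop

/-- A contraction of a subset of the base lifts to paths: follow the path, and then the track of its
end under the contraction. -/
theorem liftsContractions_endpoint : LiftsContractions A (endpoint b) := by
  intro S q c h
  let pr : ℝ → I := Set.projIcc 0 1 zero_le_one
  have hpr : Continuous pr := continuous_projIcc
  have hc := c.continuous_toFun
  -- traverse the path followed by the first part of the track, up to time `s`, at speed `1 + s`
  let L : (endpoint b ⁻¹' S) × I → I → B := fun x τ =>
    if (τ : ℝ) * (1 + x.2) ≤ 1 then x.1.1.1 (pr (τ * (1 + x.2)))
    else c.toFun ⟨endpoint b x.1.1, x.1.2⟩ (pr (τ * (1 + x.2) - 1))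
  have hL : Continuous fun x : ((endpoint b ⁻¹' S) × I) × I => L x.1 x.2 := by
    refine Continuous.if_le ?_ ?_ (by fun_prop) continuous_const ?_
    · fun_prop
    · have h1 : Continuous fun x : ((endpoint b ⁻¹' S) × I) × I =>
          ((⟨endpoint b x.1.1.1, x.1.1.2⟩, pr (x.2 * (1 + x.1.2) - 1)) : S × I) := by
        have := continuous_endpoint b
        fun_prop
      exact hc.comp h1
    · rintro ⟨x, τ⟩ hx
      dsimp only at hx ⊢
      rw [hx, sub_self]
      have e1 : pr 1 = 1 := Set.projIcc_right _
      have e0 : pr 0 = 0 := Set.projIcc_left _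
      rw [e1, e0, c.zero]
      rfl
  have hend : ∀ x : (endpoint b ⁻¹' S) × I,
      L x 1 = c.toFun ⟨endpoint b x.1.1, x.1.2⟩ x.2 := by
    intro x
    have hx := x.2.2.1
    simp only [L]
    split_ifs with h1
    · have h2 : x.2 = 0 := Subtype.ext (le_antisymm (by simpa using h1) hx)
      have e1 : pr 1 = 1 := Set.projIcc_right _
      rw [h2, c.zero]
      simp only [Set.Icc.coe_one, Set.Icc.coe_zero, add_zero, mul_one, e1]
      rfl
    · congr 1
      have e1 : pr x.2 = x.2 := Set.projIcc_val _ _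
      simp [e1]
  let M : C((endpoint b ⁻¹' S) × I, C(I, B)) := ContinuousMap.curry ⟨fun x => L x.1 x.2, hL⟩
  have hM : ∀ x, M x 0 = b := by
    intro x
    change L x 0 = b
    have e0 : pr 0 = 0 := Set.projIcc_left _
    simp [L, e0, x.1.1.2]
  refine Coh.bijective_res_of_deformation h (fun γ s => ⟨M (γ, s), hM _⟩)
    (M.continuous.subtype_mk _) ?_ ?_ ?_ ?_
  · intro γ s
    change L (γ, s) 1 ∈ S
    rw [hend]
    exact c.mem _ _
  · intro γ
    refine Subtype.ext (ContinuousMap.ext fun τ => ?_)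
    change L (γ, 0) τ = _
    have e1 : pr τ = τ := Set.projIcc_val _ _
    simp [L, τ.2.2, e1]
  · intro γ
    change L (γ, 1) 1 = q
    rw [hend]
    exact c.one _
  · intro γ s hγ
    change L (γ, s) 1 = q
    rw [hend]
    exact c.base _ _ hγ

/-- The space of paths that start at a point is contractible. -/
theorem pr_eq_zero {p : ℕ} (hp : p ≠ 0) (x : Coh A (PathsFrom b)) : Coh.pr p x = 0 := by
  let K : C(PathsFrom b × I, C(I, B)) :=
    ContinuousMap.curry ⟨fun x => x.1.1.1 (x.1.2 * x.2), by fun_prop⟩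
  have hK : ∀ x, K x 0 = b := fun x => by
    change x.1.1 (x.2 * 0) = b
    rw [mul_zero, x.1.2]
  let q : C(PUnit.{1}, PathsFrom b) := ⟨fun _ => ⟨ContinuousMap.const I b, rfl⟩, by fun_prop⟩
  let c : C(PathsFrom b, PUnit.{1}) := ⟨fun _ => PUnit.unit, by fun_prop⟩
  have e : (q.comp c).Homotopic (ContinuousMap.id (PathsFrom b)) :=
    ⟨{ toFun := fun x => ⟨K (x.2, x.1), hK _⟩
       continuous_toFun := by fun_prop
       map_zero_left := fun x => Subtype.ext (ContinuousMap.ext fun τ => by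
        change x.1 (0 * τ) = b
        rw [zero_mul, x.2])
       map_one_left := fun x => Subtype.ext (ContinuousMap.ext fun τ => by
        change x.1 (1 * τ) = x.1 τ
        rw [one_mul]) }⟩
  have e1 : Coh.pr p x = Coh.pull c (Coh.pull q (Coh.pr p x)) :=
    (Coh.pull_id _).symm.trans ((Coh.pull_eq_of_homotopic e _).symm.trans
      (Coh.pull_pull c q (Coh.pr p x)).symm)
  rw [e1, ← Coh.pr_pull, Coh.pr_eq_zero_of_subsingleton hp, map_zero]

end PathsFrom

end

section

open scoped unitInterval InnerProductSpace

/-! ### Hemispheres -/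

variable {E : Type*} [NormedAddCommGroup E] [InnerProductSpace ℝ E]

/-- A cone without vertex, star-shaped about `q`. -/
structure IsStarCone (C : Set E) (q : E) : Prop where
  zero_notMem : (0 : E) ∉ C
  smul_mem : ∀ r : ℝ, 0 < r → ∀ x ∈ C, r • x ∈ C
  segment_mem : ∀ s : ℝ, 0 ≤ s → s ≤ 1 → ∀ x ∈ C, (1 - s) • x + s • q ∈ C

/-- The part of the unit sphere in a cone that is star-shaped about `q` contracts to `q`
radially. -/
def IsStarCone.contraction {C : Set E} {q : Metric.sphere (0 : E) 1} (h : IsStarCone C q) :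
    Contraction (Subtype.val ⁻¹' C : Set (Metric.sphere (0 : E) 1)) q := by
  have hne : ∀ (x : (Subtype.val ⁻¹' C : Set (Metric.sphere (0 : E) 1))) (s : I),
      (1 - (s : ℝ)) • (x : E) + (s : ℝ) • (q : E) ≠ 0 := fun x s h0 =>
    h.zero_notMem (h0 ▸ h.segment_mem s s.2.1 s.2.2 _ x.2)
  have hone : ∀ y : Metric.sphere (0 : E) 1, ‖(y : E)‖⁻¹ • (y : E) = y := fun y => by simp
  exact
  { toFun := fun x s => ⟨‖(1 - (s : ℝ)) • (x : E) + (s : ℝ) • (q : E)‖⁻¹ •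
      ((1 - (s : ℝ)) • (x : E) + (s : ℝ) • (q : E)), by
        rw [mem_sphere_zero_iff_norm, norm_smul, norm_inv, norm_norm,
          inv_mul_cancel₀ (norm_ne_zero_iff.mpr (hne x s))]⟩
    continuous_toFun := by
      refine Continuous.subtype_mk (Continuous.smul (Continuous.inv₀ (by fun_prop) ?_)
        (by fun_prop)) _
      exact fun x => norm_ne_zero_iff.mpr (hne x.1 x.2)
    mem := fun x s => h.smul_mem _ (inv_pos.mpr (norm_pos_iff.mpr (hne x s))) _
      (h.segment_mem s s.2.1 s.2.2 _ x.2)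
    zero := fun x => Subtype.ext (by simp)
    one := fun x => Subtype.ext (by simp)
    base := fun x s hx => Subtype.ext (by
      have e : (1 - (s : ℝ)) • (q : E) + (s : ℝ) • (q : E) = q := by
        rw [← add_smul, sub_add_cancel, one_smul]
      simp only [hx, e, hone]) }

/-- The vectors `e 0, …, e N` form an orthonormal basis; the other members of the sequence do not
matter. -/
structure IsFrame (N : ℕ) (e : ℕ → E) : Prop where
  inner_self : ∀ i ≤ N, ⟪e i, e i⟫_ℝ = 1
  inner_of_ne : ∀ i ≤ N, ∀ j ≤ N, i ≠ j → ⟪e i, e j⟫_ℝ = 0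
  eq_zero : ∀ x : E, (∀ i ≤ N, ⟪e i, x⟫_ℝ = 0) → x = 0

theorem isFrame_of_orthonormalBasis {N : ℕ} (v : OrthonormalBasis (Fin (N + 1)) ℝ E) :
    IsFrame N fun i => v (Fin.ofNat (N + 1) i) where
  inner_self i _ := by simp
  inner_of_ne i hi j hj hij := by
    refine v.orthonormal.2 fun h => hij ?_
    simpa [Fin.ext_iff, Nat.mod_eq_of_lt (Nat.lt_succ_of_le hi),
      Nat.mod_eq_of_lt (Nat.lt_succ_of_le hj)] using h
  eq_zero x hx := by
    refine InnerProductSpace.ext_inner_left_basis v.toBasis fun i => ?_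
    have := hx i (Nat.le_of_lt_succ i.2)
    simpa using this

/-- The cone of the vectors whose projection to the span of `e 0, …, e j` is neither zero nor a
negative multiple of `ε • e j`, for a sign `ε`. In the sphere of dimension `j > 0` this is an enlarged
hemisphere: only the pole opposite to `ε • e j` is left out. -/
def hemi (e : ℕ → E) (ε : ℝ) (j : ℕ) : Set E :=
  {x | (∃ i < j, ⟪e i, x⟫_ℝ ≠ 0) ∨ 0 < ε * ⟪e j, x⟫_ℝ}

/-- The cone of the vectors whose projection to the span of `e 0, …, e j` is not zero. The part of the
unit sphere in it deformation retracts to the sphere of dimension `j`. -/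
def equator (e : ℕ → E) (j : ℕ) : Set E := {x | ∃ i ≤ j, ⟪e i, x⟫_ℝ ≠ 0}

/-- The cone over an arc with ends `u` and `v`. -/
def arc (u v : E) : Set E := {x | ∃ a c : ℝ, 0 ≤ a ∧ 0 ≤ c ∧ 0 < a + c ∧ x = a • u + c • v}

theorem arc_comm (u v : E) : arc u v = arc v u := by
  ext x
  constructor <;> rintro ⟨a, c, ha, hc, hac, rfl⟩ <;>
    exact ⟨c, a, hc, ha, by rwa [add_comm], add_comm _ _⟩

theorem left_mem_arc (u v : E) : u ∈ arc u v := ⟨1, 0, by simp⟩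

theorem isStarCone_arc {u v : E} (hu : ⟪u, u⟫_ℝ = 1) (hv : ⟪v, v⟫_ℝ = 1) (huv : ⟪u, v⟫_ℝ = 0) :
    IsStarCone (arc u v) u where
  zero_notMem := by
    rintro ⟨a, c, ha, hc, hac, h⟩
    have h1 := congrArg (fun x => ⟪u, x⟫_ℝ) h
    have h2 := congrArg (fun x => ⟪v, x⟫_ℝ) h
    simp only [inner_add_right, inner_smul_right, hu, hv, huv, real_inner_comm u v,
      inner_zero_right] at h1 h2
    linarith
  smul_mem := by
    rintro r hr _ ⟨a, c, ha, hc, hac, rfl⟩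
    refine ⟨r * a, r * c, by positivity, by positivity, ?_, by rw [smul_add, mul_smul, mul_smul]⟩
    rw [← mul_add]
    positivity
  segment_mem := by
    rintro s hs hs' _ ⟨a, c, ha, hc, hac, rfl⟩
    have h1 : 0 ≤ 1 - s := sub_nonneg.mpr hs'
    refine ⟨(1 - s) * a + s, (1 - s) * c, by positivity, by positivity, ?_, by module⟩
    rcases hs.eq_or_lt with rfl | h
    · simpa using hac
    · positivity

variable {N : ℕ} {e : ℕ → E}

theorem IsFrame.isStarCone_hemi (he : IsFrame N e) {ε : ℝ} (hε : ε * ε = 1) {j : ℕ} (hj : j ≤ N) :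
    IsStarCone (hemi e ε j) (ε • e j) where
  zero_notMem := by simp [hemi]
  smul_mem := by
    rintro r hr x hx
    rcases hx with ⟨i, hi, h⟩ | h
    · refine Or.inl ⟨i, hi, ?_⟩
      rw [inner_smul_right]
      exact mul_ne_zero hr.ne' h
    · refine Or.inr ?_
      rw [inner_smul_right, mul_left_comm]
      positivity
  segment_mem := by
    rintro s hs hs' x hx
    have hlast : ε * ⟪e j, (1 - s) • x + s • ε • e j⟫_ℝ = (1 - s) * (ε * ⟪e j, x⟫_ℝ) + s := by
      rw [inner_add_right, inner_smul_right, inner_smul_right, inner_smul_right, he.inner_self j hj]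
      linear_combination s * hε
    rcases hs'.eq_or_lt with rfl | hlt
    · right
      rw [hlast]
      simp
    · have h1 : 0 < 1 - s := sub_pos.mpr hlt
      rcases hx with ⟨i, hi, h⟩ | h
      · refine Or.inl ⟨i, hi, ?_⟩
        rw [inner_add_right, inner_smul_right, inner_smul_right, inner_smul_right,
          he.inner_of_ne i (by omega) j hj hi.ne, mul_zero, mul_zero, add_zero]
        exact mul_ne_zero h1.ne' h
      · refine Or.inr ?_
        rw [hlast]
        positivity

theorem IsFrame.arc_subset_hemi (he : IsFrame N e) {δ ε : ℝ} (hδ : δ * δ = 1) (hε : ε * ε = 1)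
    {j : ℕ} (hj : j ≤ N) (hj0 : 0 < j) : arc (δ • e 0) (ε • e j) ⊆ hemi e ε j := by
  rintro _ ⟨a, c, ha, hc, hac, rfl⟩
  rcases ha.eq_or_lt with rfl | ha
  · right
    rw [inner_add_right, inner_smul_right, inner_smul_right, inner_smul_right, inner_smul_right,
      he.inner_self j hj, he.inner_of_ne j hj 0 (by omega) hj0.ne']
    nlinarith
  · refine Or.inl ⟨0, hj0, ?_⟩
    rw [inner_add_right, inner_smul_right, inner_smul_right, inner_smul_right, inner_smul_right,
      he.inner_self 0 (by omega), he.inner_of_ne 0 (by omega) j hj hj0.ne]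
    have : δ ≠ 0 := fun h => by simp [h] at hδ
    simp [ha.ne', this]

theorem hemi_union_zero (e : ℕ → E) : hemi e 1 0 ∪ hemi e (-1) 0 = equator e 0 := by
  ext x
  simp only [hemi, equator, Set.mem_union, Set.mem_ofPred_eq, Nat.not_lt_zero, false_and,
    exists_false, false_or, Nat.le_zero, exists_eq_left, one_mul, neg_one_mul, neg_pos]
  rw [ne_iff_lt_or_gt, or_comm]

theorem hemi_inter_zero (e : ℕ → E) : hemi e 1 0 ∩ hemi e (-1) 0 = ∅ := by
  ext x
  simp only [hemi, Set.mem_inter_iff, Set.mem_ofPred_eq, Set.mem_empty_iff_false, iff_false]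
  rintro ⟨⟨i, hi, -⟩ | h, ⟨i, hi', -⟩ | h'⟩ <;> first | omega | linarith

theorem hemi_union (e : ℕ → E) (j : ℕ) :
    hemi e 1 (j + 1) ∪ hemi e (-1) (j + 1) = equator e (j + 1) := by
  ext x
  simp only [hemi, equator, Set.mem_union, Set.mem_ofPred_eq]
  constructor
  · rintro ((⟨i, hi, h⟩ | h) | (⟨i, hi, h⟩ | h))
    · exact ⟨i, hi.le, h⟩
    · exact ⟨j + 1, le_rfl, fun h0 => by simp [h0] at h⟩
    · exact ⟨i, hi.le, h⟩
    · exact ⟨j + 1, le_rfl, fun h0 => by simp [h0] at h⟩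
  · rintro ⟨i, hi, h⟩
    rcases hi.lt_or_eq with hi | rfl
    · exact Or.inl (Or.inl ⟨i, hi, h⟩)
    · rcases lt_or_gt_of_ne h with h | h
      · exact Or.inr (Or.inr (by linarith))
      · exact Or.inl (Or.inr (by linarith))

theorem hemi_inter (e : ℕ → E) (j : ℕ) :
    hemi e 1 (j + 1) ∩ hemi e (-1) (j + 1) = equator e j := by
  ext x
  simp only [hemi, equator, Set.mem_inter_iff, Set.mem_ofPred_eq]
  constructor
  · rintro ⟨⟨i, hi, h⟩ | h, ⟨i', hi', h'⟩ | h'⟩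
    · exact ⟨i, by omega, h⟩
    · exact ⟨i, by omega, h⟩
    · exact ⟨i', by omega, h'⟩
    · linarith
  · rintro ⟨i, hi, h⟩
    exact ⟨Or.inl ⟨i, by omega, h⟩, Or.inl ⟨i, by omega, h⟩⟩

theorem isOpen_hemi (e : ℕ → E) (ε : ℝ) (j : ℕ) : IsOpen (hemi e ε j) := by
  have h : hemi e ε j = (⋃ i : Fin j, {x | ⟪e i, x⟫_ℝ ≠ 0}) ∪ {x | 0 < ε * ⟪e j, x⟫_ℝ} := by
    ext x
    simp [hemi, Fin.exists_iff]
  rw [h]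
  refine IsOpen.union (isOpen_iUnion fun i => ?_) ?_
  · exact isOpen_ne_fun (by fun_prop) continuous_const
  · exact isOpen_lt continuous_const (by fun_prop)

/-! ### Spaces over a sphere -/

variable {A : Type*} [AddCommGroup A] {P : Type*} [TopologicalSpace P]
  {p : P → Metric.sphere (0 : E) 1}

/-- The part of the total space of `p` that lies over the subset `C` of the unit sphere. -/
abbrev partOver (p : P → Metric.sphere (0 : E) 1) (C : Set E) : Set P := {x | (p x : E) ∈ C}

omit [InnerProductSpace ℝ E] [TopologicalSpace P] in
theorem partOver_mono {C D : Set E} (h : C ⊆ D) : partOver p C ⊆ partOver p D := fun _ hx => h hx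

/-- Over an enlarged hemisphere with pole `ε • e j`, the total space has the cohomology of the fibre at the
equatorial point `δ • e 0`: both are compared with the fibre at the pole along an arc. -/
theorem LiftsContractions.bijective_res_hemi (hp : LiftsContractions A p) (he : IsFrame N e)
    {δ ε : ℝ} (hδ : δ * δ = 1) (hε : ε * ε = 1) {j : ℕ} (hj : j ≤ N) (hj0 : 0 < j)
    (h : partOver p {δ • e 0} ⊆ partOver p (hemi e ε j)) :
    Function.Bijective (Coh.res (A := A) h) := by
  have hin : ∀ {δ : ℝ}, δ * δ = 1 → ∀ {i}, i ≤ N → ⟪δ • e i, δ • e i⟫_ℝ = 1 := fun hδ i hi => by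
    rw [inner_smul_left, inner_smul_right, he.inner_self i hi, mul_one]
    exact hδ
  have hnorm : ∀ {δ : ℝ}, δ * δ = 1 → ∀ {i}, i ≤ N → δ • e i ∈ Metric.sphere (0 : E) 1 :=
    fun hδ i hi => by
      rw [mem_sphere_zero_iff_norm, ← sq_eq_sq₀ (norm_nonneg _) zero_le_one,
        ← real_inner_self_eq_norm_sq, hin hδ hi, one_pow]
  let u : Metric.sphere (0 : E) 1 := ⟨δ • e 0, hnorm hδ (by omega)⟩
  let v : Metric.sphere (0 : E) 1 := ⟨ε • e j, hnorm hε hj⟩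
  have huv : ⟪(u : E), (v : E)⟫_ℝ = 0 := by
    simp [u, v, inner_smul_left, inner_smul_right, he.inner_of_ne 0 (by omega) j hj hj0.ne]
  have hu : ∀ w : Metric.sphere (0 : E) 1, partOver p {(w : E)} = p ⁻¹' {w} :=
    fun w => by
      ext x
      simp [Subtype.ext_iff]
  have hvv : p ⁻¹' {v} ⊆ p ⁻¹' (Subtype.val ⁻¹' arc (u : E) v) := by
    intro x hx
    change (p x : E) ∈ arc (u : E) v
    rw [show p x = v from hx, arc_comm]
    exact left_mem_arc _ _
  have huu : p ⁻¹' {u} ⊆ p ⁻¹' (Subtype.val ⁻¹' arc (u : E) v) := by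
    intro x hx
    change (p x : E) ∈ arc (u : E) v
    rw [show p x = u from hx]
    exact left_mem_arc _ _
  have hsub : p ⁻¹' (Subtype.val ⁻¹' arc (u : E) v) ⊆ p ⁻¹' (Subtype.val ⁻¹' hemi e ε j) :=
    fun x hx => he.arc_subset_hemi hδ hε hj hj0 hx
  have hstar := isStarCone_arc (hin hδ (Nat.zero_le N)) (hin hε hj) huv
  have hstar' := isStarCone_arc (hin hε hj) (hin hδ (Nat.zero_le N))
    ((real_inner_comm (u : E) v).trans huv)
  rw [arc_comm] at hstar'
  have b1 := hp _ u (IsStarCone.contraction (q := u) hstar) huu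
  have b2 := hp _ v (IsStarCone.contraction (q := v) hstar') hvv
  have b3 := hp _ v (IsStarCone.contraction (q := v) (he.isStarCone_hemi hε hj)) (hvv.trans hsub)
  have b4 : Function.Bijective (Coh.res (A := A) hsub) := by
    rw [← Function.Bijective.of_comp_iff' b2]
    have : ⇑(Coh.res (A := A) hvv) ∘ ⇑(Coh.res (A := A) hsub) = Coh.res (hvv.trans hsub) :=
      funext fun x => Coh.res_res _ _ x
    rwa [this]
  have b5 := b1.comp b4
  have : ⇑(Coh.res (A := A) huu) ∘ ⇑(Coh.res (A := A) hsub) = Coh.res (huu.trans hsub) :=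
    funext fun x => Coh.res_res _ _ x
  rw [this] at b5
  have key : ∀ (F : Set P) (hF : F = p ⁻¹' {u}) (hF' : F ⊆ p ⁻¹' (Subtype.val ⁻¹' hemi e ε j)),
      Function.Bijective (Coh.res (A := A) hF') := by
    rintro _ rfl _
    exact b5
  exact key _ (hu u) h

theorem LiftsContractions.bijective_res_hemi_zero (hp : LiftsContractions A p) (he : IsFrame N e)
    {ε : ℝ} (hε : ε * ε = 1)
    (h : partOver p {ε • e 0} ⊆ partOver p (hemi e ε 0)) :
    Function.Bijective (Coh.res (A := A) h) := by
  have hnorm : ε • e 0 ∈ Metric.sphere (0 : E) 1 := by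
    rw [mem_sphere_zero_iff_norm, ← sq_eq_sq₀ (norm_nonneg _) zero_le_one,
      ← real_inner_self_eq_norm_sq, inner_smul_left, inner_smul_right, he.inner_self 0 (by omega)]
    simpa using hε
  have hu : partOver p {ε • e 0} = p ⁻¹' {⟨ε • e 0, hnorm⟩} := by
    ext x
    simp [Subtype.ext_iff]
  have key : ∀ (F : Set P) (_ : F = p ⁻¹' {⟨ε • e 0, hnorm⟩})
      (hF' : F ⊆ p ⁻¹' (Subtype.val ⁻¹' hemi e ε 0)), Function.Bijective (Coh.res (A := A) hF') := by
    rintro _ rfl hF'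
    exact hp _ _ (IsStarCone.contraction (q := ⟨ε • e 0, hnorm⟩)
      (he.isStarCone_hemi hε (by omega))) hF'
  exact key _ hu h

/-- The decomposition of the base sphere by enlarged hemispheres, lifted to the total space. -/
theorem LiftsContractions.isEquatorial (hp : LiftsContractions A p) (hpc : Continuous p)
    (he : IsFrame N e) :
    IsEquatorial A N (fun j => partOver p (equator e j))
      (fun j => partOver p (hemi e 1 j))
      (fun j => partOver p (hemi e (-1) j))
      (partOver p {(1 : ℝ) • e 0}) := by
  have hpc' : Continuous fun x => (p x : E) := by fun_prop
  have hsub : partOver p {(1 : ℝ) • e 0} ⊆ partOver p (hemi e 1 0) := by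
    refine partOver_mono ?_
    rintro _ rfl
    simp only [hemi, Set.mem_ofPred_eq, one_smul, one_mul, he.inner_self 0 (by omega)]
    exact Or.inr one_pos
  refine ⟨⟨(isOpen_hemi e 1 0).preimage hpc', (isOpen_hemi e (-1) 0).preimage hpc', ?_, ?_⟩,
    fun j hj => ⟨(isOpen_hemi e 1 _).preimage hpc', (isOpen_hemi e (-1) _).preimage hpc', ?_, ?_⟩,
    hsub, hp.bijective_res_hemi_zero he (by norm_num) hsub,
    fun j hj h => hp.bijective_res_hemi he (by norm_num) (by norm_num) (by omega) (by omega) h,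
    fun j hj h => hp.bijective_res_hemi he (by norm_num) (by norm_num) (by omega) (by omega) h⟩
  · exact congrArg (partOver p) (hemi_union_zero e)
  · exact congrArg (partOver p) (hemi_inter_zero e)
  · exact congrArg (partOver p) (hemi_union e j)
  · exact congrArg (partOver p) (hemi_inter e j)

omit [TopologicalSpace P] in
theorem IsFrame.partOver_equator (he : IsFrame N e) :
    partOver p (equator e N) = Set.univ := by
  refine Set.eq_univ_of_forall fun x => ?_
  by_contra h
  refine ne_zero_of_mem_unit_sphere (p x) (he.eq_zero _ fun i hi => ?_)
  by_contra hi'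
  exact h ⟨i, hi, hi'⟩

end


section

open scoped unitInterval InnerProductSpace

/-! ### Cohomology of spheres and of their loop spaces -/

theorem Coh.bijective_pull {A : Type*} [AddCommGroup A] {X Y : Type*} [TopologicalSpace X]
    [TopologicalSpace Y] (f : C(X, Y)) (g : C(Y, X)) (hgf : g.comp f = ContinuousMap.id X)
    (hfg : f.comp g = ContinuousMap.id Y) : Function.Bijective (Coh.pull (A := A) f) :=
  Function.bijective_iff_has_inverse.mpr ⟨Coh.pull g,
    fun x => (Coh.pull_pull g f x).trans (by rw [hfg, Coh.pull_id]),
    fun x => (Coh.pull_pull f g x).trans (by rw [hgf, Coh.pull_id])⟩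

theorem Coh.pull_injective_of_leftInverse {A : Type*} [AddCommGroup A] {X Y : Type*}
    [TopologicalSpace X] [TopologicalSpace Y] {f : C(X, Y)} {g : C(Y, X)}
    (h : f.comp g = ContinuousMap.id Y) : Function.Injective (Coh.pull (A := A) f) :=
  Function.LeftInverse.injective (g := Coh.pull g)
    fun x => (Coh.pull_pull g f x).trans (by rw [h, Coh.pull_id])

variable {A : Type*} [AddCommGroup A] {E : Type*} [NormedAddCommGroup E] [InnerProductSpace ℝ E]
  {N : ℕ} {e : ℕ → E}

theorem IsFrame.pole_subset_hemi (he : IsFrame N e) {ε : ℝ} (hε : ε * ε = 1) :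
    {ε • e 0} ⊆ hemi e ε 0 := by
  rintro _ rfl
  refine Or.inr ?_
  rw [inner_smul_right, he.inner_self 0 (by omega), mul_one, hε]
  exact one_pos

/-- Outside the degree `N`, the cohomology of an `N`-sphere comes from a point. -/
theorem IsFrame.exists_eq_pull (he : IsFrame N e) {i : ℕ} (hi : i ≠ N)
    {x : Coh A (Metric.sphere (0 : E) 1)} (hx : Coh.pr i x = x) :
    ∃ r, x = Coh.pull (ContinuousMap.const _ PUnit.unit.{1}) r := by
  have hp := liftsContractions_id (A := A) (B := Metric.sphere (0 : E) 1)
  have hq := hp.isEquatorial continuous_id he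
  have hbij : ∀ (v : E) (F : Set (Metric.sphere (0 : E) 1)) (_ : ‖v‖ = 1)
      (_ : ∀ x, x ∈ F ↔ (x : E) = v) (ψ : C(F, PUnit.{1})),
      Function.Bijective (Coh.pull (A := A) ψ) := by
    intro v F hv hF ψ
    refine Coh.bijective_pull ψ (ContinuousMap.const _ ⟨⟨v, by simpa using hv⟩, (hF _).mpr rfl⟩)
      (ContinuousMap.ext fun x => Subtype.ext (Subtype.ext ?_)) rfl
    exact ((hF _).mp x.2).symm
  have hnorm : ∀ ε : ℝ, ε * ε = 1 → ‖ε • e 0‖ = 1 := fun ε hε => by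
    rw [← sq_eq_sq₀ (norm_nonneg _) zero_le_one, ← real_inner_self_eq_norm_sq, inner_smul_left,
      inner_smul_right, he.inner_self 0 (by omega)]
    simpa using hε
  have hb1 := fun ψ => hbij _ (partOver (E := E) id {(1 : ℝ) • e 0})
    (hnorm 1 (by norm_num)) (fun x => Iff.rfl) ψ
  have hb2 := fun ψ => hbij _ (partOver (E := E) id {(-1 : ℝ) • e 0})
    (hnorm (-1) (by norm_num)) (fun x => Iff.rfl) ψ
  have hpole : partOver (E := E) id {(-1 : ℝ) • e 0} ⊆
      partOver (E := E) id (hemi e (-1) 0) :=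
    partOver_mono (he.pole_subset_hemi (by norm_num))
  obtain ⟨κ, hκ⟩ := hq.exists_isWangMap le_rfl (ContinuousMap.const _ PUnit.unit.{1}) (hb1 _) (by
    rw [← Function.Bijective.of_comp_iff' (hp.bijective_res_hemi_zero he (by norm_num) hpole)]
    convert hb2 (restr hpole (restr (hq.zero.right.trans (hq.W_zero_subset le_rfl))
      (ContinuousMap.const _ PUnit.unit.{1}))) using 1
    exact funext fun r => Coh.res_pull _ _ r)
  let ι : C(partOver (E := E) id (equator e N), Metric.sphere (0 : E) 1) :=
    ⟨Subtype.val, continuous_subtype_val⟩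
  obtain ⟨r, hr⟩ := hκ.exists_eq_pull (hb1 _).2 hi (x := Coh.pull ι x) (by rw [Coh.pr_pull, hx])
  let j : C(Metric.sphere (0 : E) 1, partOver (E := E) id (equator e N)) :=
    ⟨fun x => ⟨x, (he.partOver_equator (p := id)).ge (Set.mem_univ x)⟩, by fun_prop⟩
  have hjr := congrArg (Coh.pull j) hr
  rw [Coh.pull_pull, Coh.pull_pull, show ι.comp j = ContinuousMap.id _ from rfl, Coh.pull_id] at hjr
  exact ⟨r, hjr⟩

/-- The square of a class of degree `N` on an `N`-sphere vanishes, because the class vanishes on two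
open sets that cover the sphere. -/
theorem IsFrame.cup_self_eq_zero (he : IsFrame N e) (hN : 0 < N)
    {x : Coh A (Metric.sphere (0 : E) 1)} (hx : Coh.pr N x = x) (m : A →+ A →+ A) :
    Coh.cup m x x = 0 := by
  have hq := (liftsContractions_id (A := A) (B := Metric.sphere (0 : E) 1)).isEquatorial
    continuous_id he
  obtain ⟨k, rfl⟩ : ∃ k, N = k + 1 := ⟨N - 1, by omega⟩
  have hs := hq.succ k (by omega)
  have hF := hq.subset_W k.le_succ
  have : Subsingleton (partOver (E := E) id {(1 : ℝ) • e 0}) :=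
    ⟨fun x y => Subtype.ext (Subtype.ext (x.2.trans y.2.symm))⟩
  let ι : C(partOver (E := E) id (equator e (k + 1)),
    Metric.sphere (0 : E) 1) := ⟨Subtype.val, continuous_subtype_val⟩
  have h0 : Coh.res (hF.trans hs.inter) (Coh.pull ι x) = 0 := by
    rw [← hx, ← Coh.pr_pull, Coh.res_pr]
    exact Coh.pr_eq_zero_of_subsingleton k.succ_ne_zero _
  have h1 := hs.cup_eq_cup hF (hq.bijective_left k k.lt_succ_self _).1
    (hq.bijective_right k k.lt_succ_self _).1 m h0 (y := Coh.pull ι x) (y' := 0)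
    (by rw [h0, map_zero])
  rw [Coh.cup_zero_right, ← Coh.pull_cup] at h1
  let j : C(Metric.sphere (0 : E) 1,
      partOver (E := E) id (equator e (k + 1))) :=
    ⟨fun x => ⟨x, (he.partOver_equator (p := id)).ge (Set.mem_univ x)⟩, by fun_prop⟩
  refine Coh.pull_injective_of_leftInverse (f := ι) (g := j) rfl ?_
  rw [h1, map_zero]

/-- A class of degree `t * n` and square zero pulls back to zero on the loop space of a sphere of
dimension `n + 1`. -/
theorem IsFrame.pull_eq_zero {n t : ℕ} (he : IsFrame (n + 1) e) (hn : 0 < n)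
    (hpar : Even n ∨ Even t) (m : A →+ A →+ A) (hm : ∀ a, m a a = 0 → a = 0)
    (hc : ∀ (c : ℤ) (a : A), c ≠ 0 → c • a = 0 → a = 0) {b : Metric.sphere (0 : E) 1}
    (hb : e 0 = b) {Y : Type*} [TopologicalSpace Y] (f : C(LoopSpace _ b, Y)) {u : Coh A Y}
    (hu : Coh.pr (t * n) u = u) (huu : Coh.cup m u u = 0) : Coh.pull f u = 0 := by
  obtain ⟨k, rfl⟩ : ∃ k, n = k + 1 := ⟨n - 1, by omega⟩
  have hp := PathsFrom.liftsContractions_endpoint (A := A) b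
  have hq := hp.isEquatorial (PathsFrom.continuous_endpoint b) he
  -- the total space is the space of paths that start at `b`, which is contractible
  have hW : ∀ p ≠ 0, ∀ x : Coh A (partOver (PathsFrom.endpoint b) (equator e (k + 2))),
      Coh.pr p x = 0 := by
    intro p hp0 x
    let ι : C(partOver (PathsFrom.endpoint b) (equator e (k + 2)), PathsFrom b) :=
      ⟨Subtype.val, continuous_subtype_val⟩
    let j : C(PathsFrom b, partOver (PathsFrom.endpoint b) (equator e (k + 2))) :=
      ⟨fun γ => ⟨γ, (he.partOver_equator (p := PathsFrom.endpoint b)).ge (Set.mem_univ γ)⟩,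
        by fun_prop⟩
    refine Coh.pull_injective_of_leftInverse (f := j) (g := ι) rfl ?_
    rw [← Coh.pr_pull, PathsFrom.pr_eq_zero b hp0, map_zero]
  have hVU : hemi e (-1) 0 ⊆ hemi e 1 (k + 2) := by
    rintro x (⟨i, hi, -⟩ | h)
    · omega
    · exact Or.inl ⟨0, by omega, fun h0 => by simp [h0] at h⟩
  have hV := partOver_mono (p := PathsFrom.endpoint b) hVU
  have hpole := partOver_mono (p := PathsFrom.endpoint b)
    (he.pole_subset_hemi (ε := -1) (by norm_num))
  -- `V 0` does not contain the base point; it is compared with the top hemisphere at the point `-b`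
  have hV0 : Function.Bijective (Coh.res (A := A) hV) := by
    rw [← Function.Bijective.of_comp_iff' (hp.bijective_res_hemi_zero he (by norm_num) hpole)]
    have := hp.bijective_res_hemi he (δ := -1) (ε := 1) (by norm_num) (by norm_num) le_rfl
      (by omega) (hpole.trans hV)
    convert this using 1
    exact funext fun x => Coh.res_res _ _ x
  obtain ⟨θ, hθ⟩ := hq.exists_isWangDerivation hV hV0 hW
  -- the fibre of the endpoint map is the loop space
  have hfib : ∀ γ : PathsFrom b, γ ∈ partOver (PathsFrom.endpoint b) {(1 : ℝ) • e 0} ↔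
      γ.1 1 = b := fun γ => by
    rw [one_smul, hb]
    exact Subtype.ext_iff.symm
  let g : C(partOver (PathsFrom.endpoint b) {(1 : ℝ) • e 0}, LoopSpace _ b) :=
    ⟨fun γ => ⟨γ.1.1, γ.1.2, (hfib _).mp γ.2⟩, by
      refine continuous_induced_rng.mpr ?_
      exact continuous_subtype_val.comp continuous_subtype_val⟩
  let g' : C(LoopSpace _ b, partOver (PathsFrom.endpoint b) {(1 : ℝ) • e 0}) :=
    ⟨fun γ => ⟨⟨γ.toContinuousMap, γ.source⟩, (hfib _).mpr γ.target⟩,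
      (continuous_induced_dom.subtype_mk _).subtype_mk _⟩
  have hF : partOver (PathsFrom.endpoint b) {(1 : ℝ) • e 0} ⊆
      partOver (PathsFrom.endpoint b) (hemi e 1 (k + 2)) :=
    (hq.subset_W (j := k + 1) (by omega)).trans (hq.succ (k + 1) (by omega)).inter_left
  have hb' := hq.bijective_left (k + 1) (by omega) hF
  -- extend the class from the loop space to the hemisphere on which the derivation is defined
  obtain ⟨w, hw⟩ := hb'.2 (Coh.pull g (Coh.pull f u))
  have hw0 : w = 0 := by
    refine hθ.eq_zero_of_cup_self hn hpar m hm hc (hb'.1 ?_) (hb'.1 ?_)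
    · rw [Coh.res_pr, hw, Coh.pr_pull, Coh.pr_pull, hu]
    · rw [Coh.res_cup, hw, ← Coh.pull_cup, ← Coh.pull_cup, huu, map_zero, map_zero, map_zero]
  rw [hw0, map_zero] at hw
  exact Coh.pull_injective_of_leftInverse (f := g) (g := g') rfl (by rw [← hw, map_zero])

end


section

open scoped InnerProductSpace

/-! ### Change of coefficients -/

variable {E : Type*} [NormedAddCommGroup E] [InnerProductSpace ℝ E] {N : ℕ} {e : ℕ → E}

/-- On an `N`-sphere, a cocycle of degree `N` lifts through a surjection of coefficient groups whose
kernel is infinite cyclic, because `H^{N+1}` with integral coefficients vanishes. -/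
theorem IsFrame.exists_mapCoeff_eq {A Q : Type*} [AddCommGroup A] [AddCommGroup Q]
    (he : IsFrame N e) (φ : A →+ Q) (hφ : Function.Surjective φ) (ψ : ℤ →+ A)
    (hψ : Function.Injective ψ) (hker : ∀ a, φ a = 0 ↔ a ∈ Set.range ψ)
    {w : Cochain Q (Metric.sphere (0 : E) 1)} (hw : w.d = 0) (hwN : Cochain.pr N w = w) :
    ∃ W : Cochain A (Metric.sphere (0 : E) 1), W.d = 0 ∧ Cochain.pr N W = W ∧
      Cochain.mapCoeff φ W = w := by
  choose s hs using hφ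
  -- the coboundary of a lift `w₁` of `w` is an integral cocycle `z` of degree `N + 1`
  let w₁ : Cochain A (Metric.sphere (0 : E) 1) := Cochain.pr N fun p σ => s (w p σ)
  have hw₁ : Cochain.mapCoeff φ w₁ = w := by
    rw [← hwN]
    ext p σ
    by_cases hp : p = N
    · simp [w₁, Cochain.mapCoeff_apply, Cochain.pr_apply, hp, hs]
    · simp [w₁, Cochain.mapCoeff_apply, Cochain.pr_apply, hp]
  have hd : ∀ p σ, ∃ z : ℤ, ψ z = w₁.d p σ := fun p σ => by
    refine (hker _).mp ?_
    have := congrFun (congrFun (Cochain.d_mapCoeff φ w₁) p) σ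
    rw [hw₁, hw] at this
    exact this.symm
  choose z hz using hd
  have hzd : Cochain.mapCoeff ψ z = w₁.d := by
    ext p σ
    exact hz p σ
  have hinj : Function.Injective (Cochain.mapCoeff (X := Metric.sphere (0 : E) 1) ψ) :=
    fun a b h => funext fun p => funext fun σ => hψ (congrFun (congrFun h p) σ)
  have hzc : Cochain.d z = 0 := hinj (by rw [← Cochain.d_mapCoeff, hzd, Cochain.d_d, map_zero])
  have hzp : Cochain.pr (N + 1) z = z := hinj (by
    have : Cochain.mapCoeff ψ (Cochain.pr (N + 1) z) =
        Cochain.pr (N + 1) (Cochain.mapCoeff ψ z) := by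
      ext p σ
      by_cases hp : p = N + 1 <;> simp [Cochain.mapCoeff_apply, Cochain.pr_apply, hp]
    rw [this, hzd, ← Cochain.d_pr, Cochain.pr_pr_self])
  have hpr : Coh.pr (N + 1) (Coh.mk z hzc) = Coh.mk z hzc := by
    rw [Coh.pr_mk]
    congr 1
  obtain ⟨r, hr⟩ := he.exists_eq_pull N.succ_ne_self hpr
  have hz0 : Coh.mk z hzc = 0 := by
    rw [hr]
    exact Coh.pull_eq_zero_of_subsingleton N.succ_ne_zero (by rw [← hr, hpr])
  obtain ⟨v, hv⟩ := Coh.mk_eq_zero.mp hz0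
  refine ⟨Cochain.pr N (w₁ - Cochain.mapCoeff ψ v), ?_, Cochain.pr_pr_self _ _, ?_⟩
  · rw [Cochain.d_pr, map_sub, Cochain.d_mapCoeff, hv, hzd, sub_self, map_zero]
  · have hψφ : ∀ y, φ (ψ y) = 0 := fun y => (hker _).mpr ⟨y, rfl⟩
    rw [← hwN, ← hw₁]
    ext p σ
    by_cases hp : p = N <;> simp [Cochain.mapCoeff_apply, Cochain.pr_apply, hp, hψφ]

/-- A map from the loop space of a sphere of dimension `n + 1` to a sphere of dimension `t * n`
induces the same map in cohomology as a constant map, in each degree and for all coefficients that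
are a quotient of a group like `ℤ` or `ℚ` by an infinite cyclic group. -/
theorem IsFrame.exists_pull_loopSpace_eq {A Q : Type*} [AddCommGroup A] [AddCommGroup Q] {n t : ℕ}
    {E' : Type*} [NormedAddCommGroup E'] [InnerProductSpace ℝ E'] {e' : ℕ → E'}
    (he' : IsFrame (n + 1) e') {b : Metric.sphere (0 : E') 1} (hb : e' 0 = b)
    (he : IsFrame (t * n) e) (hn : 0 < n) (ht : 0 < t) (hpar : Even n ∨ Even t)
    (m : A →+ A →+ A) (hm : ∀ a, m a a = 0 → a = 0)
    (hc : ∀ (c : ℤ) (a : A), c ≠ 0 → c • a = 0 → a = 0)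
    (φ : A →+ Q) (hφ : Function.Surjective φ) (ψ : ℤ →+ A)
    (hψ : Function.Injective ψ) (hker : ∀ a, φ a = 0 ↔ a ∈ Set.range ψ)
    (f : C(LoopSpace _ b, Metric.sphere (0 : E) 1)) (i : ℕ)
    {u : Coh Q (Metric.sphere (0 : E) 1)} (hu : Coh.pr i u = u) :
    ∃ r, Coh.pull f u = Coh.pull (ContinuousMap.const _ PUnit.unit.{1}) r := by
  by_cases hi : i = t * n
  · subst hi
    obtain ⟨w, hw, hwu⟩ := Coh.exists_mk u
    have hpw : (Cochain.pr (t * n) w).d = 0 := by rw [Cochain.d_pr, hw, map_zero]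
    have hpu : u = Coh.mk (Cochain.pr (t * n) w) hpw := by rw [← hu, ← hwu, Coh.pr_mk]
    obtain ⟨W, hW, hWp, hWw⟩ :=
      he.exists_mapCoeff_eq φ hφ ψ hψ hker hpw (Cochain.pr_pr_self _ _)
    have hpU : Coh.pr (t * n) (Coh.mk W hW) = Coh.mk W hW := by
      rw [Coh.pr_mk]
      congr 1
    have h0 := he'.pull_eq_zero hn hpar m hm hc hb f hpU
      (he.cup_self_eq_zero (Nat.mul_pos ht hn) hpU m)
    rw [Coh.pull_mk, Coh.mk_eq_zero] at h0
    obtain ⟨v, hv⟩ := h0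
    refine ⟨0, ?_⟩
    rw [hpu, map_zero, Coh.pull_mk, Coh.mk_eq_zero]
    refine ⟨Cochain.mapCoeff φ v, ?_⟩
    rw [Cochain.d_mapCoeff, hv, ← hWw]
    rfl
  · obtain ⟨r, rfl⟩ := he.exists_eq_pull hi hu
    exact ⟨r, Coh.pull_pull _ _ _⟩

end

section

/-! ### Singular chains and cochains -/

open Simplicial Limits

variable {k : Type} [CommRing k] {Q : Type} [AddCommGroup Q] [Module k Q]
  {X Y : Type} [TopologicalSpace X] [TopologicalSpace Y]

variable (k X) in
/-- The singular chain complex of `X` with coefficients in `k`. -/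
abbrev chains : ChainComplex (ModuleCat.{0} k) ℕ :=
  (TopCat.toSSet.obj (TopCat.of X)).chainComplex (ModuleCat.of k k)

variable (k) in
/-- The chain map induced by a continuous map. -/
abbrev chainsMap (f : C(X, Y)) : chains k X ⟶ chains k Y :=
  SSet.chainComplexMap (TopCat.toSSet.map (TopCat.ofHom f)) _

/-- Singular simplices, as elements of the singular simplicial set. -/
def toSimp (n : ℕ) : (TopCat.toSSet.obj (TopCat.of X)) _⦋n⦌ ≃ Simp X n :=
  TopCat.toSSetObjEquiv (TopCat.of X) (.op ⦋n⦌)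

theorem toSimp_δ {n : ℕ} (i : Fin (n + 2)) (x : (TopCat.toSSet.obj (TopCat.of X)) _⦋n + 1⦌) :
    toSimp n ((TopCat.toSSet.obj (TopCat.of X)).δ i x) = (toSimp (n + 1) x).reindex i.succAbove :=
  rfl

theorem toSimp_map {n : ℕ} (f : C(X, Y)) (x : (TopCat.toSSet.obj (TopCat.of X)) _⦋n⦌) :
    toSimp n ((TopCat.toSSet.map (TopCat.ofHom f)).app _ x) = f.comp (toSimp n x) := rfl

variable (k) in
/-- The inclusion of the summand of the chains that belongs to a simplex. -/
abbrev simplexι {n : ℕ} (x : (TopCat.toSSet.obj (TopCat.of X)) _⦋n⦌) :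
    ModuleCat.of k k ⟶ (chains k X).X n :=
  (TopCat.toSSet.obj (TopCat.of X)).ιChainComplex x

/-- The linear functional on chains of degree `n` with given values on simplices. -/
def functional (n : ℕ) (w : Simp X n → Q) : (chains k X).X n ⟶ ModuleCat.of k Q :=
  Sigma.desc fun x => ModuleCat.ofHom (LinearMap.toSpanSingleton k Q (w (toSimp n x)))

theorem ι_functional (n : ℕ) (w : Simp X n → Q) (x : (TopCat.toSSet.obj (TopCat.of X)) _⦋n⦌) :
    simplexι k x ≫ functional n w =
      ModuleCat.ofHom (LinearMap.toSpanSingleton k Q (w (toSimp n x))) :=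
  Sigma.ι_desc _ _

theorem exists_eq_functional (n : ℕ) (u : (chains k X).X n ⟶ ModuleCat.of k Q) :
    ∃ w : Simp X n → Q, u = functional n w := by
  refine ⟨fun σ => (simplexι k ((toSimp n).symm σ) ≫ u).hom (1 : k), ?_⟩
  refine SSet.chainComplex_hom_ext fun x => ?_
  rw [ι_functional, Equiv.symm_apply_apply]
  ext
  simp

theorem functional_injective (n : ℕ) :
    Function.Injective (functional (k := k) (X := X) (Q := Q) n) := by
  intro w w' h
  ext σ
  have := congrArg (fun u => (simplexι k ((toSimp n).symm σ) ≫ u).hom (1 : k)) h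
  simpa [ι_functional] using this

theorem functional_add (n : ℕ) (w w' : Simp X n → Q) :
    functional (k := k) n (w + w') = functional n w + functional n w' := by
  refine SSet.chainComplex_hom_ext fun x => ?_
  rw [Preadditive.comp_add, ι_functional, ι_functional, ι_functional]
  ext
  simp

theorem functional_zero (n : ℕ) : functional (k := k) n (0 : Simp X n → Q) = 0 := by
  have := functional_add (k := k) n (0 : Simp X n → Q) 0
  rwa [add_zero, left_eq_add] at this

theorem d_comp_functional (n : ℕ) (w : Simp X n → Q) :
    (chains k X).d (n + 1) n ≫ functional n w =
      functional (n + 1) fun σ => altSum fun i => w (σ.reindex i.succAbove) := by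
  refine SSet.chainComplex_hom_ext fun x => ?_
  rw [SSet.ιChainComplex_d_assoc, ι_functional, Preadditive.sum_comp]
  ext
  simp [altSum, ι_functional, toSimp_δ]

theorem chainsMap_comp_functional (n : ℕ) (f : C(X, Y)) (w : Simp Y n → Q) :
    (chainsMap k f).f n ≫ functional n w = functional n fun σ => w (f.comp σ) := by
  refine SSet.chainComplex_hom_ext fun x => ?_
  rw [SSet.ι_chainComplexMap_f_assoc, ι_functional, ι_functional, toSimp_map]

/-- A map that induces the same map in cohomology as a constant map, with coefficients in a
cogenerator of the category of `k`-modules, is zero in reduced homology over `k`. -/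
theorem reducedHomologyMap_eq_zero (hQ : ∀ (M : Type) [AddCommGroup M] [Module k M] (z : M),
      z ≠ 0 → ∃ g : M →ₗ[k] Q, g z ≠ 0) (i : ℕ) (f : C(X, Y))
    (hf : ∀ u : Coh Q Y, Coh.pr i u = u →
      ∃ r, Coh.pull f u = Coh.pull (ContinuousMap.const _ PUnit.unit.{1}) r) :
    reducedHomologyMap k i f = 0 := by
  let c : C(X, PUnit.{1}) := ContinuousMap.const X PUnit.unit
  refine LinearMap.ext fun z => Subtype.ext ?_
  obtain ⟨z, hz⟩ := z
  change (HomologicalComplex.homologyMap (chainsMap k c) i).hom z = 0 at hz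
  change (HomologicalComplex.homologyMap (chainsMap k f) i).hom z = 0
  by_contra hne
  -- a functional on chains modulo boundaries that detects the image of `z`, seen as a cocycle
  obtain ⟨g, hg⟩ := hQ ((chains k Y).opcycles i)
    (((chains k Y).homologyι i).hom ((HomologicalComplex.homologyMap (chainsMap k f) i).hom z))
    fun h => hne ((ModuleCat.mono_iff_injective ((chains k Y).homologyι i)).mp inferInstance
      (h.trans (map_zero _).symm))
  obtain ⟨γ, hγ⟩ : ∃ γ : (chains k Y).opcycles i ⟶ ModuleCat.of k Q, γ.hom = g :=
    ⟨ModuleCat.ofHom g, rfl⟩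
  obtain ⟨w, hw⟩ := exists_eq_functional i ((chains k Y).pOpcycles i ≫ γ)
  have hdw : ∀ σ : Simp Y (i + 1), (altSum fun j => w (σ.reindex j.succAbove)) = 0 := by
    refine congrFun (functional_injective (k := k) (i + 1) ?_)
    rw [← d_comp_functional, ← hw, HomologicalComplex.d_pOpcycles_assoc, Limits.zero_comp]
    exact (functional_zero _).symm
  let W : Cochain Q Y := Pi.single (M := fun p => Simp Y p → Q) i w
  have hWi : W i = w := Pi.single_eq_same (M := fun p => Simp Y p → Q) i w
  have hWne : ∀ p, p ≠ i → W p = 0 := fun p hp => Pi.single_eq_of_ne (M := fun p => Simp Y p → Q) hp w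
  have hWd : W.d = 0 := by
    ext (_ | p) σ
    · rfl
    · rw [Cochain.d_succ]
      by_cases hp : p = i
      · subst hp
        rw [hWi]
        exact hdw σ
      · rw [hWne p hp]
        exact altSum_zero
  have hWpr : Cochain.pr i W = W := by
    ext p σ
    rw [Cochain.pr_apply]
    split_ifs with hp
    · rfl
    · rw [hWne p hp]
  obtain ⟨r, hr⟩ := hf (Coh.mk W hWd) (by rw [Coh.pr_mk]; congr 1)
  obtain ⟨R, hR, rfl⟩ := Coh.exists_mk r
  rw [Coh.pull_mk, Coh.pull_mk, ← sub_eq_zero, ← Coh.mk_sub, Coh.mk_eq_zero] at hr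
  obtain ⟨v, hv⟩ := hr
  have hdR : (chains k PUnit.{1}).d (i + 1) i ≫ functional i (R i) = 0 := by
    rw [d_comp_functional, ← functional_zero]
    exact congrArg _ (funext fun σ => congrFun (congrFun hR (i + 1)) σ)
  have hdw' : (chains k Y).d (i + 1) i ≫ functional i w = 0 := by
    rw [← hw, HomologicalComplex.d_pOpcycles_assoc, Limits.zero_comp]
  have hsum : (chainsMap k f).f i ≫ functional i w =
      (chainsMap k c).f i ≫ functional i (R i) + functional i (v.d i) := by
    rw [chainsMap_comp_functional, chainsMap_comp_functional, ← functional_add, hv]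
    congr 1
    ext σ
    simp [Cochain.pull_apply, hWi, c]
  have hbd : ∃ (i' : ℕ) (x : (chains k X).X i' ⟶ ModuleCat.of k Q),
      functional i (v.d i) = (chains k X).d i i' ≫ x := by
    cases i with
    | zero => exact ⟨0, 0, by
      rw [Limits.comp_zero]
      exact (congrArg _ (funext fun σ => Cochain.d_zero ..)).trans (functional_zero 0)⟩
    | succ j =>
      refine ⟨j, functional j (v j), ?_⟩
      rw [d_comp_functional]
      exact congrArg _ (funext fun σ => Cochain.d_succ ..)
  obtain ⟨i', x, hx⟩ := hbd
  have hprev : (ComplexShape.down ℕ).prev i = i + 1 := by simp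
  have hgd : γ = (chains k Y).descOpcycles (functional i w) (i + 1) hprev hdw' := by
    rw [← cancel_epi ((chains k Y).pOpcycles i), HomologicalComplex.p_descOpcycles, hw]
  have key : HomologicalComplex.homologyMap (chainsMap k f) i ≫ (chains k Y).homologyι i ≫
      γ = HomologicalComplex.homologyMap (chainsMap k c) i ≫
        (chains k PUnit.{1}).homologyι i ≫
          (chains k PUnit.{1}).descOpcycles (functional i (R i)) (i + 1) hprev hdR := by
    rw [hgd, HomologicalComplex.homologyι_naturality_assoc,
      HomologicalComplex.homologyι_naturality_assoc,
      HomologicalComplex.opcyclesMap_comp_descOpcycles,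
      HomologicalComplex.opcyclesMap_comp_descOpcycles, ← sub_eq_zero, ← Preadditive.comp_sub]
    rw [← (chains k X).homologyι_descOpcycles_eq_zero_of_boundary (functional i (v.d i)) (i + 1)
      hprev x hx]
    congr 1
    rw [← cancel_epi ((chains k X).pOpcycles i), Preadditive.comp_sub,
      HomologicalComplex.p_descOpcycles, HomologicalComplex.p_descOpcycles,
      HomologicalComplex.p_descOpcycles, hsum, add_sub_cancel_left]
  subst hγ
  refine hg ((congrArg (fun φ => φ.hom z) key).trans (Eq.trans ?_
    (map_zero ((chains k PUnit.{1}).homologyι i ≫ (chains k PUnit.{1}).descOpcycles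
      (functional i (R i)) (i + 1) hprev hdR).hom)))
  exact congrArg ((chains k PUnit.{1}).homologyι i ≫ (chains k PUnit.{1}).descOpcycles
    (functional i (R i)) (i + 1) hprev hdR).hom hz

end


section

/-! ### Loop spaces of standard spheres -/

/-- A point of the standard sphere is the first vector of a frame. -/
theorem exists_isFrame_eq {d : ℕ} (b : StdSphere d) :
    ∃ e : ℕ → EuclideanSpace ℝ (Fin (d + 1)), IsFrame d e ∧ e 0 = b := by
  obtain ⟨v, hv⟩ := Orthonormal.exists_orthonormalBasis_extension_of_card_eq (𝕜 := ℝ)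
    (E := EuclideanSpace ℝ (Fin (d + 1))) (ι := Fin (d + 1)) (by simp) (v := fun _ => (b : _))
    (s := {0}) ⟨fun i => by simp, fun i j hij => (hij (Subsingleton.elim i j)).elim⟩
  exact ⟨_, isFrame_of_orthonormalBasis v, hv 0 rfl⟩

/-- The case of integral homology, by cohomology with coefficients `ℚ/ℤ`. -/
theorem reducedHomologyMap_int_eq_zero {n t : ℕ} (hn : 0 < n) (ht : 0 < t)
    (hpar : Even n ∨ Even t) (b : StdSphere (n + 1))
    (f : C(LoopSpace (StdSphere (n + 1)) b, StdSphere (t * n))) (i : ℕ) :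
    reducedHomologyMap ℤ i f = 0 := by
  obtain ⟨e', he', hb⟩ := exists_isFrame_eq b
  have he := isFrame_of_orthonormalBasis (EuclideanSpace.basisFun (Fin (t * n + 1)) ℝ)
  refine reducedHomologyMap_eq_zero (Q := AddCircle (1 : ℚ)) (fun M _ _ z hz => ?_) i f fun u hu =>
    he'.exists_pull_loopSpace_eq hb he hn ht hpar (A := ℚ) AddMonoidHom.mul
      (fun a ha => mul_self_eq_zero.mp ha) (fun c a hc ha => ?_)
      (QuotientAddGroup.mk' _) (QuotientAddGroup.mk'_surjective _) (Int.castAddHom ℚ)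
      Int.cast_injective (fun a => ?_) f i hu
  · obtain ⟨g, hg⟩ := CharacterModule.exists_character_apply_ne_zero_of_ne_zero hz
    exact ⟨{ g with map_smul' := fun r x => map_intCast_smul g ℤ ℤ r x }, hg⟩
  · simpa [hc] using ha
  · rw [QuotientAddGroup.mk'_apply, QuotientAddGroup.eq_zero_iff, AddSubgroup.mem_zmultiples_iff]
    simp

/-- The case of homology modulo two, by cohomology with coefficients `ℤ/2`. -/
theorem reducedHomologyMap_zmod_two_eq_zero {n t : ℕ} (hn : 0 < n) (ht : 0 < t)
    (hpar : Even n ∨ Even t) (b : StdSphere (n + 1))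
    (f : C(LoopSpace (StdSphere (n + 1)) b, StdSphere (t * n))) (i : ℕ) :
    reducedHomologyMap (ZMod 2) i f = 0 := by
  have : Fact (Nat.Prime 2) := ⟨Nat.prime_two⟩
  obtain ⟨e', he', hb⟩ := exists_isFrame_eq b
  have he := isFrame_of_orthonormalBasis (EuclideanSpace.basisFun (Fin (t * n + 1)) ℝ)
  refine reducedHomologyMap_eq_zero (Q := ZMod 2) (fun M _ _ z hz => ?_) i f fun u hu =>
    he'.exists_pull_loopSpace_eq hb he hn ht hpar (A := ℤ) AddMonoidHom.mul
      (fun a ha => mul_self_eq_zero.mp ha) (fun c a hc ha => ?_)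
      (Int.castAddHom (ZMod 2)) ZMod.intCast_surjective (AddMonoidHom.mulLeft 2)
      (mul_right_injective₀ two_ne_zero) (fun a => ?_) f i hu
  · by_contra! h
    exact hz ((Module.forall_dual_apply_eq_zero_iff (ZMod 2) z).mp h)
  · simpa [hc] using ha
  · refine (ZMod.intCast_zmod_eq_zero_iff_dvd a 2).trans ?_
    exact exists_congr fun c => eq_comm

end

end SingularCohomology

end

/-- Every continuous map from the loop space of `S^(n+1)` (based loops at an arbitrary point `b`,
compact-open topology) to `S^(tn)` is zero on reduced homology, integrally and mod 2. -/
theorem mainTheorem5 (n t : ℕ) (hn : 0 < n) (ht : 1 < t)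
    (hpar : Odd (n + 1) ∨ (Even (n + 1) ∧ Even t))
    (b : StdSphere (n + 1)) (f : C(LoopSpace (StdSphere (n + 1)) b, StdSphere (t * n))) :
    (∀ i : ℕ, reducedHomologyMap ℤ i f = 0) ∧
      (∀ i : ℕ, reducedHomologyMap (ZMod 2) i f = 0) := by
  have hpar' : Even n ∨ Even t := hpar.imp (fun h => by simpa [Nat.odd_add_one] using h) And.right
  exact ⟨SingularCohomology.reducedHomologyMap_int_eq_zero hn (by omega) hpar' b f,
    SingularCohomology.reducedHomologyMap_zmod_two_eq_zero hn (by omega) hpar' b f⟩
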